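/- **Setting.** Let $C=(C_{i,j})_{1\le i,j\le n}$ be a symmetrizable generalized Cartan matrix, $r_1,\dots,r_n\geq 1$ integers such that $B=(r_iC_{i,j})$ is symmetric, and $(\mathfrak h,\{\alpha_i\},\{\alpha_i^\vee\})$ a realization of $C$ over $\mathbb Q$ (so $\dim_{\mathbb Q}\mathfrak h=2n-\mathrm{rank}\,C$, the $\alpha_i\in\mathfrak h^*$ and the $\alpha_i^\vee\in\mathfrak h$ are linearly independent, $\alpha_j(\alpha_i^\vee)=C_{i,j}$). Let $q\in\mathbb C^*$ be not a root of unity, with fixed rational powers $q^x$ (a homomorphism $x\mapsto q^x$, $(\mathbb Q,+)\to\mathbb C^*$, with $q^1=q$); put $q_i=q^{r_i}$, $[m]_q=\frac{q^m-q^{-m}}{q-q^{-1}}$. Let $\tilde{\mathcal U}=\tilde{\mathcal U}_q(\hat{\mathfrak g})$ be the $\mathbb C$-algebra with generators $x^\pm_{i,r}$ ($r\in\mathbb Z$), $k_h$ ($h\in\mathfrak h$), $h_{i,m}$ ($m\in\mathbb Z\setminus\{0\}$), $1\le i\le n$, and relations $$k_hk_{h'}=k_{h+h'},\quad k_0=1,\quad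 [k_h,h_{j,m}]=0,\quad [h_{i,m},h_{j,m'}]=0,\quad k_hx^\pm_{j,r}k_{-h}=q^{\pm\alpha_j(h)}x^\pm_{j,r},$$ $$[h_{i,m},x^\pm_{j,r}]=\pm\tfrac1m[mB_{i,j}]_q\,x^\pm_{j,m+r},\qquad [x^+_{i,r},x^-_{j,r'}]=\delta_{i,j}\frac{\phi^+_{i,r+r'}-\phi^-_{i,r+r'}}{q_i-q_i^{-1}},$$ $$x^\pm_{i,r+1}x^\pm_{j,r'}-q^{\pm B_{i,j}}x^\pm_{j,r'}x^\pm_{i,r+1}=q^{\pm B_{i,j}}x^\pm_{i,r}x^\pm_{j,r'+1}-x^\pm_{j,r'+1}x^\pm_{i,r},$$ where $\sum_{m\ge0}\phi^\pm_{i,\pm m}z^{\pm m}=k_{\pm r_i\alpha_i^\vee}\exp\bigl(\pm(q-q^{-1})\sum_{m\ge1}h_{i,\pm m}z^{\pm m}\bigr)$ and $\phi^+_{i,m}=0$ for $m<0$, $\phi^-_{i,m}=0$ for $m>0$. Let $\mathcal C=\mathbb C((u))$ and $\tilde{\mathcal U}'=\mathcal C\otimes_{\mathbb C}\tilde{\mathcal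 U}$. **Categories.** For a module $V$ and $\omega\in\mathfrak h^*$ let $V_\omega=\{v: k_hv=q^{\omega(h)}v\ \forall h\in\mathfrak h\}$. Write $\omega\le\mu$ if $\mu-\omega\in\sum_i\mathbb N\alpha_i$. A $\tilde{\mathcal U}$-module $V$ is in $\mathcal O(\tilde{\mathcal U})$ if $V=\bigoplus_\omega V_\omega$, all $V_\omega$ are finite dimensional, and there are $\lambda_1,\dots,\lambda_s\in\mathfrak h^*$ such that every $\omega$ with $V_\omega\ne0$ satisfies $\omega\le\lambda_j$ for some $j$. For a family $\Psi=(\Psi^\pm_{i,\pm m})_{1\le i\le n,\,m\ge0}$ of scalars let $$V_{\omega,\Psi}=\{v\in V_\omega:\ \exists p\ \forall i\ \forall m\ge 0,\ (\phi^\pm_{i,\pm m}-\Psi^\pm_{i,\pm m})^pv=0\}.$$ An $l$-weight (resp. $l,u$-weight) is a pair $(\omega,\Psi)$ with $\Psi^\pm_{i,\pm m}\in\mathbb C$ (resp. $\in\mathbb C[u,u^{-1}]$) and $\Psi^\pm_{i,0}=q_i^{\pm\omega(\alpha_i^\vee)}$; it is an $l$-weight (resp. $l,u$-weight) of $V$ if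 $V_{\omega,\Psi}\ne0$. A $\tilde{\mathcal U}'$-module $V$ is in $\mathcal O(\tilde{\mathcal U}')$ if it satisfies the same three conditions (over $\mathcal C$) and $V_\omega=\bigoplus_{\Psi}V_{\omega,\Psi}$ for every $\omega$, the sum being over the $\Psi$ such that $(\omega,\Psi)$ is an $l,u$-weight. For an integer $R\ge0$, $V$ is in $\mathcal O^R(\tilde{\mathcal U}')$ if moreover there are $\mathcal C$-bases of all the $V_\omega$ in which the matrix coefficients of $x^\pm_{i,m}:V_\omega\to V_{\omega\pm\alpha_i}$ are in $\mathbb C[[u]]$ if $m\ge0$ and in $u^{Rm}\mathbb C[[u]]$ if $m\le0$, those of $\phi^-_{i,-m}$ are in $u^{-mR}\mathbb C[[u]]$ and those of $\phi^+_{i,m}$ are in $\mathbb C[[u]]$ ($m\ge0$). **Theorem.** There is a unique morphism of $\mathcal C$-algebras $\Delta_u:\tilde{\mathcal U}'\to(\tilde{\mathcal U}\otimes_{\mathbb C}\tilde{\mathcal U})((u))$ such that $$\Delta_u(x^+_{i,r})=x^+_{i,r}\otimes1+\sum_{l\ge0}u^{r+l}\,\phi^-_{i,-l}\otimes x^+_{i,r+l},\qquad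 \Delta_u(x^-_{i,r})=u^r(1\otimes x^-_{i,r})+\sum_{l\ge0}u^l\,x^-_{i,r-l}\otimes\phi^+_{i,l},$$ $$\Delta_u(\phi^\pm_{i,\pm m})=\sum_{0\le l\le m}u^{\pm l}\,\phi^\pm_{i,\pm(m-l)}\otimes\phi^\pm_{i,\pm l}\ (m\ge0),\qquad \Delta_u(k_h)=k_h\otimes k_h.$$ Let $V_1\in\mathcal O(\tilde{\mathcal U})$, $R\ge0$ and $V_2\in\mathcal O^R(\tilde{\mathcal U}')$, and let $i(V_1)=\mathcal C\otimes_{\mathbb C}V_1$ be the $\tilde{\mathcal U}'$-module obtained by extension of scalars. Then $\Delta_u$ defines a structure of $\tilde{\mathcal U}'$-module on $i(V_1)\otimes_{\mathcal C}V_2$: there is exactly one such structure for which, for all $g\in\tilde{\mathcal U}'$ with $\Delta_u(g)=\sum_m u^mt_m$ ($t_m\in\tilde{\mathcal U}\otimes_{\mathbb C}\tilde{\mathcal U}$) and all $y\in i(V_1)\otimes_{\mathcal C}V_2$, the series $\sum_m u^m\,t_m y$ converges $u$-adically (with respect to the $\mathbb C[[u]]$-span of some finite set of vectors) to $g\,y$.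 With this structure, $i(V_1)\otimes_{\mathcal C}V_2$ is in $\mathcal O^{R+1}(\tilde{\mathcal U}')$. Moreover its $l,u$-weights are exactly the pairs $(\lambda_1+\lambda_2,\gamma_1(z)\gamma_2(uz))$, where $(\lambda_1,\gamma_1)$ is an $l$-weight of $V_1$, $(\lambda_2,\gamma_2)$ is an $l,u$-weight of $V_2$, and $\gamma=\gamma_1(z)\gamma_2(uz)$ means $\gamma^\pm_{i,\pm m}=\sum_{0\le l\le m}(\gamma_1)^\pm_{i,\pm l}(\gamma_2)^\pm_{i,\pm(m-l)}u^{\pm(m-l)}$. -/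

import Mathlib

open scoped TensorProduct

namespace QAff

noncomputable section

/-- The field `𝒞 = ℂ((u))` of formal Laurent series (a type of its own, so that it carries only one
`ℂ`-algebra structure for instance search, the coefficientwise one). -/
def LC : Type := LaurentSeries ℂ

instance : Field LC := inferInstanceAs (Field (LaurentSeries ℂ))

instance : Algebra ℂ LC := (HahnSeries.instAlgebra : Algebra ℂ (LaurentSeries ℂ))

/-- The coefficient of `u ^ m`. -/
def LC.coeff (c : LC) (m : ℤ) : ℂ := HahnSeries.coeff (c : LaurentSeries ℂ) m

/-- The power `u ^ m` in `ℂ((u))`. -/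
def uPow (m : ℤ) : LC := (HahnSeries.single m 1 : LaurentSeries ℂ)

/-- A symmetrizable generalized Cartan matrix `C` with symmetrizing integers `r_i`, a realization of
it on a finite dimensional `ℚ`-vector space `H` (written `𝔥` in the comments below), and a
parameter `q ∈ ℂ^*`, not a root of unity, together with the rational powers of `q`, that is,
a homomorphism `x ↦ q ^ x` from `(ℚ, +)` to `ℂ^*`, where `q = q ^ 1`. -/
structure Datum (n : ℕ) (H : Type*) [AddCommGroup H] [Module ℚ H] where
  /-- the generalized Cartan matrix -/
  C : Matrix (Fin n) (Fin n) ℤ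
  C_diag : ∀ i, C i i = 2
  C_offdiag : ∀ i j, i ≠ j → C i j ≤ 0
  C_zero : ∀ i j, C i j = 0 ↔ C j i = 0
  /-- the positive integers `r_i` such that `diag(r_1, ..., r_n) C` is symmetric -/
  r : Fin n → ℕ
  r_pos : ∀ i, 0 < r i
  symm : ∀ i j, (r i : ℤ) * C i j = (r j : ℤ) * C j i
  finite : Module.Finite ℚ H
  /-- `dim 𝔥 = 2 n - rank C` -/
  dim : Module.finrank ℚ H + (C.map (Int.cast : ℤ → ℚ)).rank = 2 * n
  /-- the simple roots `α_i` -/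
  root : Fin n → Module.Dual ℚ H
  /-- the simple coroots `α_i^∨` -/
  coroot : Fin n → H
  root_indep : LinearIndependent ℚ root
  coroot_indep : LinearIndependent ℚ coroot
  pairing : ∀ i j, root j (coroot i) = (C i j : ℚ)
  /-- the rational powers of `q` -/
  qpow : Multiplicative ℚ →* ℂˣ
  not_root_of_unity : ∀ m : ℕ, 0 < m → qpow (Multiplicative.ofAdd 1) ^ m ≠ 1

variable {n : ℕ} {H : Type*} [AddCommGroup H] [Module ℚ H] (D : Datum n H)

/-! ### The algebra `Ũ_q(ĝ)` -/

/-- `q ^ x` for rational `x`. -/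
def Datum.qp (x : ℚ) : ℂ := (D.qpow (Multiplicative.ofAdd x) : ℂˣ)

/-- `B_{i,j} = r_i C_{i,j}`. -/
def Datum.B (i j : Fin n) : ℤ := (D.r i : ℤ) * D.C i j

/-- The `q`-integer `[m]_q = (q^m - q^{-m}) / (q - q^{-1})`. -/
def Datum.qInt (m : ℤ) : ℂ :=
  (D.qp (m : ℚ) - D.qp (-(m : ℚ))) / (D.qp 1 - D.qp (-1))

/-- The generators `x_{i,r}^±` (the sign being `ε`), `k_h` and `h_{i,m}` (`m ≠ 0`). -/
inductive Gen (n : ℕ) (H : Type*) : Type _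
  | x (ε : ℤˣ) (i : Fin n) (r : ℤ) : Gen n H
  | k (h : H) : Gen n H
  | h (i : Fin n) (m : {m : ℤ // m ≠ 0}) : Gen n H

/-- The free algebra on the generators. -/
abbrev Free (n : ℕ) (H : Type*) : Type _ := FreeAlgebra ℂ (Gen n H)

def xF (ε : ℤˣ) (i : Fin n) (r : ℤ) : Free n H := FreeAlgebra.ι ℂ (Gen.x ε i r)

def kF (h : H) : Free n H := FreeAlgebra.ι ℂ (Gen.k h)

/-- `h_{i,m}` for `m ≠ 0`, and `0` for `m = 0`. -/
def hF (i : Fin n) (m : ℤ) : Free n H :=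
  if hm : m ≠ 0 then FreeAlgebra.ι ℂ (Gen.h i ⟨m, hm⟩) else 0

/-- The coefficient of `z ^ m` in `exp(f)`, for a power series `f` without constant term
(so that `f ^ j` does not contribute to this coefficient for `j > m`). -/
def expCoeff {A : Type*} [Ring A] [Algebra ℂ A] (f : PowerSeries A) (m : ℕ) : A :=
  ∑ j ∈ Finset.range (m + 1), ((j.factorial : ℂ)⁻¹) • PowerSeries.coeff m (f ^ j)

/-- `phiF ε i m` is `φ^ε_{i, ε m}` (`m ≥ 0`), the coefficient of `z^{ε m}` in
`k_{ε r_i α_i^∨} exp(ε (q - q⁻¹) ∑_{p ≥ 1} h_{i, ε p} z^{ε p})`. -/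
def phiF (ε : ℤˣ) (i : Fin n) (m : ℕ) : Free n H :=
  kF (((ε : ℤ) * (D.r i : ℤ)) • D.coroot i) *
    expCoeff (PowerSeries.mk fun p : ℕ =>
      (((ε : ℤ) : ℂ) * (D.qp 1 - D.qp (-1))) • (hF i ((ε : ℤ) * (p : ℤ)) : Free n H)) m

/-- `phiZF ε i r` is `φ^ε_{i, r}` for `r ∈ ℤ`; it vanishes unless `ε r ≥ 0`. -/
def phiZF (ε : ℤˣ) (i : Fin n) (r : ℤ) : Free n H :=
  if 0 ≤ (ε : ℤ) * r then phiF D ε i ((ε : ℤ) * r).toNat else 0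

/-- The defining relations of `Ũ_q(ĝ)`: all the relations of the quantum affinization
except the affine quantum Serre relations. -/
inductive Rel : Free n H → Free n H → Prop
  | k_mul (h h' : H) : Rel (kF h * kF h') (kF (h + h'))
  | k_zero : Rel (kF 0) 1
  | k_h (h : H) (j : Fin n) (m : ℤ) (hm : m ≠ 0) : Rel (kF h * hF j m) (hF j m * kF h)
  | h_h (i j : Fin n) (m m' : ℤ) (hm : m ≠ 0) (hm' : m' ≠ 0) :
      Rel (hF i m * hF j m') (hF j m' * hF i m)
  | k_x (h : H) (ε : ℤˣ) (j : Fin n) (r : ℤ) :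
      Rel (kF h * xF ε j r * kF (-h)) (D.qp (((ε : ℤ) : ℚ) * D.root j h) • xF ε j r)
  | h_x (i j : Fin n) (m : ℤ) (hm : m ≠ 0) (ε : ℤˣ) (r : ℤ) :
      Rel (hF i m * xF ε j r - xF ε j r * hF i m)
        ((((ε : ℤ) : ℂ) * ((m : ℂ)⁻¹ * D.qInt (m * D.B i j))) • xF ε j (m + r))
  | x_x (i j : Fin n) (r r' : ℤ) :
      Rel (xF 1 i r * xF (-1) j r' - xF (-1) j r' * xF 1 i r)
        (if i = j then
          (D.qp (D.r i : ℚ) - D.qp (-(D.r i : ℚ)))⁻¹ •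
            (phiZF D 1 i (r + r') - phiZF D (-1) i (r + r'))
         else 0)
  | x_quad (ε : ℤˣ) (i j : Fin n) (r r' : ℤ) :
      Rel (xF ε i (r + 1) * xF ε j r'
            - D.qp (((ε : ℤ) * D.B i j : ℤ) : ℚ) • (xF ε j r' * xF ε i (r + 1)))
          (D.qp (((ε : ℤ) * D.B i j : ℤ) : ℚ) • (xF ε i r * xF ε j (r' + 1))
            - xF ε j (r' + 1) * xF ε i r)

/-- The `ℂ`-algebra `Ũ_q(ĝ)`. -/
def Ut : Type _ := RingQuot (Rel D)

instance : Ring (Ut D) := inferInstanceAs (Ring (RingQuot (Rel D)))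

instance : Algebra ℂ (Ut D) := inferInstanceAs (Algebra ℂ (RingQuot (Rel D)))

/-- The quotient map from the free algebra. -/
def mkU : Free n H →ₐ[ℂ] Ut D := RingQuot.mkAlgHom ℂ (Rel D)

def Ut.x (ε : ℤˣ) (i : Fin n) (r : ℤ) : Ut D := mkU D (xF ε i r)

def Ut.k (h : H) : Ut D := mkU D (kF h)

/-- `Ut.phi D ε i m` is `φ^ε_{i, ε m}` for `m ≥ 0`. -/
def Ut.phi (ε : ℤˣ) (i : Fin n) (m : ℕ) : Ut D := mkU D (phiF D ε i m)

/-- The `ℂ((u))`-algebra `Ũ'_q(ĝ) = ℂ((u)) ⊗ Ũ_q(ĝ)`. -/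
abbrev Ut' : Type _ := LC ⊗[ℂ] Ut D

/-- The inclusion `Ũ_q(ĝ) → Ũ'_q(ĝ)`. -/
def incl : Ut D →ₐ[ℂ] Ut' D := Algebra.TensorProduct.includeRight

/-! ### The completed tensor product and the deformed coproduct -/

/-- The completion `(Ũ_q(ĝ) ⊗_ℂ Ũ_q(ĝ))((u))` of `Ũ'_q(ĝ) ⊗ Ũ'_q(ĝ)`. -/
abbrev UtCompl : Type _ := LaurentSeries (Ut D ⊗[ℂ] Ut D)

/-- The inclusion of scalars `ℂ((u)) → A((u))`. -/
def laurentScalars (A : Type*) [Ring A] [Algebra ℂ A] : LC →+* LaurentSeries A where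
  toFun c := HahnSeries.map (c : LaurentSeries ℂ) (algebraMap ℂ A)
  map_zero' := by
    ext m
    exact map_zero (algebraMap ℂ A)
  map_one' := by
    ext m
    change algebraMap ℂ A ((1 : LaurentSeries ℂ).coeff m) = _
    by_cases hm : m = 0 <;> simp [HahnSeries.coeff_one, hm]
  map_add' a b := by
    ext m
    exact map_add (algebraMap ℂ A) _ _
  map_mul' a b := HahnSeries.map_mul ((algebraMap ℂ A : ℂ →+* A) : ℂ →ₙ+* A)

theorem laurentScalars_commute (A : Type*) [Ring A] [Algebra ℂ A] (c : LC) (t : LaurentSeries A) :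
    laurentScalars A c * t = t * laurentScalars A c := by
  ext a
  rw [HahnSeries.coeff_mul, HahnSeries.coeff_mul]
  refine Finset.sum_equiv (Equiv.prodComm _ _) (fun _ => Finset.swap_mem_antidiagonal.symm) ?_
  intro p _
  change algebraMap ℂ A (c.coeff p.1) * t.coeff p.2 = t.coeff p.2 * algebraMap ℂ A (c.coeff p.1)
  exact Algebra.commutes (c.coeff p.1) (t.coeff p.2)

instance : Algebra LC (UtCompl D) :=
  (laurentScalars (Ut D ⊗[ℂ] Ut D)).toAlgebra' (laurentScalars_commute _)

/-- The defining formulas of the deformed new Drinfel'd coproduct `Δ_u`: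
`Δ_u(x_{i,r}^+) = x_{i,r}^+ ⊗ 1 + ∑_{l ≥ 0} u^{r+l} φ_{i,-l}^- ⊗ x_{i,r+l}^+`,
`Δ_u(x_{i,r}^-) = u^r (1 ⊗ x_{i,r}^-) + ∑_{l ≥ 0} u^l x_{i,r-l}^- ⊗ φ_{i,l}^+`,
`Δ_u(φ_{i,±m}^±) = ∑_{0 ≤ l ≤ m} u^{±l} φ_{i,±(m-l)}^± ⊗ φ_{i,±l}^±`, `Δ_u(k_h) = k_h ⊗ k_h`. -/
structure IsDrinfeldCoproduct (Δ : Ut' D →ₐ[LC] UtCompl D) : Prop where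
  map_x_pos : ∀ (i : Fin n) (r : ℤ),
    Δ (incl D (Ut.x D 1 i r)) =
      HahnSeries.single 0 (Ut.x D 1 i r ⊗ₜ[ℂ] 1) +
        HahnSeries.single r 1 * HahnSeries.ofPowerSeries ℤ (Ut D ⊗[ℂ] Ut D)
          (PowerSeries.mk fun l : ℕ => Ut.phi D (-1) i l ⊗ₜ[ℂ] Ut.x D 1 i (r + l))
  map_x_neg : ∀ (i : Fin n) (r : ℤ),
    Δ (incl D (Ut.x D (-1) i r)) =
      HahnSeries.single r (1 ⊗ₜ[ℂ] Ut.x D (-1) i r) +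
        HahnSeries.ofPowerSeries ℤ (Ut D ⊗[ℂ] Ut D)
          (PowerSeries.mk fun l : ℕ => Ut.x D (-1) i (r - l) ⊗ₜ[ℂ] Ut.phi D 1 i l)
  map_phi : ∀ (ε : ℤˣ) (i : Fin n) (m : ℕ),
    Δ (incl D (Ut.phi D ε i m)) =
      ∑ l ∈ Finset.range (m + 1),
        HahnSeries.single ((ε : ℤ) * (l : ℤ)) (Ut.phi D ε i (m - l) ⊗ₜ[ℂ] Ut.phi D ε i l)
  map_k : ∀ h : H, Δ (incl D (Ut.k D h)) = HahnSeries.single 0 (Ut.k D h ⊗ₜ[ℂ] Ut.k D h)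

/-! ### Weights, `l`-weights and the category `𝒪` -/

section Weights

variable (K : Type*) [Field K] [Algebra ℂ K] {V : Type*} [AddCommGroup V] [Module K V]

/-- The weight space `V_ω = {v | ∀ h, k_h v = q^{ω(h)} v}`, where `κ h` is the action of `k_h`. -/
def weightSpace (κ : H → Module.End K V) (ω : Module.Dual ℚ H) : Submodule K V :=
  ⨅ h : H, LinearMap.ker (κ h - algebraMap K (Module.End K V) (algebraMap ℂ K (D.qp (ω h))))

/-- `ω ∈ D(μ)`, that is, `μ - ω` is a sum of simple roots. -/
def InCone (μ ω : Module.Dual ℚ H) : Prop :=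
  ∃ c : Fin n → ℕ, μ - ω = ∑ i, c i • D.root i

/-- The conditions of the category `𝒪` on the action `κ` of the `k_h`: the module is the direct sum
of its weight spaces, these are finite dimensional, and the weights lie in a finite union of
cones. -/
structure InOWeights (κ : H → Module.End K V) : Prop where
  indep : iSupIndep (weightSpace D K κ)
  iSup_eq_top : ⨆ ω, weightSpace D K κ ω = ⊤
  finite : ∀ ω, Module.Finite K (weightSpace D K κ ω)
  bounded : ∃ S : Finset (Module.Dual ℚ H),
    ∀ ω, weightSpace D K κ ω ≠ ⊥ → ∃ μ ∈ S, InCone D μ ω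

/-- `V_{ω,Ψ}`: the vectors of weight `ω` killed by a power of each `φ^±_{i,±m} - Ψ^±_{i,±m}`
(with a common exponent), where `Φ ε i m` is the action of `φ^ε_{i,ε m}`. -/
def lWeightSpace (κ : H → Module.End K V) (Φ : ℤˣ → Fin n → ℕ → Module.End K V)
    (ω : Module.Dual ℚ H) (Ψ : ℤˣ → Fin n → ℕ → K) : Submodule K V where
  carrier := {v | v ∈ weightSpace D K κ ω ∧ ∃ p : ℕ, ∀ ε i m,
    ((Φ ε i m - algebraMap K (Module.End K V) (Ψ ε i m)) ^ p) v = 0}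
  zero_mem' := ⟨Submodule.zero_mem _, 0, fun _ _ _ => map_zero _⟩
  add_mem' := by
    rintro v w ⟨hv, p, hp⟩ ⟨hw, p', hp'⟩
    refine ⟨Submodule.add_mem _ hv hw, max p p', fun ε i m => ?_⟩
    rw [map_add, Module.End.pow_map_zero_of_le (le_max_left p p') (hp ε i m),
      Module.End.pow_map_zero_of_le (le_max_right p p') (hp' ε i m), add_zero]
  smul_mem' := by
    rintro a v ⟨hv, p, hp⟩
    refine ⟨Submodule.smul_mem _ a hv, p, fun ε i m => ?_⟩
    rw [map_smul, hp ε i m, smul_zero]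

/-- The compatibility `Ψ^±_{i,0} = q_i^{± ω(α_i^∨)}`, where `q_i = q^{r_i}`. -/
def Compatible (ω : Module.Dual ℚ H) (Ψ : ℤˣ → Fin n → ℕ → K) : Prop :=
  ∀ (ε : ℤˣ) (i : Fin n),
    Ψ ε i 0 = algebraMap ℂ K (D.qp (((ε : ℤ) : ℚ) * (D.r i : ℚ) * ω (D.coroot i)))

end Weights

/-- The set `P_l` of `l`-weights. -/
def Pl : Set (Module.Dual ℚ H × (ℤˣ → Fin n → ℕ → ℂ)) :=
  {p | Compatible D ℂ p.1 p.2}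

/-- The set `P_{l,u}` of `l,u`-weights: all the `Ψ^±_{i,±m}(u)` are Laurent polynomials. -/
def Plu : Set (Module.Dual ℚ H × (ℤˣ → Fin n → ℕ → LC)) :=
  {p | Compatible D LC p.1 p.2 ∧ ∀ ε i m, {l : ℤ | (p.2 ε i m).coeff l ≠ 0}.Finite}

section Modules

variable {V₁ : Type*} [AddCommGroup V₁] [Module ℂ V₁]
variable {V : Type*} [AddCommGroup V] [Module LC V]

/-- The category `𝒪(Ũ_q(ĝ))`. -/
def InO (ρ : Ut D →ₐ[ℂ] Module.End ℂ V₁) : Prop :=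
  InOWeights D ℂ (fun h => ρ (Ut.k D h))

/-- The `l`-weights of a `Ũ_q(ĝ)`-module. -/
def lWeights (ρ : Ut D →ₐ[ℂ] Module.End ℂ V₁) :
    Set (Module.Dual ℚ H × (ℤˣ → Fin n → ℕ → ℂ)) :=
  {p | p ∈ Pl D ∧ lWeightSpace D ℂ (fun h => ρ (Ut.k D h)) (fun ε i m => ρ (Ut.phi D ε i m))
    p.1 p.2 ≠ ⊥}

/-- The weight spaces `V_ω` of a `Ũ'_q(ĝ)`-module. -/
def wtSpace' (ρ : Ut' D →ₐ[LC] Module.End LC V) (ω : Module.Dual ℚ H) : Submodule LC V :=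
  weightSpace D LC (fun h => ρ (incl D (Ut.k D h))) ω

/-- The spaces `V_{ω,Ψ(u)}` of a `Ũ'_q(ĝ)`-module. -/
def luSpace (ρ : Ut' D →ₐ[LC] Module.End LC V) (ω : Module.Dual ℚ H)
    (Ψ : ℤˣ → Fin n → ℕ → LC) : Submodule LC V :=
  lWeightSpace D LC (fun h => ρ (incl D (Ut.k D h)))
    (fun ε i m => ρ (incl D (Ut.phi D ε i m))) ω Ψ

/-- The `l,u`-weights of a `Ũ'_q(ĝ)`-module. -/
def luWeights (ρ : Ut' D →ₐ[LC] Module.End LC V) :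
    Set (Module.Dual ℚ H × (ℤˣ → Fin n → ℕ → LC)) :=
  {p | p ∈ Plu D ∧ luSpace D ρ p.1 p.2 ≠ ⊥}

/-- The category `𝒪(Ũ'_q(ĝ))`. The last two conditions say that `V_ω` is the direct sum of the
`V_{ω,Ψ(u)}` with `(ω, Ψ(u))` in `P_{l,u}`. -/
structure InO' (ρ : Ut' D →ₐ[LC] Module.End LC V) : Prop where
  weights : InOWeights D LC (fun h => ρ (incl D (Ut.k D h)))
  lu_indep : ∀ ω : Module.Dual ℚ H,
    iSupIndep (fun Ψ : {Ψ : ℤˣ → Fin n → ℕ → LC // (ω, Ψ) ∈ Plu D} => luSpace D ρ ω Ψ.1)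
  lu_iSup : ∀ ω : Module.Dual ℚ H,
    ⨆ Ψ : {Ψ : ℤˣ → Fin n → ℕ → LC // (ω, Ψ) ∈ Plu D}, luSpace D ρ ω Ψ.1 = wtSpace' D ρ ω

/-- The subset `u^N ℂ[[u]]` of `ℂ((u))`. -/
def uLattice (N : ℤ) : Set LC := {f | ∀ m < N, f.coeff m = 0}

/-- `v` is a combination of the family `e` with all coefficients in `u^N ℂ[[u]]`. -/
def HasCoeffsIn {d : ℕ} (e : Fin d → V) (N : ℤ) (v : V) : Prop :=
  ∃ c : Fin d → LC, (∀ β, c β ∈ uLattice N) ∧ v = ∑ β, c β • e β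

/-- The category `𝒪^R(Ũ'_q(ĝ))`: there are bases `b ω` of all the weight spaces `V_ω` such that
the coefficients of `x_{i,m}^±` lie in `ℂ[[u]]` if `m ≥ 0` and in `u^{Rm} ℂ[[u]]` if `m ≤ 0`, those
of `φ_{i,-m}^-` in `u^{-mR} ℂ[[u]]` and those of `φ_{i,m}^+` in `ℂ[[u]]` (`m ≥ 0`). -/
structure InOR (R : ℕ) (ρ : Ut' D →ₐ[LC] Module.End LC V) : Prop where
  inO' : InO' D ρ
  exists_bases : ∃ (d : Module.Dual ℚ H → ℕ)
      (b : ∀ ω, Module.Basis (Fin (d ω)) LC (wtSpace' D ρ ω)),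
    (∀ (ε : ℤˣ) (i : Fin n) (m : ℤ) (ω : Module.Dual ℚ H) (α : Fin (d ω)),
      HasCoeffsIn (fun β => (b (ω + (ε : ℤ) • D.root i) β : V))
        (if 0 ≤ m then 0 else (R : ℤ) * m) (ρ (incl D (Ut.x D ε i m)) (b ω α))) ∧
    (∀ (i : Fin n) (m : ℕ) (ω : Module.Dual ℚ H) (α : Fin (d ω)),
      HasCoeffsIn (fun β => (b ω β : V)) (-((m : ℤ) * (R : ℤ)))
        (ρ (incl D (Ut.phi D (-1) i m)) (b ω α))) ∧
    (∀ (i : Fin n) (m : ℕ) (ω : Module.Dual ℚ H) (α : Fin (d ω)),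
      HasCoeffsIn (fun β => (b ω β : V)) 0 (ρ (incl D (Ut.phi D 1 i m)) (b ω α)))

/-! ### The action on the tensor product -/

/-- The `Ũ'_q(ĝ)`-module `i(V₁) = ℂ((u)) ⊗ V₁`, obtained by extension of scalars: `c ⊗ g` acts by
`c' ⊗ v ↦ c c' ⊗ g v`. -/
def iRep (ρ₁ : Ut D →ₐ[ℂ] Module.End ℂ V₁) : Ut' D →ₐ[LC] Module.End LC (LC ⊗[ℂ] V₁) :=
  (Module.endTensorEndAlgHom (R := ℂ) (S := LC) (A := LC) (M := LC) (N := V₁)).comp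
    (Algebra.TensorProduct.map (Algebra.lmul LC LC) ρ₁)

theorem iRep_apply (ρ₁ : Ut D →ₐ[ℂ] Module.End ℂ V₁) (c c' : LC) (g : Ut D) (v : V₁) :
    iRep D ρ₁ (c ⊗ₜ[ℂ] g) (c' ⊗ₜ[ℂ] v) = (c * c') ⊗ₜ[ℂ] (ρ₁ g v) := by
  simp [iRep, Module.endTensorEndAlgHom]

/-- The `ℂ((u))`-vector space `i(V₁) ⊗_{ℂ((u))} V₂`. -/
abbrev iTensor (V₁ V₂ : Type*) [AddCommGroup V₁] [Module ℂ V₁] [AddCommGroup V₂] [Module LC V₂] :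
    Type _ :=
  (LC ⊗[ℂ] V₁) ⊗[LC] V₂

/-- The action of `Ũ_q(ĝ) ⊗_ℂ Ũ_q(ĝ)` on the tensor product over `ℂ((u))` of two
`Ũ'_q(ĝ)`-modules: `a ⊗ b` acts by `a` on the left and by `b` on the right. -/
def tensorAct {W : Type*} [AddCommGroup W] [Module LC W]
    (σ : Ut' D →ₐ[LC] Module.End LC W) (ρ : Ut' D →ₐ[LC] Module.End LC V) :
    Ut D ⊗[ℂ] Ut D →+ Module.End LC (W ⊗[LC] V) :=
  TensorProduct.liftAddHom
    (AddMonoidHom.mk' (fun a => AddMonoidHom.mk'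
      (fun b => TensorProduct.map (σ (incl D a)) (ρ (incl D b)))
      (fun b b' => by rw [map_add, map_add, TensorProduct.map_add_right]))
      (fun a a' => by
        ext b : 1
        change TensorProduct.map (σ (incl D (a + a'))) (ρ (incl D b)) =
          TensorProduct.map (σ (incl D a)) (ρ (incl D b)) +
            TensorProduct.map (σ (incl D a')) (ρ (incl D b))
        rw [map_add, map_add, TensorProduct.map_add_left]))
    (fun c a b => by
      change TensorProduct.map (σ (incl D (c • a))) (ρ (incl D b)) =
        TensorProduct.map (σ (incl D a)) (ρ (incl D (c • b)))
      rw [map_smul (incl D) c a, map_smul (incl D) c b, ← algebraMap_smul LC c (incl D a),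
        ← algebraMap_smul LC c (incl D b), map_smul σ, map_smul ρ, TensorProduct.map_smul_left, TensorProduct.map_smul_right])

theorem tensorAct_apply {W : Type*} [AddCommGroup W] [Module LC W]
    (σ : Ut' D →ₐ[LC] Module.End LC W) (ρ : Ut' D →ₐ[LC] Module.End LC V) (a b : Ut D)
    (w : W) (v : V) :
    tensorAct D σ ρ (a ⊗ₜ[ℂ] b) (w ⊗ₜ[LC] v) = σ (incl D a) w ⊗ₜ[LC] ρ (incl D b) v := rfl

/-- The family `f` of vectors is summable with sum `y` for the `u`-adic topology: up to `u^N`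
times the `ℂ[[u]]`-span of a fixed finite family of vectors, every large enough finite partial
sum is `y`. -/
def HasUSum (f : ℤ → V) (y : V) : Prop :=
  ∃ (d : ℕ) (e : Fin d → V), ∀ N : ℤ, ∃ F₀ : Finset ℤ, ∀ F : Finset ℤ, F₀ ⊆ F →
    HasCoeffsIn e N (∑ m ∈ F, f m - y)

/-- The module structure `τ` on the tensor product of the modules `σ` and `ρ` is the one defined
by `Δ`: each `g` acts by `Δ(g) = ∑_m u^m t_m`, that is, `g` maps `y` to the `u`-adically
convergent sum of the `u^m t_m(y)`. -/
def IsDefinedBy (Δ : Ut' D →ₐ[LC] UtCompl D) {W : Type*} [AddCommGroup W] [Module LC W]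
    (σ : Ut' D →ₐ[LC] Module.End LC W) (ρ : Ut' D →ₐ[LC] Module.End LC V)
    (τ : Ut' D →ₐ[LC] Module.End LC (W ⊗[LC] V)) : Prop :=
  ∀ (g : Ut' D) (y : W ⊗[LC] V),
    HasUSum (fun m : ℤ => uPow m • tensorAct D σ ρ ((Δ g).coeff m) y) (τ g y)

end Modules

/-- The product `γ₁(z) γ₂(uz)`: its component at `±m` is
`∑_{0 ≤ l ≤ m} (γ₁)^±_{±l} (γ₂)^±_{±(m-l)} u^{±(m-l)}`. -/
def twistedMul (γ₁ : ℤˣ → Fin n → ℕ → ℂ) (γ₂ : ℤˣ → Fin n → ℕ → LC) : ℤˣ → Fin n → ℕ → LC :=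
  fun ε i m => ∑ l ∈ Finset.range (m + 1),
    algebraMap ℂ LC (γ₁ ε i l) * γ₂ ε i (m - l) * uPow ((ε : ℤ) * ((m - l : ℕ) : ℤ))

end

end QAff

/-! Existence of `Δ_u`. Besides the prescribed values, send `h_{i,m}` to `h ⊗ 1 + u^m (1 ⊗ h)` and
check the defining relations. Apart from the summands `x^+_{i,r} ⊗ 1` and `u^r (1 ⊗ x^-_{i,r})`, the
images of the `x`'s are families `∑_s u^s a_{r-s} ⊗ b_s` (`IsCur`) in which one of the sequences
`a`, `b` is a current `x` and the other a current `φ`. All depends on moving `φ` past `x`: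
exponentiating the bracket of `h` with `x` produces the function `c (1 - c⁻¹ z) / (1 - c z)`
(`Ut.phi_mul_x`). Clearing its denominator shows that `φ` and `x` satisfy the same quadratic
relation as two `x`'s (`Ut.quad_phiZ_x`), so the quadratic relation for the images holds summand by
summand (`quad_dX`). In the bracket of the images of `x^+` and `x^-`, the two mixed sums commute
because the same function appears on both legs (`dP_commute_dQ`), and what remains collapses to the
image of `φ^+ - φ^-`. The value on `φ` is the exponential of a sum of two commuting series. For
uniqueness, `h` is recovered from `φ` by logarithmic differentiation.

The module structure. Convergence of vectors is convergence of scalars along all linear functionals,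
inside one finite dimensional subspace (`hasUSum_iff`). Operators given by convergent series are
therefore stable under sums and products (`ActsAs.mul`), and only the generators have to be
examined. In bases of weight vectors, the images of one basis vector involve finitely many
coordinates, the sum is bounded below in `m`, and `u^m` forces convergence. That same factor, added
to the order `R m` allowed in the second module, turns `R` into `R + 1`.

The `l,u`-weights. If `v` and `w` are `l`-weight vectors, `φ` acts on `v ⊗ w` by a finite sum of
commuting operators with known generalized eigenvalues, so `v ⊗ w` has the twisted product as its
`l,u`-weight. Such tensors span the module, and `l`-weight spaces are independent, so the spans are
the full `l`-weight spaces and no other weights occur (`IsDefinedBy.tensorLwt_eq`). Weight spaces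
stay finite dimensional because intervals for the order given by the simple roots are finite. -/

namespace QAff

/-! ### The exponential of a power series with commuting coefficients -/

section Exp

variable {A : Type*} [Ring A]

/-- The Euler operator `z d/dz` on power series. -/
noncomputable def euler (f : PowerSeries A) : PowerSeries A := PowerSeries.mk fun m => m • PowerSeries.coeff m f

@[simp] theorem coeff_euler (f : PowerSeries A) (m : ℕ) :
    PowerSeries.coeff m (euler f) = m • PowerSeries.coeff m f := PowerSeries.coeff_mk _ _

theorem euler_add (f g : PowerSeries A) : euler (f + g) = euler f + euler g := by
  ext m; simp

theorem euler_mul (f g : PowerSeries A) : euler (f * g) = euler f * g + f * euler g := by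
  ext m
  simp only [coeff_euler, PowerSeries.coeff_mul, map_add, Finset.smul_sum]
  rw [← Finset.sum_add_distrib]
  refine Finset.sum_congr rfl fun p hp => ?_
  rw [← Finset.HasAntidiagonal.mem_antidiagonal.1 hp, add_smul, smul_mul_assoc, mul_smul_comm]

theorem euler_pow {f : PowerSeries A} (hf : Commute (euler f) f) (j : ℕ) :
    euler (f ^ (j + 1)) = (j + 1) • (euler f * f ^ j) := by
  induction j with
  | zero => simp
  | succ j ih =>
    rw [pow_succ, euler_mul, ih, smul_mul_assoc, mul_assoc, ← pow_succ,
      ← (hf.pow_right (j + 1)).eq, succ_nsmul _ (j + 1)]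

theorem commute_of_coeff {f g : PowerSeries A}
    (h : ∀ a b, Commute (PowerSeries.coeff a f) (PowerSeries.coeff b g)) : Commute f g := by
  ext m
  rw [PowerSeries.coeff_mul, PowerSeries.coeff_mul, ← Finset.Nat.sum_antidiagonal_swap]
  exact Finset.sum_congr rfl fun p _ => (h _ _).eq

theorem coeff_pow_eq_zero {f : PowerSeries A} (hf : PowerSeries.coeff 0 f = 0) {j m : ℕ}
    (h : m < j) : PowerSeries.coeff m (f ^ j) = 0 := by
  induction j generalizing m with
  | zero => omega
  | succ j ih =>
    rw [pow_succ', PowerSeries.coeff_mul]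
    refine Finset.sum_eq_zero fun p hp => ?_
    have := Finset.HasAntidiagonal.mem_antidiagonal.1 hp
    rcases Nat.eq_zero_or_pos p.1 with h0 | h0
    · rw [h0, hf, zero_mul]
    · rw [ih (by omega), mul_zero]

variable [Algebra ℂ A]

/-- The exponential of a power series without constant term. -/
noncomputable def expS (f : PowerSeries A) : PowerSeries A := PowerSeries.mk (expCoeff f)

@[simp] theorem coeff_expS (f : PowerSeries A) (m : ℕ) :
    PowerSeries.coeff m (expS f) = expCoeff f m := PowerSeries.coeff_mk _ _

@[simp] theorem expCoeff_zero (f : PowerSeries A) : expCoeff f 0 = 1 := by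
  simp [expCoeff]

/-- As `f ^ j` has order at least `j`, any larger truncation gives the same value; several
coefficients can thus share one range of `j`. -/
theorem expCoeff_eq {f : PowerSeries A} (hf : PowerSeries.coeff 0 f = 0) {m M : ℕ} (h : m ≤ M) :
    expCoeff f m =
      ∑ j ∈ Finset.range (M + 1), ((j.factorial : ℂ)⁻¹) • PowerSeries.coeff m (f ^ j) := by
  refine Finset.sum_subset (Finset.range_mono (by omega)) fun j _ hj => ?_
  rw [coeff_pow_eq_zero hf (by simpa using hj), smul_zero]

/-- With `euler_unique`, this makes `z E' = (z f') E` a characterization of exponentials: identities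
between exponentials below are proved by checking this equation and a constant term. -/
theorem euler_expS {f : PowerSeries A} (hf : PowerSeries.coeff 0 f = 0)
    (hc : ∀ a b, Commute (PowerSeries.coeff a f) (PowerSeries.coeff b f)) :
    euler (expS f) = euler f * expS f := by
  have hfc : Commute (euler f) f := commute_of_coeff fun a b => by
    rw [coeff_euler]; exact (hc a b).smul_left a
  ext m
  rcases m with _ | m
  · simp [PowerSeries.coeff_mul]
  rw [coeff_euler, coeff_expS, expCoeff, Finset.sum_range_succ', smul_add, Finset.smul_sum]
  have h0 : (m + 1) • ((Nat.factorial 0 : ℂ)⁻¹ • PowerSeries.coeff (m + 1) (f ^ 0)) = 0 := by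
    simp [PowerSeries.coeff_one]
  rw [h0, add_zero, PowerSeries.coeff_mul]
  have h1 : ∀ p ∈ Finset.HasAntidiagonal.antidiagonal (m + 1),
      PowerSeries.coeff p.1 (euler f) * PowerSeries.coeff p.2 (expS f) =
      ∑ j ∈ Finset.range (m + 1), ((j.factorial : ℂ)⁻¹) •
        (PowerSeries.coeff p.1 (euler f) * PowerSeries.coeff p.2 (f ^ j)) := by
    intro p hp
    have := Finset.HasAntidiagonal.mem_antidiagonal.1 hp
    -- The Euler operator kills the term `p.1 = 0`, the only one whose second index exceeds `m`.
    rcases Nat.eq_zero_or_pos p.1 with h0 | h0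
    · simp [h0]
    · rw [coeff_expS, expCoeff_eq hf (show p.2 ≤ m by omega), Finset.mul_sum]
      exact Finset.sum_congr rfl fun j _ => mul_smul_comm _ _ _
  rw [Finset.sum_congr rfl h1, Finset.sum_comm]
  refine Finset.sum_congr rfl fun j _ => ?_
  rw [← Finset.smul_sum, ← PowerSeries.coeff_mul, smul_comm, ← coeff_euler, euler_pow hfc,
    map_nsmul, ← Nat.cast_smul_eq_nsmul ℂ, smul_smul, Nat.factorial_succ]
  congr 1
  have : ((j : ℂ) + 1) ≠ 0 := by exact_mod_cast j.succ_ne_zero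
  push_cast
  field_simp

/-- The coefficient of `z^m` reads `m E_m = ∑ F_a E_b` with only `b < m` contributing, as `F_0 = 0`;
since `m` is invertible, `E` is determined recursively. -/
theorem euler_unique {F E E' : PowerSeries A} (hF : PowerSeries.coeff 0 F = 0)
    (hE : euler E = F * E) (hE' : euler E' = F * E')
    (h0 : PowerSeries.coeff 0 E = PowerSeries.coeff 0 E') : E = E' := by
  ext m
  induction m using Nat.strong_induction_on with
  | _ m ih =>
    rcases Nat.eq_zero_or_pos m with rfl | hm
    · exact h0
    · have h : m • PowerSeries.coeff m E = m • PowerSeries.coeff m E' := by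
        rw [← coeff_euler, ← coeff_euler, hE, hE', PowerSeries.coeff_mul, PowerSeries.coeff_mul]
        refine Finset.sum_congr rfl fun p hp => ?_
        have := Finset.HasAntidiagonal.mem_antidiagonal.1 hp
        rcases Nat.eq_zero_or_pos p.1 with h0 | h0
        · rw [h0, hF, zero_mul, zero_mul]
        · rw [ih p.2 (by omega)]
      rw [← Nat.cast_smul_eq_nsmul ℂ, ← Nat.cast_smul_eq_nsmul ℂ] at h
      exact smul_right_injective _ (Nat.cast_ne_zero.2 hm.ne') h

theorem map_expCoeff {B : Type*} [Ring B] [Algebra ℂ B] (φ : A →ₐ[ℂ] B) (f : PowerSeries A)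
    (m : ℕ) : φ (expCoeff f m) = expCoeff (PowerSeries.map (φ : A →+* B) f) m := by
  simp only [expCoeff, map_sum, map_smul]
  refine Finset.sum_congr rfl fun j _ => ?_
  rw [← map_pow, PowerSeries.coeff_map]
  rfl

/-- A power series `E` with constant term `1` and `z E' = z f' E` is `exp f`. -/
theorem expS_eq {f E : PowerSeries A} (hf : PowerSeries.coeff 0 f = 0)
    (hc : ∀ a b, Commute (PowerSeries.coeff a f) (PowerSeries.coeff b f))
    (h0 : PowerSeries.coeff 0 E = 1) (hE : euler E = euler f * E) : expS f = E :=
  euler_unique (by simp) (euler_expS hf hc) hE (by simp [h0])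

theorem commute_expCoeff {f : PowerSeries A} {a : A}
    (h : ∀ b, Commute a (PowerSeries.coeff b f)) (m : ℕ) : Commute a (expCoeff f m) := by
  have h1 : ∀ j b, Commute a (PowerSeries.coeff b (f ^ j)) := by
    intro j
    induction j with
    | zero =>
      intro b
      rw [pow_zero, PowerSeries.coeff_one]
      split_ifs
      exacts [Commute.one_right a, Commute.zero_right a]
    | succ j ih =>
      intro b
      rw [pow_succ, PowerSeries.coeff_mul]
      exact Commute.sum_right _ _ _ fun p _ => (ih _).mul_right (h _)
  exact Commute.sum_right _ _ _ fun j _ => (h1 j m).smul_right _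

/-- The recursion satisfied by the coefficients of the exponential. -/
theorem nsmul_expCoeff {f : PowerSeries A} (hf : PowerSeries.coeff 0 f = 0)
    (hc : ∀ a b, Commute (PowerSeries.coeff a f) (PowerSeries.coeff b f)) (m : ℕ) :
    m • expCoeff f m =
      ∑ p ∈ Finset.HasAntidiagonal.antidiagonal m, (p.1 • PowerSeries.coeff p.1 f) * expCoeff f p.2 := by
  have := congrArg (PowerSeries.coeff m) (euler_expS hf hc)
  rw [coeff_euler, PowerSeries.coeff_mul] at this
  simpa using this

end Exp

variable {n : ℕ} {H : Type*} [AddCommGroup H] [Module ℚ H] (D : Datum n H)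

/-! ### Powers of `q` -/

theorem Datum.qp_add (x y : ℚ) : D.qp (x + y) = D.qp x * D.qp y := by
  simp [Datum.qp, ofAdd_add]

theorem Datum.qp_zero : D.qp 0 = 1 := by
  simp [Datum.qp]

theorem Datum.qp_ne_zero (x : ℚ) : D.qp x ≠ 0 := Units.ne_zero _

theorem Datum.qp_neg (x : ℚ) : D.qp (-x) = (D.qp x)⁻¹ := by
  refine eq_inv_of_mul_eq_one_left ?_
  rw [← D.qp_add, neg_add_cancel, D.qp_zero]

theorem Datum.qp_nat_mul (m : ℕ) (x : ℚ) : D.qp (m * x) = D.qp x ^ m := by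
  induction m with
  | zero => simp [D.qp_zero]
  | succ m ih => rw [Nat.cast_succ, add_mul, one_mul, D.qp_add, ih, pow_succ]

theorem Datum.qp_one_ne_one : D.qp 1 ≠ 1 := fun h =>
  D.not_root_of_unity 1 one_pos (Units.ext (by simpa [Datum.qp] using h))

theorem Datum.q_sub_ne_zero : D.qp 1 - D.qp (-1) ≠ 0 := by
  intro h
  refine D.not_root_of_unity 2 two_pos (Units.ext ?_)
  have h1 := sub_eq_zero.1 h
  rw [D.qp_neg] at h1
  have h2 : D.qp 1 * D.qp 1 = 1 := by
    nth_rewrite 2 [h1]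
    exact mul_inv_cancel₀ (D.qp_ne_zero 1)
  rw [pow_two]
  exact h2

theorem Datum.B_symm (i j : Fin n) : D.B i j = D.B j i := D.symm i j

/-! ### Relations in `Ũ_q(ĝ)` -/

/-- `h_{i,m}`, which is `0` for `m = 0`. -/
noncomputable def Ut.h (i : Fin n) (m : ℤ) : Ut D := mkU D (hF i m)

/-- `φ^ε_{i,r}` for `r ∈ ℤ`, which vanishes unless `ε r ≥ 0`. -/
noncomputable def Ut.phiZ (ε : ℤˣ) (i : Fin n) (r : ℤ) : Ut D := mkU D (phiZF D ε i r)

/-- The power series `ε (q - q⁻¹) ∑_{p ≥ 1} h_{i, ε p} z^p`. -/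
noncomputable def etaS (ε : ℤˣ) (i : Fin n) : PowerSeries (Ut D) :=
  PowerSeries.mk fun p : ℕ => (((ε : ℤ) : ℂ) * (D.qp 1 - D.qp (-1))) • Ut.h D i ((ε : ℤ) * (p : ℤ))

variable {D} in
theorem mkU_rel {a b : Free n H} (h : Rel D a b) : mkU D a = mkU D b :=
  RingQuot.mkAlgHom_rel ℂ h

theorem Ut.h_zero (i : Fin n) : Ut.h D i 0 = 0 := by
  simp [Ut.h, hF]

theorem Ut.k_mul (h h' : H) : Ut.k D h * Ut.k D h' = Ut.k D (h + h') := by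
  have := mkU_rel (Rel.k_mul (D := D) h h')
  rwa [map_mul] at this

theorem Ut.k_zero : Ut.k D 0 = 1 := by
  have := mkU_rel (Rel.k_zero (D := D))
  rwa [map_one] at this

theorem Ut.commute_k_k (h h' : H) : Commute (Ut.k D h) (Ut.k D h') := by
  rw [commute_iff_eq, Ut.k_mul, Ut.k_mul, add_comm]

theorem Ut.commute_k_h (h : H) (i : Fin n) (m : ℤ) : Commute (Ut.k D h) (Ut.h D i m) := by
  rcases eq_or_ne m 0 with rfl | hm
  · rw [Ut.h_zero]
    exact Commute.zero_right _
  · have := mkU_rel (Rel.k_h (D := D) h i m hm)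
    rwa [map_mul, map_mul] at this

theorem Ut.commute_h_h (i j : Fin n) (m m' : ℤ) : Commute (Ut.h D i m) (Ut.h D j m') := by
  rcases eq_or_ne m 0 with rfl | hm
  · rw [Ut.h_zero]
    exact Commute.zero_left _
  rcases eq_or_ne m' 0 with rfl | hm'
  · rw [Ut.h_zero]
    exact Commute.zero_right _
  · have := mkU_rel (Rel.h_h (D := D) i j m m' hm hm')
    rwa [map_mul, map_mul] at this

theorem Ut.k_mul_x (h : H) (ε : ℤˣ) (j : Fin n) (r : ℤ) :
    Ut.k D h * Ut.x D ε j r = D.qp (((ε : ℤ) : ℚ) * D.root j h) • (Ut.x D ε j r * Ut.k D h) := by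
  have := mkU_rel (Rel.k_x (D := D) h ε j r)
  rw [map_mul, map_mul, map_smul] at this
  change Ut.k D h * Ut.x D ε j r * Ut.k D (-h) = _ • Ut.x D ε j r at this
  rw [← smul_mul_assoc, ← this, mul_assoc, Ut.k_mul, neg_add_cancel, Ut.k_zero, mul_one]

theorem Ut.h_mul_x (i j : Fin n) {m : ℤ} (hm : m ≠ 0) (ε : ℤˣ) (r : ℤ) :
    Ut.h D i m * Ut.x D ε j r - Ut.x D ε j r * Ut.h D i m =
      (((ε : ℤ) : ℂ) * ((m : ℂ)⁻¹ * D.qInt (m * D.B i j))) • Ut.x D ε j (m + r) := by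
  have := mkU_rel (Rel.h_x (D := D) i j m hm ε r)
  rwa [map_sub, map_mul, map_mul, map_smul] at this

theorem Ut.x_x_comm (i j : Fin n) (r r' : ℤ) :
    Ut.x D 1 i r * Ut.x D (-1) j r' - Ut.x D (-1) j r' * Ut.x D 1 i r =
      if i = j then (D.qp (D.r i : ℚ) - D.qp (-(D.r i : ℚ)))⁻¹ •
            (Ut.phiZ D 1 i (r + r') - Ut.phiZ D (-1) i (r + r')) else 0 := by
  have := mkU_rel (Rel.x_x (D := D) i j r r')
  rw [map_sub, map_mul, map_mul, apply_ite (mkU D), map_smul, map_sub, map_zero] at this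
  exact this

/-- The relation between two sequences which the currents `x_i^±(z)`, `x_j^±(w)` satisfy. -/
def Quad {A : Type*} [Ring A] [Algebra ℂ A] (a : ℂ) (X Y : ℤ → A) : Prop :=
  ∀ r s, X (r + 1) * Y s - a • (Y s * X (r + 1)) = a • (X r * Y (s + 1)) - Y (s + 1) * X r

/-- Exchanging the two sequences exchanges the two sides up to sign, with the same constant. -/
theorem Quad.symm {A : Type*} [Ring A] [Algebra ℂ A] {a : ℂ} {X Y : ℤ → A} (h : Quad a X Y) :
    Quad a Y X := by
  intro r s
  have := h s r
  rw [← sub_eq_zero] at this ⊢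
  exact Eq.trans (by module) this

theorem Ut.quad_x_x (ε : ℤˣ) (i j : Fin n) :
    Quad (D.qp (((ε : ℤ) * D.B i j : ℤ) : ℚ)) (Ut.x D ε i) (Ut.x D ε j) := by
  intro r s
  have := mkU_rel (Rel.x_quad (D := D) ε i j r s)
  rw [map_sub, map_sub, map_mul, map_mul, map_smul, map_smul, map_mul, map_mul] at this
  exact this

theorem coeff_etaS (ε : ℤˣ) (i : Fin n) (p : ℕ) : PowerSeries.coeff p (etaS D ε i) =
    (((ε : ℤ) : ℂ) * (D.qp 1 - D.qp (-1))) • Ut.h D i ((ε : ℤ) * (p : ℤ)) :=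
  PowerSeries.coeff_mk _ _

theorem coeff_zero_etaS (ε : ℤˣ) (i : Fin n) : PowerSeries.coeff 0 (etaS D ε i) = 0 := by
  rw [coeff_etaS, Nat.cast_zero, mul_zero, Ut.h_zero, smul_zero]

theorem commute_etaS (ε ε' : ℤˣ) (i j : Fin n) (a b : ℕ) :
    Commute (PowerSeries.coeff a (etaS D ε i)) (PowerSeries.coeff b (etaS D ε' j)) := by
  rw [coeff_etaS, coeff_etaS]
  exact ((Ut.commute_h_h D _ _ _ _).smul_left _).smul_right _

theorem Ut.phi_eq (ε : ℤˣ) (i : Fin n) (m : ℕ) : Ut.phi D ε i m =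
    Ut.k D (((ε : ℤ) * (D.r i : ℤ)) • D.coroot i) * expCoeff (etaS D ε i) m := by
  rw [Ut.phi, phiF, map_mul, map_expCoeff]
  congr 2
  ext p
  rw [PowerSeries.coeff_map, PowerSeries.coeff_mk, coeff_etaS]
  exact map_smul (mkU D) _ _

theorem Ut.phi_zero (ε : ℤˣ) (i : Fin n) : Ut.phi D ε i 0 =
    Ut.k D (((ε : ℤ) * (D.r i : ℤ)) • D.coroot i) := by
  rw [Ut.phi_eq, expCoeff_zero, mul_one]

theorem Ut.commute_h_expCoeff (i j : Fin n) (m : ℤ) (ε : ℤˣ) (p : ℕ) :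
    Commute (Ut.h D i m) (expCoeff (etaS D ε j) p) :=
  commute_expCoeff (fun b => by
    rw [coeff_etaS]; exact (Ut.commute_h_h D _ _ _ _).smul_right _) p

theorem Ut.commute_k_expCoeff (h : H) (ε : ℤˣ) (i : Fin n) (p : ℕ) :
    Commute (Ut.k D h) (expCoeff (etaS D ε i) p) :=
  commute_expCoeff (fun b => by
    rw [coeff_etaS]; exact (Ut.commute_k_h D _ _ _).smul_right _) p

theorem Ut.commute_expCoeff_expCoeff (ε ε' : ℤˣ) (i j : Fin n) (p p' : ℕ) :
    Commute (expCoeff (etaS D ε i) p) (expCoeff (etaS D ε' j) p') :=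
  commute_expCoeff (fun b => by
    rw [coeff_etaS]; exact ((Ut.commute_h_expCoeff D _ _ _ _ _).symm).smul_right _) p'

theorem Ut.commute_k_phi (h : H) (ε : ℤˣ) (i : Fin n) (m : ℕ) :
    Commute (Ut.k D h) (Ut.phi D ε i m) := by
  rw [Ut.phi_eq]
  exact (Ut.commute_k_k D _ _).mul_right (Ut.commute_k_expCoeff D _ _ _ _)

theorem Ut.commute_h_phi (i j : Fin n) (m : ℤ) (ε : ℤˣ) (p : ℕ) :
    Commute (Ut.h D i m) (Ut.phi D ε j p) := by
  rw [Ut.phi_eq]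
  exact (Ut.commute_k_h D _ _ _).symm.mul_right (Ut.commute_h_expCoeff D _ _ _ _ _)

theorem Ut.commute_phi_phi (ε ε' : ℤˣ) (i j : Fin n) (m m' : ℕ) :
    Commute (Ut.phi D ε i m) (Ut.phi D ε' j m') := by
  rw [Ut.phi_eq D ε']
  refine (Ut.commute_k_phi D _ _ _ _).symm.mul_right ?_
  rw [Ut.phi_eq]
  exact (Ut.commute_k_expCoeff D _ _ _ _).mul_left (Ut.commute_expCoeff_expCoeff D _ _ _ _ _ _)

theorem Ut.phiZ_of_nonneg (ε : ℤˣ) (i : Fin n) {s : ℤ} {m : ℕ} (hs : (ε : ℤ) * s = m) :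
    Ut.phiZ D ε i s = Ut.phi D ε i m := by
  rw [Ut.phiZ, phiZF, if_pos (by omega), hs]
  rfl

theorem Ut.phiZ_of_neg (ε : ℤˣ) (i : Fin n) {s : ℤ} (hs : (ε : ℤ) * s < 0) :
    Ut.phiZ D ε i s = 0 := by
  rw [Ut.phiZ, phiZF, if_neg (by omega), map_zero]

theorem Ut.phiZ_cases (ε : ℤˣ) (i : Fin n) (s : ℤ) :
    Ut.phiZ D ε i s = 0 ∨ ∃ m, Ut.phiZ D ε i s = Ut.phi D ε i m := by
  rcases lt_or_ge ((ε : ℤ) * s) 0 with h | h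
  · exact Or.inl (Ut.phiZ_of_neg D ε i h)
  · exact Or.inr ⟨_, Ut.phiZ_of_nonneg D ε i (Int.toNat_of_nonneg h).symm⟩

theorem Ut.commute_phiZ {a : Ut D} {ε : ℤˣ} {i : Fin n} (h : ∀ m, Commute a (Ut.phi D ε i m))
    (s : ℤ) : Commute a (Ut.phiZ D ε i s) := by
  rcases Ut.phiZ_cases D ε i s with h0 | ⟨m, hm⟩
  · rw [h0]; exact Commute.zero_right _
  · rw [hm]; exact h m

theorem Ut.commute_k_phiZ (h : H) (ε : ℤˣ) (i : Fin n) (s : ℤ) :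
    Commute (Ut.k D h) (Ut.phiZ D ε i s) := Ut.commute_phiZ D (Ut.commute_k_phi D h ε i) s

theorem Ut.commute_h_phiZ (i j : Fin n) (m : ℤ) (ε : ℤˣ) (s : ℤ) :
    Commute (Ut.h D i m) (Ut.phiZ D ε j s) := Ut.commute_phiZ D (Ut.commute_h_phi D i j m ε) s

theorem Ut.commute_phiZ_phiZ (ε ε' : ℤˣ) (i j : Fin n) (s s' : ℤ) :
    Commute (Ut.phiZ D ε i s) (Ut.phiZ D ε' j s') :=
  Ut.commute_phiZ D (fun m => (Ut.commute_phiZ D (fun m' =>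
    (Ut.commute_phi_phi D ε ε' i j m' m).symm) s).symm) s'

/-! ### The commutation of `φ` and `x` -/

/-- The coefficients of `(1 - c⁻¹ z) / (1 - c z)`. -/
noncomputable def gco (c : ℂ) (k : ℕ) : ℂ := if k = 0 then 1 else (c - c⁻¹) * c ^ (k - 1)

theorem gco_zero (c : ℂ) : gco c 0 = 1 := by simp [gco]

theorem gco_succ (c : ℂ) (k : ℕ) : gco c (k + 1) = (c - c⁻¹) * c ^ k := by simp [gco]

/-- This is `z g' = (z g'/g) g` for `g = (1 - c⁻¹ z) / (1 - c z)`, whose logarithmic derivative `z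
g'/g` is `∑_p (c^p - c^{-p}) z^p`. -/
theorem sum_gco (c : ℂ) (k : ℕ) :
    ∑ p ∈ Finset.HasAntidiagonal.antidiagonal k, (c ^ p.1 - c⁻¹ ^ p.1) * gco c p.2 =
      k * gco c k := by
  induction k with
  | zero => simp
  | succ k ih =>
    have h1 : ∑ p ∈ Finset.HasAntidiagonal.antidiagonal (k + 1),
        (c ^ p.1 - c⁻¹ ^ p.1) * gco c p.2 =
        c * (∑ p ∈ Finset.HasAntidiagonal.antidiagonal k, (c ^ p.1 - c⁻¹ ^ p.1) * gco c p.2)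
          + (c ^ (k + 1) - c⁻¹ ^ (k + 1)) - c⁻¹ * (c ^ k - c⁻¹ ^ k) := by
      rw [Finset.Nat.antidiagonal_succ', Finset.sum_cons, Finset.sum_map]
      simp only [Function.Embedding.prodMap, Function.Embedding.coeFn_mk, Prod.map,
        Function.Embedding.refl_apply]
      rcases k with _ | k
      · simp [gco]
      · rw [Finset.Nat.antidiagonal_succ', Finset.sum_cons, Finset.sum_cons, Finset.sum_map,
          Finset.sum_map, mul_add, Finset.mul_sum]
        simp only [Function.Embedding.prodMap, Function.Embedding.coeFn_mk, Prod.map,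
          Function.Embedding.refl_apply]
        have h2 : ∀ p ∈ Finset.HasAntidiagonal.antidiagonal k,
            (c ^ p.1 - c⁻¹ ^ p.1) * gco c (Nat.succ (Nat.succ p.2)) =
            c * ((c ^ p.1 - c⁻¹ ^ p.1) * gco c (Nat.succ p.2)) := fun p _ => by
          rw [Nat.succ_eq_add_one, Nat.succ_eq_add_one, gco_succ, gco_succ]; ring
        rw [Finset.sum_congr rfl h2]
        simp [gco]
        ring
    rw [h1, ih, gco_succ]
    rcases k with _ | k
    · simp
    · rw [gco_succ]
      push_cast
      ring

/-- `q^{ε ε' B_{i,j}}`. -/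
noncomputable def Datum.c (ε' ε : ℤˣ) (i j : Fin n) : ℂ :=
  D.qp (((ε' : ℤ) * ((ε : ℤ) * D.B i j) : ℤ) : ℚ)

/-- The factor `p` cancels `1/m` and `q - q⁻¹` cancels the denominator of the `q`-integer; what is
left is a coefficient of the logarithmic derivative in `sum_gco`. -/
theorem nsmul_coeff_etaS_mul_x (ε' ε : ℤˣ) (i j : Fin n) (p : ℕ) (r : ℤ) :
    (p • PowerSeries.coeff p (etaS D ε' i)) * Ut.x D ε j r =
      Ut.x D ε j r * (p • PowerSeries.coeff p (etaS D ε' i)) +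
        (D.c ε' ε i j ^ p - (D.c ε' ε i j)⁻¹ ^ p) • Ut.x D ε j (r + (ε' : ℤ) * p) := by
  rcases Nat.eq_zero_or_pos p with rfl | hp
  · simp
  have hp' : (p : ℂ) ≠ 0 := Nat.cast_ne_zero.2 hp.ne'
  have hm : (ε' : ℤ) * (p : ℤ) ≠ 0 :=
    mul_ne_zero ε'.ne_zero (by exact_mod_cast hp.ne')
  have h := Ut.h_mul_x D i j hm ε r
  rw [sub_eq_iff_eq_add'] at h
  rw [coeff_etaS, ← Nat.cast_smul_eq_nsmul ℂ, smul_smul, smul_mul_assoc, h, smul_add, smul_smul,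
    mul_smul_comm, add_comm r]
  congr 2
  have h1 : ∀ m : ℤ, D.qInt m = (D.qp m - D.qp (-m)) / (D.qp 1 - D.qp (-1)) := fun m => rfl
  rw [h1, Datum.c, ← D.qp_neg, ← D.qp_nat_mul, ← D.qp_nat_mul]
  have h2 := D.q_sub_ne_zero
  generalize D.qp 1 - D.qp (-1) = Q at h2
  rcases Int.units_eq_one_or ε with rfl | rfl <;> rcases Int.units_eq_one_or ε' with rfl | rfl <;>
  · push_cast
    simp only [one_mul, neg_mul, mul_neg, neg_neg]
    field_simp
    try ring

/-- Both sides solve `z E' = (z η') E` with constant term `x`. For the right side, moving `z η'`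
past the series of translates of `x` creates exactly its Euler derivative, by `sum_gco`. -/
theorem expS_etaS_mul_x (ε' ε : ℤˣ) (i j : Fin n) (r : ℤ) :
    expS (etaS D ε' i) * PowerSeries.C (Ut.x D ε j r) =
      PowerSeries.mk (fun k : ℕ => gco (D.c ε' ε i j) k • Ut.x D ε j (r + (ε' : ℤ) * k)) *
        expS (etaS D ε' i) := by
  set X : PowerSeries (Ut D) :=
    PowerSeries.mk (fun k : ℕ => gco (D.c ε' ε i j) k • Ut.x D ε j (r + (ε' : ℤ) * k)) with hX
  have hE := euler_expS (coeff_zero_etaS D ε' i) (commute_etaS D ε' ε' i i)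
  have hC : euler (PowerSeries.C (Ut.x D ε j r)) = 0 := by
    ext m
    rw [coeff_euler, PowerSeries.coeff_C]
    split_ifs with h <;> simp [h]
  have hcomm : euler (etaS D ε' i) * X = X * euler (etaS D ε' i) + euler X := by
    ext m
    rw [map_add, PowerSeries.coeff_mul, PowerSeries.coeff_mul, coeff_euler,
      ← Finset.Nat.sum_antidiagonal_swap (f := fun p =>
        PowerSeries.coeff p.1 X * PowerSeries.coeff p.2 (euler (etaS D ε' i))), ← sub_eq_iff_eq_add', ← Finset.sum_sub_distrib]
    have h1 : ∀ p ∈ Finset.HasAntidiagonal.antidiagonal m,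
        PowerSeries.coeff p.1 (euler (etaS D ε' i)) * PowerSeries.coeff p.2 X -
          PowerSeries.coeff p.2 X * PowerSeries.coeff p.1 (euler (etaS D ε' i)) =
        ((D.c ε' ε i j ^ p.1 - (D.c ε' ε i j)⁻¹ ^ p.1) * gco (D.c ε' ε i j) p.2) •
          Ut.x D ε j (r + (ε' : ℤ) * m) := by
      intro p hp
      have := Finset.HasAntidiagonal.mem_antidiagonal.1 hp
      rw [coeff_euler, hX, PowerSeries.coeff_mk, mul_smul_comm, nsmul_coeff_etaS_mul_x, smul_add,
        smul_mul_assoc, add_sub_cancel_left, smul_smul, mul_comm, ← this, add_assoc]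
      congr 3
      push_cast
      ring
    calc _ = ∑ p ∈ Finset.HasAntidiagonal.antidiagonal m,
        ((D.c ε' ε i j ^ p.1 - (D.c ε' ε i j)⁻¹ ^ p.1) * gco (D.c ε' ε i j) p.2) •
          Ut.x D ε j (r + (ε' : ℤ) * m) := by
            exact Finset.sum_congr rfl h1
      _ = _ := by
        rw [← Finset.sum_smul, sum_gco, hX, PowerSeries.coeff_mk, mul_smul,
          Nat.cast_smul_eq_nsmul]
  refine euler_unique (F := euler (etaS D ε' i)) (by simp) ?_ ?_ ?_
  · rw [euler_mul, hC, mul_zero, add_zero, hE, mul_assoc]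
  · rw [euler_mul, hE, ← mul_assoc, ← mul_assoc, hcomm, add_mul, add_comm]
  · simp [hX, gco_zero, PowerSeries.coeff_mul]

theorem Ut.k_coroot_mul_x (ε' ε : ℤˣ) (i j : Fin n) (r : ℤ) :
    Ut.k D (((ε' : ℤ) * (D.r i : ℤ)) • D.coroot i) * Ut.x D ε j r =
      D.c ε' ε i j • (Ut.x D ε j r * Ut.k D (((ε' : ℤ) * (D.r i : ℤ)) • D.coroot i)) := by
  rw [Ut.k_mul_x, map_zsmul, D.pairing, Datum.c, Datum.B]
  congr 2
  simp only [zsmul_eq_mul]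
  push_cast
  ring

theorem Ut.phi_mul_x (ε' ε : ℤˣ) (i j : Fin n) (m : ℕ) (r : ℤ) :
    Ut.phi D ε' i m * Ut.x D ε j r = ∑ p ∈ Finset.HasAntidiagonal.antidiagonal m,
      (D.c ε' ε i j * gco (D.c ε' ε i j) p.1) •
        (Ut.x D ε j (r + (ε' : ℤ) * p.1) * Ut.phi D ε' i p.2) := by
  have h := congrArg (PowerSeries.coeff m) (expS_etaS_mul_x D ε' ε i j r)
  rw [PowerSeries.coeff_mul_C, PowerSeries.coeff_mul, coeff_expS] at h
  rw [Ut.phi_eq, mul_assoc, h, Finset.mul_sum]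
  refine Finset.sum_congr rfl fun p _ => ?_
  rw [PowerSeries.coeff_mk, coeff_expS, smul_mul_assoc, mul_smul_comm, ← mul_assoc,
    Ut.k_coroot_mul_x, Ut.phi_eq, smul_mul_assoc, smul_smul, mul_comm, mul_assoc]

/-- The bound `M` is left free, the terms with `k > ε' s` being zero, so that different expansions
can be compared over one range. -/
theorem Ut.phiZ_mul_x (ε' ε : ℤˣ) (i j : Fin n) (s r : ℤ) {M : ℕ} (hM : (ε' : ℤ) * s < M) :
    Ut.phiZ D ε' i s * Ut.x D ε j r = ∑ k ∈ Finset.range M,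
      (D.c ε' ε i j * gco (D.c ε' ε i j) k) •
        (Ut.x D ε j (r + (ε' : ℤ) * k) * Ut.phiZ D ε' i (s - (ε' : ℤ) * k)) := by
  have hee : (ε' : ℤ) * (ε' : ℤ) = 1 := by
    rw [← Units.val_mul, Int.units_mul_self, Units.val_one]
  have hk : ∀ k : ℕ, (ε' : ℤ) * (s - (ε' : ℤ) * k) = (ε' : ℤ) * s - k := fun k => by
    rw [mul_sub, ← mul_assoc, hee, one_mul]
  rcases lt_or_ge ((ε' : ℤ) * s) 0 with h | h
  · rw [Ut.phiZ_of_neg D ε' i h, zero_mul, Finset.sum_eq_zero]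
    intro k _
    rw [Ut.phiZ_of_neg D ε' i (by rw [hk]; omega), mul_zero, smul_zero]
  · obtain ⟨m, hm⟩ := Int.eq_ofNat_of_zero_le h
    rw [Ut.phiZ_of_nonneg D ε' i hm, Ut.phi_mul_x,
      Finset.Nat.sum_antidiagonal_eq_sum_range_succ_mk]
    symm
    refine (Finset.sum_subset (Finset.range_mono (show m + 1 ≤ M by omega))
      fun k _ hk' => ?_).symm.trans (Finset.sum_congr rfl fun k hk' => ?_)
    · rw [Finset.mem_range, not_lt] at hk'
      rw [Ut.phiZ_of_neg D ε' i (by rw [hk]; omega), mul_zero, smul_zero]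
    · rw [Finset.mem_range] at hk'
      rw [Ut.phiZ_of_nonneg D ε' i (m := m - k) (by rw [hk]; omega)]

/-- This multiplies the expansion by the denominator `1 - c z`. As `gco c (k + 2) = c * gco c (k +
1)`, the tails of the two expansions cancel and only `k = 0` and `k = 1` leave a trace. -/
theorem Ut.phiZ_quad_aux (ε' ε : ℤˣ) (i j : Fin n) (s r : ℤ) :
    Ut.phiZ D ε' i s * Ut.x D ε j r
        - D.c ε' ε i j • (Ut.phiZ D ε' i (s - ε') * Ut.x D ε j (r + ε')) =
      D.c ε' ε i j • (Ut.x D ε j r * Ut.phiZ D ε' i s)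
        - Ut.x D ε j (r + ε') * Ut.phiZ D ε' i (s - ε') := by
  have hee : (ε' : ℤ) * (ε' : ℤ) = 1 := by
    rw [← Units.val_mul, Int.units_mul_self, Units.val_one]
  have hc : D.c ε' ε i j ≠ 0 := D.qp_ne_zero _
  obtain ⟨M, hM⟩ : ∃ M : ℕ, (ε' : ℤ) * s < M + 1 := ⟨((ε' : ℤ) * s).toNat, by omega⟩
  rw [Ut.phiZ_mul_x D ε' ε i j s r (M := M + 1 + 1) (by push_cast; omega),
    Ut.phiZ_mul_x D ε' ε i j (s - ε') (r + ε') (M := M + 1) (by rw [mul_sub, hee]; push_cast; omega),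
    Finset.sum_range_succ', Finset.sum_range_succ', Finset.sum_range_succ' _ M]
  have h1 : ∀ k : ℕ, r + (ε' : ℤ) * ((k + 1 : ℕ) : ℤ) = r + ε' + ε' * k := fun k => by
    push_cast; ring
  have h2 : ∀ k : ℕ, s - (ε' : ℤ) * ((k + 1 : ℕ) : ℤ) = s - ε' - ε' * k := fun k => by
    push_cast; ring
  simp only [h1, h2]
  rw [smul_add, Finset.smul_sum, Finset.sum_congr rfl (g := fun k => D.c ε' ε i j •
    ((D.c ε' ε i j * gco (D.c ε' ε i j) (k + 1)) • (Ut.x D ε j (r + ε' + ε' * ((k + 1 : ℕ) : ℤ)) *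
      Ut.phiZ D ε' i (s - ε' - ε' * ((k + 1 : ℕ) : ℤ)))))]
  · simp only [gco_zero, gco_succ, zero_add, pow_zero, mul_one, Nat.cast_zero, mul_zero, add_zero,
      sub_zero, smul_smul]
    have h3 : D.c ε' ε i j * (D.c ε' ε i j - (D.c ε' ε i j)⁻¹) =
      D.c ε' ε i j * D.c ε' ε i j - 1 := by field_simp
    rw [h3, sub_smul, one_smul]
    abel
  · intro k _
    rw [smul_smul, gco_succ, gco_succ, pow_succ]
    congr 1
    ring

/-- The constant does not depend on `ε'`: for `ε' = -1` both the constant and the shifts are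
inverted, and multiplying through by `a` restores the same form. Towards `x^ε`, both `φ^+` and `φ^-`
thus behave like another `x^ε`. -/
theorem Ut.quad_phiZ_x (ε' ε : ℤˣ) (i j : Fin n) :
    Quad (D.qp (((ε : ℤ) * D.B i j : ℤ) : ℚ)) (Ut.phiZ D ε' i) (Ut.x D ε j) := by
  intro s r
  rcases Int.units_eq_one_or ε' with rfl | rfl
  · have := Ut.phiZ_quad_aux D 1 ε i j (s + 1) r
    simp only [Datum.c, Units.val_one, one_mul, add_sub_cancel_right] at this
    rw [← sub_eq_zero] at this ⊢
    exact Eq.trans (by module) this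
  · have := Ut.phiZ_quad_aux D (-1) ε i j s (r + 1)
    have hc : D.c (-1) ε i j = (D.qp (((ε : ℤ) * D.B i j : ℤ) : ℚ))⁻¹ := by
      rw [← D.qp_neg]; simp [Datum.c]
    have h0 := D.qp_ne_zero (((ε : ℤ) * D.B i j : ℤ) : ℚ)
    rw [hc] at this
    generalize D.qp (((ε : ℤ) * D.B i j : ℤ) : ℚ) = a at this h0
    have h2 := congrArg (fun t => a • t) this
    simp only [smul_sub, smul_smul, mul_inv_cancel₀ h0, one_smul] at h2
    simp only [Units.val_neg, Units.val_one, sub_neg_eq_add, ← sub_eq_add_neg,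
      add_sub_cancel_right] at h2
    rw [← sub_eq_zero, ← neg_eq_zero] at h2
    rw [← sub_eq_zero]
    exact Eq.trans (by module) h2

/-! ### Products of Laurent series -/

section Hahn

variable {T : Type*} [Ring T]

theorem hasFiniteSupport_coeff_mul (f g : LaurentSeries T) (N : ℤ) :
    (fun s => f.coeff s * g.coeff (N - s)).HasFiniteSupport := by
  refine Set.Finite.subset (((Finset.antidiagonal f.isPWO_support g.isPWO_support N).image
    Prod.fst).finite_toSet) fun s hs => ?_
  rw [Function.mem_support] at hs
  rw [Finset.coe_image, Set.mem_image]
  refine ⟨(s, N - s), ?_, rfl⟩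
  rw [Finset.mem_coe, Finset.mem_antidiagonal]
  exact ⟨left_ne_zero_of_mul hs, right_ne_zero_of_mul hs, by simp⟩

/-- A sum over all of `ℤ`, instead of over an antidiagonal depending on the supports, can be
reindexed by shifts. -/
theorem coeff_mul_eq_finsum (f g : LaurentSeries T) (N : ℤ) :
    (f * g).coeff N = ∑ᶠ s, f.coeff s * g.coeff (N - s) := by
  rw [HahnSeries.coeff_mul, finsum_eq_sum_of_support_subset (s :=
    (Finset.antidiagonal f.isPWO_support g.isPWO_support N).image Prod.fst), Finset.sum_image]
  · refine Finset.sum_congr rfl fun p hp => ?_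
    rw [← (Finset.mem_antidiagonal.1 hp).2.2, add_sub_cancel_left]
  · intro p hp p' hp' h
    have h1 := (Finset.mem_antidiagonal.1 hp).2.2
    have h2 := (Finset.mem_antidiagonal.1 hp').2.2
    exact Prod.ext h (by rw [h] at h1; omega)
  · intro s hs
    rw [Function.mem_support] at hs
    rw [Finset.coe_image, Set.mem_image]
    refine ⟨(s, N - s), ?_, rfl⟩
    rw [Finset.mem_coe, Finset.mem_antidiagonal]
    exact ⟨left_ne_zero_of_mul hs, right_ne_zero_of_mul hs, by simp⟩

theorem hasFiniteSupport_coeff_mul' (f g : LaurentSeries T) (N : ℤ) :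
    (fun s => f.coeff (N - s) * g.coeff s).HasFiniteSupport := by
  have h := (hasFiniteSupport_coeff_mul f g N).preimage
    (f := fun s => N - s) (fun a _ b _ hab => by simpa using hab)
  refine h.subset fun s hs => ?_
  simpa using hs

theorem coeff_mul_eq_finsum' (f g : LaurentSeries T) (N : ℤ) :
    (f * g).coeff N = ∑ᶠ s, f.coeff (N - s) * g.coeff s := by
  rw [coeff_mul_eq_finsum, ← finsum_comp_equiv (Equiv.subLeft N)]
  simp

end Hahn

/-! ### Currents with values in a tensor product -/

section Cur

variable {A : Type*} [Ring A] [Algebra ℂ A]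

/-- The family `P` of Laurent series is `P_r = ∑_s u^s a_{r-s} ⊗ b_s`. -/
def IsCur (a b : ℤ → A) (P : ℤ → LaurentSeries (A ⊗[ℂ] A)) : Prop :=
  ∀ r s, (P r).coeff s = a (r - s) ⊗ₜ[ℂ] b s

variable {a b a' b' : ℤ → A} {P P' : ℤ → LaurentSeries (A ⊗[ℂ] A)} {q : ℂ}

/-- The second product is indexed by its right factor, so `t` labels the coefficient of `P` in both
products and they combine term by term. -/
theorem IsCur.coeff_mul_sub (hP : IsCur a b P) (hP' : IsCur a' b' P') (q : ℂ) (r s N : ℤ) :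
    (P r * P' s - q • (P' s * P r)).coeff N = ∑ᶠ t,
      ((a (r - t) * a' (s - N + t)) ⊗ₜ[ℂ] (b t * b' (N - t)) -
        q • ((a' (s - N + t) * a (r - t)) ⊗ₜ[ℂ] (b' (N - t) * b t))) := by
  rw [HahnSeries.coeff_sub, HahnSeries.coeff_smul, coeff_mul_eq_finsum, coeff_mul_eq_finsum',
    smul_finsum, ← finsum_sub_distrib (hasFiniteSupport_coeff_mul _ _ _)]
  · refine finsum_congr fun t => ?_
    rw [hP, hP', Algebra.TensorProduct.tmul_mul_tmul, Algebra.TensorProduct.tmul_mul_tmul,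
      show s - (N - t) = s - N + t by ring]
  · refine (hasFiniteSupport_coeff_mul' (P' s) (P r) N).subset fun t ht => ?_
    rw [Function.mem_support] at ht ⊢
    exact fun h => ht (by rw [h, smul_zero])

theorem IsCur.coeff_mul_sub' (hP : IsCur a b P) (hP' : IsCur a' b' P') (q : ℂ) (r s N : ℤ) :
    (q • (P r * P' s) - P' s * P r).coeff N = ∑ᶠ t,
      (q • ((a (r - t) * a' (s - N + t)) ⊗ₜ[ℂ] (b t * b' (N - t))) -
        ((a' (s - N + t) * a (r - t)) ⊗ₜ[ℂ] (b' (N - t) * b t))) := by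
  rw [HahnSeries.coeff_sub, HahnSeries.coeff_smul, coeff_mul_eq_finsum, coeff_mul_eq_finsum',
    smul_finsum, ← finsum_sub_distrib _ (hasFiniteSupport_coeff_mul' _ _ _)]
  · refine finsum_congr fun t => ?_
    rw [hP, hP', Algebra.TensorProduct.tmul_mul_tmul, Algebra.TensorProduct.tmul_mul_tmul,
      show s - (N - t) = s - N + t by ring]
  · refine (hasFiniteSupport_coeff_mul (P r) (P' s) N).subset fun t ht => ?_
    rw [Function.mem_support] at ht ⊢
    exact fun h => ht (by rw [h, smul_zero])

/-- The left legs commute, so the relation of the right legs applies to each term, after a shift of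
`t` by one on one side. -/
theorem IsCur.quad_right (hP : IsCur a b P) (hP' : IsCur a' b' P')
    (h : ∀ r s, Commute (a r) (a' s)) (hb : Quad q b b') : Quad q P P' := by
  intro r s
  ext N
  rw [hP.coeff_mul_sub hP', hP.coeff_mul_sub' hP', ← finsum_comp_equiv (Equiv.addRight (1 : ℤ))]
  refine finsum_congr fun t => ?_
  simp only [Equiv.coe_addRight]
  have h1 := hb t (N - (t + 1))
  rw [show N - (t + 1) + 1 = N - t by ring] at h1
  rw [show r + 1 - (t + 1) = r - t by ring, show s - N + (t + 1) = s + 1 - N + t by ring,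
    ← (h (r - t) (s + 1 - N + t)).eq, ← TensorProduct.tmul_smul, ← TensorProduct.tmul_sub, h1,
    TensorProduct.tmul_sub, TensorProduct.tmul_smul]

/-- The indices `r` and `s` enter only through the left legs, so here the terms match without a
shift. -/
theorem IsCur.quad_left (hP : IsCur a b P) (hP' : IsCur a' b' P')
    (h : ∀ r s, Commute (b r) (b' s)) (ha : Quad q a a') : Quad q P P' := by
  intro r s
  ext N
  rw [hP.coeff_mul_sub hP', hP.coeff_mul_sub' hP']
  refine finsum_congr fun t => ?_
  have h1 := ha (r - t) (s - N + t)
  rw [show r - t + 1 = r + 1 - t by ring, show s - N + t + 1 = s + 1 - N + t by ring] at h1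
  rw [← (h t (N - t)).eq, TensorProduct.smul_tmul', ← TensorProduct.sub_tmul, h1,
    TensorProduct.sub_tmul, TensorProduct.smul_tmul']

theorem Quad.add_left {B : Type*} [Ring B] [Algebra ℂ B] {X X' Y : ℤ → B} (h : Quad q X Y)
    (h' : Quad q X' Y) : Quad q (fun r => X r + X' r) Y := by
  intro r s
  have h1 := congrArg₂ (· + ·) (h r s) (h' r s)
  simp only [add_mul, mul_add, smul_add]
  rw [← sub_eq_zero] at h1 ⊢
  exact Eq.trans (by abel) h1

theorem Quad.add_right {B : Type*} [Ring B] [Algebra ℂ B] {X Y Y' : ℤ → B} (h : Quad q X Y)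
    (h' : Quad q X Y') : Quad q X (fun r => Y r + Y' r) :=
  (h.symm.add_left h'.symm).symm

theorem quad_single_zero {x x' : ℤ → A} (h : Quad q x x') :
    Quad q (fun r => (HahnSeries.single 0 (x r ⊗ₜ[ℂ] 1) : LaurentSeries (A ⊗[ℂ] A)))
      (fun r => HahnSeries.single 0 (x' r ⊗ₜ[ℂ] 1)) := by
  intro r s
  simp only [HahnSeries.single_mul_single, Algebra.TensorProduct.tmul_mul_tmul, mul_one, add_zero]
  ext N
  simp only [HahnSeries.coeff_sub, HahnSeries.coeff_smul, HahnSeries.coeff_single]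
  split_ifs
  · rw [TensorProduct.smul_tmul', ← TensorProduct.sub_tmul, h r s, TensorProduct.sub_tmul,
      TensorProduct.smul_tmul']
  · simp

theorem quad_single {x x' : ℤ → A} (h : Quad q x x') :
    Quad q (fun r => (HahnSeries.single r (1 ⊗ₜ[ℂ] x r) : LaurentSeries (A ⊗[ℂ] A)))
      (fun r => HahnSeries.single r (1 ⊗ₜ[ℂ] x' r)) := by
  intro r s
  simp only [HahnSeries.single_mul_single, Algebra.TensorProduct.tmul_mul_tmul, mul_one,
    show s + (r + 1) = r + 1 + s by ring, show r + (s + 1) = r + 1 + s by ring,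
    show s + 1 + r = r + 1 + s by ring]
  ext N
  simp only [HahnSeries.coeff_sub, HahnSeries.coeff_smul, HahnSeries.coeff_single]
  split_ifs
  · rw [← TensorProduct.tmul_smul, ← TensorProduct.tmul_sub, h r s, TensorProduct.tmul_sub,
      TensorProduct.tmul_smul]
  · simp

theorem IsCur.quad_single_zero (hP' : IsCur a' b' P') {x : ℤ → A} (h : Quad q x a') :
    Quad q (fun r => HahnSeries.single 0 (x r ⊗ₜ[ℂ] 1)) P' := by
  intro r s
  ext N
  simp only [HahnSeries.coeff_sub, HahnSeries.coeff_smul, HahnSeries.coeff_single_zero_mul,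
    HahnSeries.coeff_mul_single_zero, hP' _ _, Algebra.TensorProduct.tmul_mul_tmul, one_mul,
    mul_one, TensorProduct.smul_tmul', ← TensorProduct.sub_tmul]
  have := h r (s - N)
  rw [show s - N + 1 = s + 1 - N by ring] at this
  rw [this]

theorem IsCur.quad_single (hP' : IsCur a' b' P') {x : ℤ → A} (h : Quad q x b') :
    Quad q (fun r => HahnSeries.single r (1 ⊗ₜ[ℂ] x r)) P' := by
  intro r s
  ext N
  simp only [HahnSeries.coeff_sub, HahnSeries.coeff_smul, HahnSeries.coeff_single_mul,
    HahnSeries.coeff_mul_single, hP' _ _, Algebra.TensorProduct.tmul_mul_tmul, one_mul,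
    mul_one, ← TensorProduct.tmul_smul, show s + 1 - (N - r) = s - (N - (r + 1)) by ring,
    ← TensorProduct.tmul_sub]
  have := h r (N - (r + 1))
  rw [show N - (r + 1) + 1 = N - r by ring] at this
  rw [this]

end Cur

/-! ### The values of the deformed coproduct on the generators -/

section Coproduct

variable {n : ℕ} {H : Type*} [AddCommGroup H] [Module ℚ H] (D : Datum n H)

/-- `∑_{l ≥ 0} u^{r+l} φ_{i,-l}^- ⊗ x_{i,r+l}^+`. -/
noncomputable def dP (i : Fin n) (r : ℤ) : UtCompl D :=
  HahnSeries.single r 1 * HahnSeries.ofPowerSeries ℤ (Ut D ⊗[ℂ] Ut D)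
    (PowerSeries.mk fun l : ℕ => Ut.phi D (-1) i l ⊗ₜ[ℂ] Ut.x D 1 i (r + l))

/-- `∑_{l ≥ 0} u^l x_{i,r-l}^- ⊗ φ_{i,l}^+`. -/
noncomputable def dQ (i : Fin n) (r : ℤ) : UtCompl D :=
  HahnSeries.ofPowerSeries ℤ (Ut D ⊗[ℂ] Ut D)
    (PowerSeries.mk fun l : ℕ => Ut.x D (-1) i (r - l) ⊗ₜ[ℂ] Ut.phi D 1 i l)

theorem coeff_ofPowerSeries_neg {T : Type*} [Ring T] (f : PowerSeries T) {s : ℤ} (hs : s < 0) :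
    (HahnSeries.ofPowerSeries ℤ T f).coeff s = 0 := by
  rw [PowerSeries.coeff_coe, if_pos hs]

theorem isCur_dP (i : Fin n) : IsCur (Ut.phiZ D (-1) i) (Ut.x D 1 i) (dP D i) := by
  intro r s
  rw [dP, HahnSeries.coeff_single_mul, one_mul]
  rcases lt_or_ge (s - r) 0 with h | h
  · rw [coeff_ofPowerSeries_neg _ h, Ut.phiZ_of_neg, TensorProduct.zero_tmul]
    simpa using h
  · obtain ⟨m, hm⟩ := Int.eq_ofNat_of_zero_le h
    rw [hm, HahnSeries.ofPowerSeries_apply_coeff, PowerSeries.coeff_mk, ← hm,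
      Ut.phiZ_of_nonneg D (-1) i (m := m) (by simp; omega), add_sub_cancel]

theorem isCur_dQ (i : Fin n) : IsCur (Ut.x D (-1) i) (Ut.phiZ D 1 i) (dQ D i) := by
  intro r s
  rw [dQ]
  rcases lt_or_ge s 0 with h | h
  · rw [coeff_ofPowerSeries_neg _ h, Ut.phiZ_of_neg, TensorProduct.tmul_zero]
    simpa using h
  · obtain ⟨m, rfl⟩ := Int.eq_ofNat_of_zero_le h
    rw [HahnSeries.ofPowerSeries_apply_coeff, PowerSeries.coeff_mk,
      Ut.phiZ_of_nonneg D 1 i (m := m) (by simp)]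

/-- The image of `x_{i,r}^ε`. -/
noncomputable def dX (ε : ℤˣ) (i : Fin n) (r : ℤ) : UtCompl D :=
  if ε = 1 then HahnSeries.single 0 (Ut.x D 1 i r ⊗ₜ[ℂ] 1) + dP D i r
  else HahnSeries.single r (1 ⊗ₜ[ℂ] Ut.x D (-1) i r) + dQ D i r

theorem dX_one (i : Fin n) (r : ℤ) :
    dX D 1 i r = HahnSeries.single 0 (Ut.x D 1 i r ⊗ₜ[ℂ] 1) + dP D i r := if_pos rfl

theorem dX_neg_one (i : Fin n) (r : ℤ) :
    dX D (-1) i r = HahnSeries.single r (1 ⊗ₜ[ℂ] Ut.x D (-1) i r) + dQ D i r :=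
  if_neg (by decide)

/-- The image of `k_h`. -/
noncomputable def dK (h : H) : UtCompl D := HahnSeries.single 0 (Ut.k D h ⊗ₜ[ℂ] Ut.k D h)

/-- The image of `h_{i,m}`. -/
noncomputable def dH (i : Fin n) (m : ℤ) : UtCompl D :=
  HahnSeries.single 0 (Ut.h D i m ⊗ₜ[ℂ] 1) + HahnSeries.single m (1 ⊗ₜ[ℂ] Ut.h D i m)

/-- Each image has two summands, giving four relations: `x` with `x`, `x` with `φ` twice, and the
mixed currents with each other, where the `φ` legs commute. The symmetry of `B` allows `i` and `j`
to be exchanged in the relation of `φ` with `x`. -/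
theorem quad_dX (ε : ℤˣ) (i j : Fin n) :
    Quad (D.qp (((ε : ℤ) * D.B i j : ℤ) : ℚ)) (dX D ε i) (dX D ε j) := by
  have hs : D.qp (((ε : ℤ) * D.B i j : ℤ) : ℚ) = D.qp (((ε : ℤ) * D.B j i : ℤ) : ℚ) := by
    rw [D.B_symm]
  have hx := Ut.quad_x_x D ε i j
  have h1 : ∀ ε', Quad (D.qp (((ε : ℤ) * D.B i j : ℤ) : ℚ)) (Ut.x D ε i) (Ut.phiZ D ε' j) :=
    fun ε' => by rw [hs]; exact (Ut.quad_phiZ_x D ε' ε j i).symm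
  have h2 : ∀ ε', Quad (D.qp (((ε : ℤ) * D.B i j : ℤ) : ℚ)) (Ut.x D ε j) (Ut.phiZ D ε' i) :=
    fun ε' => (Ut.quad_phiZ_x D ε' ε i j).symm
  rcases Int.units_eq_one_or ε with rfl | rfl
  · rw [funext (dX_one D i), funext (dX_one D j)]
    refine Quad.add_left (Quad.add_right (quad_single_zero hx) ?_) (Quad.add_right ?_ ?_)
    · exact (isCur_dP D j).quad_single_zero (h1 _)
    · exact ((isCur_dP D i).quad_single_zero (h2 _)).symm
    · exact (isCur_dP D i).quad_right (isCur_dP D j)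
        (fun r s => Ut.commute_phiZ_phiZ D _ _ _ _ _ _) hx
  · rw [funext (dX_neg_one D i), funext (dX_neg_one D j)]
    refine Quad.add_left (Quad.add_right (quad_single hx) ?_) (Quad.add_right ?_ ?_)
    · exact (isCur_dQ D j).quad_single (h1 _)
    · exact ((isCur_dQ D i).quad_single (h2 _)).symm
    · exact (isCur_dQ D i).quad_left (isCur_dQ D j)
        (fun r s => Ut.commute_phiZ_phiZ D _ _ _ _ _ _) hx

/-- In one order `φ^-` has to be moved past `x^-` on the left leg, in the other `φ^+` past `x^+` on
the right leg. The constants agree since the signs cancel and `B` is symmetric, so both products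
expand into the same terms `G k t`, up to the shift of `t` by `k`, which is invisible after summing
over `t`. -/
theorem dP_commute_dQ (i j : Fin n) (r s : ℤ) : Commute (dP D i r) (dQ D j s) := by
  rw [commute_iff_eq, ← sub_eq_zero, ← one_smul ℂ (dQ D j s * dP D i r)]
  ext N
  rw [(isCur_dP D i).coeff_mul_sub (isCur_dQ D j)]
  have hc : D.c (-1) (-1) i j = D.c 1 1 j i := by
    rw [Datum.c, Datum.c, D.B_symm]; simp
  set c := D.c 1 1 j i with hc'
  -- A term can be nonzero only if `r + k ≤ t ≤ N`, so `k ≤ N - r` suffices.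
  obtain ⟨M, hM⟩ : ∃ M : ℕ, N - r < M := ⟨(N - r + 1).toNat, by omega⟩
  -- the common expansion of both products
  let G : ℕ → ℤ → Ut D ⊗[ℂ] Ut D := fun k t => (c * gco c k) •
    ((Ut.x D (-1) j (s - N + t - k) * Ut.phiZ D (-1) i (r - t + k)) ⊗ₜ[ℂ]
      (Ut.x D 1 i t * Ut.phiZ D 1 j (N - t)))
  have hG : ∀ k, (G k).support ⊆ Set.Icc (r + k) N := by
    intro k t ht
    by_contra h
    refine ht ?_
    rw [Set.mem_Icc, not_and_or, not_le, not_le] at h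
    rcases h with h | h
    · simp only [G]
      rw [Ut.phiZ_of_neg D (-1) i (by simp; omega), mul_zero, TensorProduct.zero_tmul, smul_zero]
    · simp only [G]
      rw [Ut.phiZ_of_neg D 1 j (by simp; omega), mul_zero, TensorProduct.tmul_zero, smul_zero]
  have hGf : ∀ k, (G k).HasFiniteSupport := fun k => (Set.finite_Icc _ _).subset (hG k)
  have h1 : ∀ t, (Ut.phiZ D (-1) i (r - t) * Ut.x D (-1) j (s - N + t)) ⊗ₜ[ℂ]
      (Ut.x D 1 i t * Ut.phiZ D 1 j (N - t)) = ∑ k ∈ Finset.range M, G k t := by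
    intro t
    rcases lt_or_ge N t with h | h
    · rw [Ut.phiZ_of_neg D 1 j (by simp; omega), mul_zero, TensorProduct.tmul_zero,
        Finset.sum_eq_zero]
      intro k _
      exact Function.notMem_support.1 fun h' => absurd (hG k h').2 (by omega)
    · rw [Ut.phiZ_mul_x D (-1) (-1) i j _ _ (M := M) (by simp; omega), TensorProduct.sum_tmul]
      refine Finset.sum_congr rfl fun k _ => ?_
      rw [hc, ← TensorProduct.smul_tmul']
      simp [G, sub_eq_add_neg]
  have h2 : ∀ t, (Ut.x D (-1) j (s - N + t) * Ut.phiZ D (-1) i (r - t)) ⊗ₜ[ℂ]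
      (Ut.phiZ D 1 j (N - t) * Ut.x D 1 i t) = ∑ k ∈ Finset.range M, G k (t + k) := by
    intro t
    rcases lt_or_ge t r with h | h
    · rw [Ut.phiZ_of_neg D (-1) i (by simp; omega), mul_zero, TensorProduct.zero_tmul,
        Finset.sum_eq_zero]
      intro k _
      exact Function.notMem_support.1 fun h' => absurd (hG k h').1 (by omega)
    · rw [Ut.phiZ_mul_x D 1 1 j i _ _ (M := M) (by simp; omega), TensorProduct.tmul_sum]
      refine Finset.sum_congr rfl fun k _ => ?_
      rw [← hc', TensorProduct.tmul_smul]
      simp only [G, Units.val_one, one_mul]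
      rw [show s - N + (t + k) - (k : ℤ) = s - N + t by ring,
        show r - (t + k) + (k : ℤ) = r - t by ring, show N - (t + k : ℤ) = N - t - k by ring]
  have hGf' : ∀ k : ℕ, (fun t => G k (t + k)).HasFiniteSupport := fun k =>
    ((hGf k).preimage (f := fun t => t + (k : ℤ)) (fun a _ b _ hab => by simpa using hab))
  simp only [h1, h2, one_smul]
  rw [finsum_sub_distrib, finsum_sum_comm _ _ fun k _ => hGf k,
    finsum_sum_comm _ _ fun k _ => hGf' k, HahnSeries.coeff_zero, sub_eq_zero]
  · exact Finset.sum_congr rfl fun k _ => (finsum_comp_equiv (Equiv.addRight (k : ℤ))).symm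
  · refine (Set.Finite.biUnion (Finset.range M).finite_toSet fun k _ => hGf k).subset
      fun t ht => ?_
    obtain ⟨k, hk, hne⟩ := Finset.exists_ne_zero_of_sum_ne_zero ht
    exact Set.mem_biUnion hk hne
  · refine (Set.Finite.biUnion (Finset.range M).finite_toSet fun k _ => hGf' k).subset
      fun t ht => ?_
    obtain ⟨k, hk, hne⟩ := Finset.exists_ne_zero_of_sum_ne_zero ht
    exact Set.mem_biUnion hk hne

end Coproduct

/-! ### Existence and uniqueness of the deformed coproduct -/

section Existence

variable {n : ℕ} {H : Type*} [AddCommGroup H] [Module ℚ H] (D : Datum n H)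

/-- The deformed coproduct on the free algebra. -/
noncomputable def dFree : Free n H →ₐ[ℂ] UtCompl D :=
  FreeAlgebra.lift ℂ fun g => match g with
    | Gen.x ε i r => dX D ε i r
    | Gen.k h => dK D h
    | Gen.h i m => dH D i m

theorem dFree_x (ε : ℤˣ) (i : Fin n) (r : ℤ) : dFree D (xF ε i r) = dX D ε i r :=
  FreeAlgebra.lift_ι_apply _ _

theorem dFree_k (h : H) : dFree D (kF h) = dK D h :=
  FreeAlgebra.lift_ι_apply _ _

theorem dFree_h (i : Fin n) (m : ℤ) : dFree D (hF i m) = dH D i m := by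
  rcases eq_or_ne m 0 with rfl | hm
  · simp [hF, dH, Ut.h_zero]
  · rw [hF, dif_pos hm]
    exact FreeAlgebra.lift_ι_apply _ _

/-- The embedding of `A` as constant series in the first tensor factor. -/
noncomputable def leftHom (A : Type*) [Ring A] [Algebra ℂ A] : A →+* LaurentSeries (A ⊗[ℂ] A) :=
  HahnSeries.C.comp (Algebra.TensorProduct.includeLeft (R := ℂ) (S := ℂ) (A := A) (B := A) :
    A →+* A ⊗[ℂ] A)

theorem leftHom_apply {A : Type*} [Ring A] [Algebra ℂ A] (a : A) :
    leftHom A a = HahnSeries.single 0 (a ⊗ₜ[ℂ] 1) := rfl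

theorem smul_single {T : Type*} [Ring T] [Algebra ℂ T] (c : ℂ) (m : ℤ) (t : T) :
    c • (HahnSeries.single m t : LaurentSeries T) = HahnSeries.single m (c • t) := by
  ext N
  simp only [HahnSeries.coeff_smul, HahnSeries.coeff_single]
  split_ifs <;> simp

theorem single_sum {T ι : Type*} [Ring T] (m : ℤ) (s : Finset ι) (t : ι → T) :
    (HahnSeries.single m (∑ i ∈ s, t i) : LaurentSeries T) = ∑ i ∈ s, HahnSeries.single m (t i) :=
  map_sum (HahnSeries.single.addMonoidHom m) t s

theorem nsmul_single {T : Type*} [Ring T] (c : ℕ) (m : ℤ) (t : T) :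
    c • (HahnSeries.single m t : LaurentSeries T) = HahnSeries.single m (c • t) := by
  ext N
  rw [HahnSeries.coeff_nsmul]
  simp only [HahnSeries.coeff_single, Pi.smul_apply]
  split_ifs <;> simp

/-- The image of the exponent is `f₁ + f₂`, where `f₁` lives on the left leg and `f₂` on the right
leg with its powers of `u`. These commute, so the product of the two exponentials satisfies the
Euler equation of `exp (f₁ + f₂)`. -/
theorem dFree_expCoeff (ε : ℤˣ) (i : Fin n) (m : ℕ) :
    dFree D (expCoeff (PowerSeries.mk fun p : ℕ =>
      (((ε : ℤ) : ℂ) * (D.qp 1 - D.qp (-1))) • (hF i ((ε : ℤ) * (p : ℤ)) : Free n H)) m) =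
    ∑ p ∈ Finset.HasAntidiagonal.antidiagonal m, HahnSeries.single ((ε : ℤ) * p.2)
      (expCoeff (etaS D ε i) p.1 ⊗ₜ[ℂ] expCoeff (etaS D ε i) p.2) := by
  set η := etaS D ε i with hη
  have hη0 := coeff_zero_etaS D ε i
  have hηc := commute_etaS D ε ε i i
  let f₁ : PowerSeries (UtCompl D) := PowerSeries.map (leftHom _) η
  let f₂ : PowerSeries (UtCompl D) := PowerSeries.mk fun p =>
    HahnSeries.single ((ε : ℤ) * p) (1 ⊗ₜ[ℂ] PowerSeries.coeff p η)
  let E₁ : PowerSeries (UtCompl D) := PowerSeries.map (leftHom _) (expS η)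
  let E₂ : PowerSeries (UtCompl D) := PowerSeries.mk fun p =>
    HahnSeries.single ((ε : ℤ) * p) (1 ⊗ₜ[ℂ] expCoeff η p)
  have hf₁ : ∀ p, PowerSeries.coeff p f₁ = HahnSeries.single 0 (PowerSeries.coeff p η ⊗ₜ[ℂ] 1) :=
    fun p => PowerSeries.coeff_map _ _ _
  have hf₂ : ∀ p, PowerSeries.coeff p f₂ =
      HahnSeries.single ((ε : ℤ) * p) (1 ⊗ₜ[ℂ] PowerSeries.coeff p η) :=
    fun p => PowerSeries.coeff_mk _ _
  have hE₁c : ∀ p, PowerSeries.coeff p E₁ = HahnSeries.single 0 (expCoeff η p ⊗ₜ[ℂ] 1) :=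
    fun p => by rw [PowerSeries.coeff_map, coeff_expS, leftHom_apply]
  have hE₂c : ∀ p, PowerSeries.coeff p E₂ =
      HahnSeries.single ((ε : ℤ) * p) (1 ⊗ₜ[ℂ] expCoeff η p) := fun p => PowerSeries.coeff_mk _ _
  have hE₁ : euler E₁ = euler f₁ * E₁ := by
    have h : ∀ g : PowerSeries (Ut D), euler (PowerSeries.map (leftHom (Ut D)) g) =
        PowerSeries.map (leftHom (Ut D)) (euler g) := fun g => by ext; simp
    rw [h, h, euler_expS hη0 hηc, map_mul]
  have hE₂ : euler E₂ = euler f₂ * E₂ := by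
    ext1 p
    rw [coeff_euler, hE₂c, nsmul_single, ← TensorProduct.tmul_smul, nsmul_expCoeff hη0 hηc,
      TensorProduct.tmul_sum, single_sum, PowerSeries.coeff_mul]
    refine Finset.sum_congr rfl fun a ha => ?_
    rw [coeff_euler, hf₂, hE₂c, nsmul_single, HahnSeries.single_mul_single,
      ← TensorProduct.tmul_smul, Algebra.TensorProduct.tmul_mul_tmul, one_mul, ← mul_add,
      ← Nat.cast_add, (Finset.HasAntidiagonal.mem_antidiagonal.1 ha)]
  have hcomm12 : ∀ (a b : Ut D) (l m : ℤ), Commute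
      (HahnSeries.single l (a ⊗ₜ[ℂ] (1 : Ut D)) : UtCompl D)
      (HahnSeries.single m ((1 : Ut D) ⊗ₜ[ℂ] b)) := fun a b l m => by
    rw [commute_iff_eq, HahnSeries.single_mul_single, HahnSeries.single_mul_single,
      Algebra.TensorProduct.tmul_mul_tmul, Algebra.TensorProduct.tmul_mul_tmul, one_mul, mul_one,
      one_mul, mul_one, add_comm]
  have hcomm : Commute E₁ (euler f₂) := commute_of_coeff fun a b => by
    rw [hE₁c, coeff_euler, hf₂, nsmul_single, ← TensorProduct.tmul_smul]
    exact hcomm12 _ _ _ _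
  have hf : PowerSeries.map (dFree D : Free n H →+* UtCompl D) (PowerSeries.mk fun p : ℕ =>
      (((ε : ℤ) : ℂ) * (D.qp 1 - D.qp (-1))) • (hF i ((ε : ℤ) * (p : ℤ)) : Free n H)) =
      f₁ + f₂ := by
    ext1 p
    rw [PowerSeries.coeff_map, PowerSeries.coeff_mk, map_add, hf₁, hf₂, hη, coeff_etaS]
    refine (map_smul (dFree D) _ _).trans ?_
    rw [dFree_h, dH, smul_add, smul_single, smul_single, TensorProduct.tmul_smul,
      TensorProduct.smul_tmul']
  rw [map_expCoeff, hf, ← coeff_expS, expS_eq (E := E₁ * E₂), PowerSeries.coeff_mul]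
  · refine Finset.sum_congr rfl fun p _ => ?_
    rw [hE₁c, hE₂c, HahnSeries.single_mul_single, Algebra.TensorProduct.tmul_mul_tmul, one_mul,
      mul_one, zero_add]
  · rw [map_add, hf₁, hf₂, hη0]
    simp
  · intro a b
    have hs : ∀ (a b : Ut D) (l m : ℤ), Commute a b → Commute
        (HahnSeries.single l ((1 : Ut D) ⊗ₜ[ℂ] a) : UtCompl D)
        (HahnSeries.single m ((1 : Ut D) ⊗ₜ[ℂ] b)) := fun a b l m h => by
      rw [commute_iff_eq, HahnSeries.single_mul_single, HahnSeries.single_mul_single,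
        Algebra.TensorProduct.tmul_mul_tmul, Algebra.TensorProduct.tmul_mul_tmul, h.eq, add_comm]
    rw [map_add, map_add, hf₁, hf₁, hf₂, hf₂]
    exact ((hηc a b).map (leftHom (Ut D)) |>.add_right (hcomm12 _ _ _ _)).add_left
      ((hcomm12 _ _ _ _).symm.add_right (hs _ _ _ _ (hηc a b)))
  · rw [PowerSeries.coeff_mul, Finset.Nat.antidiagonal_zero, Finset.sum_singleton, hE₁c, hE₂c]
    simp [← Algebra.TensorProduct.one_def]
  · rw [euler_mul, hE₁, hE₂, ← mul_assoc, hcomm.eq, euler_add, add_mul, mul_assoc, mul_assoc]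

theorem dFree_phiF (ε : ℤˣ) (i : Fin n) (m : ℕ) :
    dFree D (phiF D ε i m) = ∑ l ∈ Finset.range (m + 1),
      HahnSeries.single ((ε : ℤ) * (l : ℤ)) (Ut.phi D ε i (m - l) ⊗ₜ[ℂ] Ut.phi D ε i l) := by
  rw [phiF, map_mul, dFree_expCoeff, dFree_k, dK, Finset.mul_sum,
    ← Finset.Nat.sum_antidiagonal_swap, Finset.Nat.sum_antidiagonal_eq_sum_range_succ_mk]
  refine Finset.sum_congr rfl fun l _ => ?_
  rw [HahnSeries.single_mul_single, Algebra.TensorProduct.tmul_mul_tmul, Ut.phi_eq, Ut.phi_eq,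
    zero_add, Prod.fst_swap, Prod.snd_swap]

/-- With `φ` extended by zero, the coproduct of `φ` has a form uniform in all integers, which can be
compared with the bracket of `x^+` and `x^-`. -/
theorem coeff_dFree_phiZF (ε : ℤˣ) (i : Fin n) (R N : ℤ) :
    (dFree D (phiZF D ε i R)).coeff N = Ut.phiZ D ε i (R - N) ⊗ₜ[ℂ] Ut.phiZ D ε i N := by
  have hee : (ε : ℤ) * (ε : ℤ) = 1 := by
    rw [← Units.val_mul, Int.units_mul_self, Units.val_one]
  have hmul : (ε : ℤ) * (R - N) = ε * R - ε * N := mul_sub _ _ _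
  rcases lt_or_ge ((ε : ℤ) * N) 0 with hN | hN
  · rw [Ut.phiZ_of_neg D ε i hN, TensorProduct.tmul_zero, phiZF]
    split_ifs with h
    · rw [dFree_phiF, HahnSeries.coeff_sum]
      refine Finset.sum_eq_zero fun l _ => HahnSeries.coeff_single_of_ne ?_
      rintro rfl
      rw [← mul_assoc, hee] at hN
      omega
    · simp
  obtain ⟨l, hl⟩ := Int.eq_ofNat_of_zero_le hN
  rcases lt_or_ge ((ε : ℤ) * (R - N)) 0 with h | h
  · rw [Ut.phiZ_of_neg D ε i h, TensorProduct.zero_tmul, phiZF]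
    split_ifs with h0
    · rw [dFree_phiF, HahnSeries.coeff_sum]
      refine Finset.sum_eq_zero fun l' hl' => HahnSeries.coeff_single_of_ne ?_
      rintro rfl
      rw [Finset.mem_range] at hl'
      rw [hmul, ← mul_assoc, hee] at h
      omega
    · simp
  obtain ⟨l', hl'⟩ := Int.eq_ofNat_of_zero_le h
  rw [Ut.phiZ_of_nonneg D ε i hl, Ut.phiZ_of_nonneg D ε i hl', phiZF, if_pos (by omega),
    dFree_phiF, HahnSeries.coeff_sum, Finset.sum_eq_single l]
  · have hNl : (ε : ℤ) * (l : ℤ) = N := by rw [← hl, ← mul_assoc, hee, one_mul]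
    rw [hNl, HahnSeries.coeff_single_same, show ((ε : ℤ) * R).toNat - l = l' by omega]
  · intro l'' _ hne
    refine HahnSeries.coeff_single_of_ne ?_
    rintro rfl
    rw [← mul_assoc, hee] at hl
    omega
  · intro h0
    rw [Finset.mem_range] at h0
    omega

theorem dK_mul (h h' : H) : dK D h * dK D h' = dK D (h + h') := by
  rw [dK, dK, dK, HahnSeries.single_mul_single, Algebra.TensorProduct.tmul_mul_tmul, Ut.k_mul,
    add_zero]

theorem dK_zero : dK D 0 = 1 := by
  rw [dK, Ut.k_zero]
  rfl

theorem dK_commute_dH (h : H) (j : Fin n) (m : ℤ) : Commute (dK D h) (dH D j m) := by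
  have hc := (Ut.commute_k_h D h j m).eq
  rw [commute_iff_eq, dK, dH, mul_add, add_mul]
  simp only [HahnSeries.single_mul_single, Algebra.TensorProduct.tmul_mul_tmul, hc, zero_add,
    add_zero, one_mul, mul_one]

theorem dH_commute_dH (i j : Fin n) (m m' : ℤ) : Commute (dH D i m) (dH D j m') := by
  have hc := (Ut.commute_h_h D i j m m').eq
  rw [commute_iff_eq, dH, dH, mul_add, add_mul, add_mul, mul_add, add_mul, add_mul]
  simp only [HahnSeries.single_mul_single, Algebra.TensorProduct.tmul_mul_tmul, hc, zero_add,
    add_zero, one_mul, mul_one, add_comm m m']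
  abel

theorem dK_mul_dX (h : H) (ε : ℤˣ) (j : Fin n) (r : ℤ) :
    dK D h * dX D ε j r = D.qp (((ε : ℤ) : ℚ) * D.root j h) • (dX D ε j r * dK D h) := by
  have hx := Ut.k_mul_x D h ε j
  ext N
  rcases Int.units_eq_one_or ε with rfl | rfl
  · rw [dX_one, mul_add, add_mul, smul_add, HahnSeries.coeff_add, HahnSeries.coeff_add, dK,
      HahnSeries.coeff_smul, HahnSeries.coeff_smul, HahnSeries.coeff_single_zero_mul,
      HahnSeries.coeff_single_zero_mul, HahnSeries.coeff_mul_single_zero,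
      HahnSeries.coeff_mul_single_zero, isCur_dP D j, HahnSeries.coeff_single]
    congr 1
    · split_ifs
      · rw [Algebra.TensorProduct.tmul_mul_tmul, Algebra.TensorProduct.tmul_mul_tmul, hx, mul_one,
          one_mul, TensorProduct.smul_tmul']
      · simp
    · rw [Algebra.TensorProduct.tmul_mul_tmul, Algebra.TensorProduct.tmul_mul_tmul, hx,
        (Ut.commute_k_phiZ D _ _ _ _).eq, TensorProduct.tmul_smul]
  · rw [dX_neg_one, mul_add, add_mul, smul_add, HahnSeries.coeff_add, HahnSeries.coeff_add, dK,
      HahnSeries.coeff_smul, HahnSeries.coeff_smul, HahnSeries.coeff_single_zero_mul,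
      HahnSeries.coeff_single_zero_mul, HahnSeries.coeff_mul_single_zero,
      HahnSeries.coeff_mul_single_zero, isCur_dQ D j, HahnSeries.coeff_single]
    congr 1
    · split_ifs
      · rw [Algebra.TensorProduct.tmul_mul_tmul, Algebra.TensorProduct.tmul_mul_tmul, hx, mul_one,
          one_mul, TensorProduct.tmul_smul]
      · simp
    · rw [Algebra.TensorProduct.tmul_mul_tmul, Algebra.TensorProduct.tmul_mul_tmul, hx,
        (Ut.commute_k_phiZ D _ _ _ _).eq, TensorProduct.smul_tmul']

/-- Since `h` commutes with `φ`, the bracket sees only the leg carrying `x`; the factor `u^m` of the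
second summand of `dH` accounts for the shift of the index when this is the right leg. -/
theorem dH_mul_dX (i j : Fin n) {m : ℤ} (hm : m ≠ 0) (ε : ℤˣ) (r : ℤ) :
    dH D i m * dX D ε j r - dX D ε j r * dH D i m =
      (((ε : ℤ) : ℂ) * ((m : ℂ)⁻¹ * D.qInt (m * D.B i j))) • dX D ε j (m + r) := by
  have hx := Ut.h_mul_x D i j hm ε
  have hφ := fun ε' s => (Ut.commute_h_phiZ D i j m ε' s).eq
  set c := ((ε : ℤ) : ℂ) * ((m : ℂ)⁻¹ * D.qInt (m * D.B i j)) with hcdef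
  clear_value c
  rcases Int.units_eq_one_or ε with rfl | rfl
  · have h1 : dH D i m * HahnSeries.single 0 (Ut.x D 1 j r ⊗ₜ[ℂ] 1) -
        HahnSeries.single 0 (Ut.x D 1 j r ⊗ₜ[ℂ] 1) * dH D i m =
        c • (HahnSeries.single 0 (Ut.x D 1 j (m + r) ⊗ₜ[ℂ] 1) : UtCompl D) := by
      rw [smul_single, TensorProduct.smul_tmul', ← hx r, TensorProduct.sub_tmul, HahnSeries.single_sub, dH,
        add_mul, mul_add]
      simp only [HahnSeries.single_mul_single, Algebra.TensorProduct.tmul_mul_tmul, zero_add,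
        add_zero, one_mul, mul_one]
      abel
    have h2 : dH D i m * dP D j r - dP D j r * dH D i m = c • dP D j (m + r) := by
      ext N
      rw [HahnSeries.coeff_sub, dH, add_mul, mul_add, HahnSeries.coeff_add, HahnSeries.coeff_add,
        HahnSeries.coeff_smul, HahnSeries.coeff_single_zero_mul, HahnSeries.coeff_mul_single_zero,
        HahnSeries.coeff_single_mul, HahnSeries.coeff_mul_single, isCur_dP D j, isCur_dP D j,
        isCur_dP D j]
      simp only [Algebra.TensorProduct.tmul_mul_tmul, one_mul, mul_one, hφ]
      rw [add_sub_add_left_eq_sub, ← TensorProduct.tmul_sub, hx, TensorProduct.tmul_smul,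
        add_sub_cancel, show r - (N - m) = m + r - N by ring]
    rw [dX_one, dX_one, smul_add, ← h1, ← h2, mul_add, add_mul]
    abel
  · have h1 : dH D i m * HahnSeries.single r (1 ⊗ₜ[ℂ] Ut.x D (-1) j r) -
        HahnSeries.single r (1 ⊗ₜ[ℂ] Ut.x D (-1) j r) * dH D i m =
        c • (HahnSeries.single (m + r) (1 ⊗ₜ[ℂ] Ut.x D (-1) j (m + r)) : UtCompl D) := by
      rw [smul_single, ← TensorProduct.tmul_smul, ← hx r, TensorProduct.tmul_sub, HahnSeries.single_sub, dH,
        add_mul, mul_add]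
      simp only [HahnSeries.single_mul_single, Algebra.TensorProduct.tmul_mul_tmul, zero_add,
        add_zero, one_mul, mul_one, add_comm r m]
      abel
    have h2 : dH D i m * dQ D j r - dQ D j r * dH D i m = c • dQ D j (m + r) := by
      ext N
      rw [HahnSeries.coeff_sub, dH, add_mul, mul_add, HahnSeries.coeff_add, HahnSeries.coeff_add,
        HahnSeries.coeff_smul, HahnSeries.coeff_single_zero_mul, HahnSeries.coeff_mul_single_zero,
        HahnSeries.coeff_single_mul, HahnSeries.coeff_mul_single, isCur_dQ D j, isCur_dQ D j,
        isCur_dQ D j]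
      simp only [Algebra.TensorProduct.tmul_mul_tmul, one_mul, mul_one, hφ]
      rw [add_sub_add_right_eq_sub, ← TensorProduct.sub_tmul, hx, ← TensorProduct.smul_tmul',
        show m + (r - N) = m + r - N by ring]
    rw [dX_neg_one, dX_neg_one, smul_add, ← h1, ← h2, mul_add, add_mul]
    abel

/-- Only the brackets `[x^+, x^-] ⊗ φ^+` and `φ^- ⊗ [x^+, x^-]` survive. They contribute `(φ^+ -
φ^-) ⊗ φ^+` and `φ^- ⊗ (φ^+ - φ^-)`, in which the terms `φ^- ⊗ φ^+` cancel. -/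
theorem dX_dX_comm (i j : Fin n) (r s : ℤ) :
    dX D 1 i r * dX D (-1) j s - dX D (-1) j s * dX D 1 i r =
      if i = j then (D.qp (D.r i : ℚ) - D.qp (-(D.r i : ℚ)))⁻¹ •
        (dFree D (phiZF D 1 i (r + s)) - dFree D (phiZF D (-1) i (r + s))) else 0 := by
  have hx := Ut.x_x_comm D i j
  have h1 : dX D 1 i r * dX D (-1) j s - dX D (-1) j s * dX D 1 i r =
      (HahnSeries.single 0 (Ut.x D 1 i r ⊗ₜ[ℂ] 1) * dQ D j s
        - dQ D j s * HahnSeries.single 0 (Ut.x D 1 i r ⊗ₜ[ℂ] 1)) +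
      (dP D i r * HahnSeries.single s (1 ⊗ₜ[ℂ] Ut.x D (-1) j s)
        - HahnSeries.single s (1 ⊗ₜ[ℂ] Ut.x D (-1) j s) * dP D i r) := by
    have h2 : (HahnSeries.single 0 (Ut.x D 1 i r ⊗ₜ[ℂ] 1) : UtCompl D) *
        HahnSeries.single s (1 ⊗ₜ[ℂ] Ut.x D (-1) j s) =
        HahnSeries.single s (1 ⊗ₜ[ℂ] Ut.x D (-1) j s) *
        HahnSeries.single 0 (Ut.x D 1 i r ⊗ₜ[ℂ] 1) := by
      simp only [HahnSeries.single_mul_single, Algebra.TensorProduct.tmul_mul_tmul, one_mul,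
        mul_one, zero_add, add_zero]
    rw [dX_one, dX_neg_one, mul_add, add_mul, add_mul, mul_add, add_mul, add_mul, h2,
      (dP_commute_dQ D i j r s).eq]
    abel
  rw [h1]
  ext N
  rw [HahnSeries.coeff_add, HahnSeries.coeff_sub, HahnSeries.coeff_sub,
    HahnSeries.coeff_single_zero_mul, HahnSeries.coeff_mul_single_zero,
    HahnSeries.coeff_single_mul, HahnSeries.coeff_mul_single, isCur_dP D i, isCur_dQ D j]
  simp only [Algebra.TensorProduct.tmul_mul_tmul, one_mul, mul_one]
  rw [← TensorProduct.sub_tmul, ← TensorProduct.tmul_sub, hx, hx]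
  split_ifs with hij
  · subst hij
    rw [HahnSeries.coeff_smul, HahnSeries.coeff_sub, coeff_dFree_phiZF, coeff_dFree_phiZF,
      show r + (s - N) = r + s - N by ring, show r - (N - s) = r + s - N by ring,
      sub_add_cancel, ← TensorProduct.smul_tmul', TensorProduct.tmul_smul, ← smul_add,
      TensorProduct.sub_tmul, TensorProduct.tmul_sub]
    congr 1
    abel
  · simp

theorem dFree_rel {a b : Free n H} (h : Rel D a b) : dFree D a = dFree D b := by
  induction h with
  | k_mul h h' => rw [map_mul, dFree_k, dFree_k, dFree_k, dK_mul]
  | k_zero => rw [map_one, dFree_k, dK_zero]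
  | k_h h j m hm => rw [map_mul, map_mul, dFree_k, dFree_h, (dK_commute_dH D h j m).eq]
  | h_h i j m m' hm hm' =>
    rw [map_mul, map_mul, dFree_h, dFree_h, (dH_commute_dH D i j m m').eq]
  | k_x h ε j r =>
    rw [map_mul, map_mul, map_smul, dFree_k, dFree_x, dFree_k, dK_mul_dX]
    refine (Algebra.smul_mul_assoc _ _ _).trans ?_
    rw [mul_assoc, dK_mul, add_neg_cancel, dK_zero, mul_one]
  | h_x i j m hm ε r =>
    rw [map_sub, map_mul, map_mul, map_smul, dFree_h, dFree_x, dFree_x, dH_mul_dX D i j hm]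
  | x_x i j r r' =>
    rw [map_sub, map_mul, map_mul, dFree_x, dFree_x, dX_dX_comm, apply_ite (dFree D), map_smul,
      map_sub, map_zero]
  | x_quad ε i j r r' =>
    rw [map_sub, map_sub, map_smul, map_smul, map_mul, map_mul, map_mul, map_mul, dFree_x,
      dFree_x, dFree_x, dFree_x]
    exact quad_dX D ε i j r r'

/-- The deformed coproduct on `Ũ_q(ĝ)`. -/
noncomputable def dU : Ut D →ₐ[ℂ] UtCompl D :=
  RingQuot.liftAlgHom ℂ ⟨dFree D, fun _ _ h => dFree_rel D h⟩

theorem dU_mkU (a : Free n H) : dU D (mkU D a) = dFree D a :=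
  RingQuot.liftAlgHom_mkAlgHom_apply _ _ _ _

theorem algebraMap_utCompl (c : LC) :
    algebraMap LC (UtCompl D) c = laurentScalars (Ut D ⊗[ℂ] Ut D) c := rfl

/-- Coefficientwise scalars and constant Laurent series act in the same way, as required to extend
`dU` to `ℂ((u)) ⊗ Ũ`. -/
instance : IsScalarTower ℂ LC (UtCompl D) := by
  refine IsScalarTower.of_algebraMap_eq fun c => ?_
  ext N
  rw [algebraMap_utCompl]
  change _ = algebraMap ℂ (Ut D ⊗[ℂ] Ut D)
    ((HahnSeries.C (algebraMap ℂ ℂ c) : LaurentSeries ℂ).coeff N)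
  change (HahnSeries.C (algebraMap ℂ (Ut D ⊗[ℂ] Ut D) c)).coeff N = _
  rw [HahnSeries.C_apply, HahnSeries.C_apply, HahnSeries.coeff_single, HahnSeries.coeff_single]
  split_ifs <;> simp

/-- The deformed coproduct `Δ_u`. -/
noncomputable def coproduct : Ut' D →ₐ[LC] UtCompl D :=
  Algebra.TensorProduct.lift (Algebra.ofId LC (UtCompl D)) (dU D)
    fun c t => Algebra.commutes c (dU D t)

theorem coproduct_incl (a : Ut D) : coproduct D (incl D a) = dU D a := by
  refine (Algebra.TensorProduct.lift_tmul (R := ℂ) (S := LC) (Algebra.ofId LC (UtCompl D)) (dU D)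
    (fun c t => Algebra.commutes c (dU D t)) 1 a).trans ?_
  rw [map_one, one_mul]

theorem isDrinfeldCoproduct_coproduct : IsDrinfeldCoproduct D (coproduct D) where
  map_x_pos i r := by
    rw [coproduct_incl, Ut.x, dU_mkU, dFree_x, dX_one]
    rfl
  map_x_neg i r := by
    rw [coproduct_incl, Ut.x, dU_mkU, dFree_x, dX_neg_one]
    rfl
  map_phi ε i m := by
    rw [coproduct_incl, Ut.phi, dU_mkU, dFree_phiF]
  map_k h := by
    rw [coproduct_incl, Ut.k, dU_mkU, dFree_k]
    rfl

/-- Homomorphisms which agree on the `k_h` and the `φ_{i,m}^±` agree on the `h_{i,m}`. -/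
theorem map_h_eq_of_map_phi_eq {B : Type*} [Ring B] [Algebra ℂ B] {F G : Ut D →ₐ[ℂ] B}
    (hk : ∀ h, F (Ut.k D h) = G (Ut.k D h))
    (hφ : ∀ ε i m, F (Ut.phi D ε i m) = G (Ut.phi D ε i m)) (i : Fin n) {m : ℤ} (hm : m ≠ 0) :
    F (Ut.h D i m) = G (Ut.h D i m) := by
  obtain ⟨ε, p, hp, rfl⟩ : ∃ (ε : ℤˣ) (p : ℕ), 0 < p ∧ m = (ε : ℤ) * p := by
    rcases lt_or_gt_of_ne hm with h | h
    · exact ⟨-1, m.natAbs, by omega, by rw [Units.val_neg, Units.val_one]; omega⟩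
    · exact ⟨1, m.natAbs, by omega, by rw [Units.val_one]; omega⟩
  have hE : PowerSeries.map (F : Ut D →+* B) (expS (etaS D ε i)) =
      PowerSeries.map (G : Ut D →+* B) (expS (etaS D ε i)) := by
    ext1 m
    rw [PowerSeries.coeff_map, PowerSeries.coeff_map, coeff_expS]
    change F _ = G _
    have h1 : expCoeff (etaS D ε i) m =
        Ut.k D (-(((ε : ℤ) * (D.r i : ℤ)) • D.coroot i)) * Ut.phi D ε i m := by
      rw [Ut.phi_eq, ← mul_assoc, Ut.k_mul, neg_add_cancel, Ut.k_zero, one_mul]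
    rw [h1, map_mul, map_mul, hk, hφ]
  have he : ∀ F : Ut D →ₐ[ℂ] B,
      euler (PowerSeries.map (F : Ut D →+* B) (expS (etaS D ε i))) =
      euler (PowerSeries.map (F : Ut D →+* B) (etaS D ε i)) *
        PowerSeries.map (F : Ut D →+* B) (expS (etaS D ε i)) := by
    intro F
    have h : ∀ g : PowerSeries (Ut D), euler (PowerSeries.map (F : Ut D →+* B) g) =
        PowerSeries.map (F : Ut D →+* B) (euler g) := fun g => by ext; simp
    rw [h, h, euler_expS (coeff_zero_etaS D ε i) (commute_etaS D ε ε i i), map_mul]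
  have h1 := he F
  rw [hE, he G, ← sub_eq_zero, ← sub_mul] at h1
  -- The difference of the two derivatives is killed by multiplication by a series with constant
  -- term `1`, so it vanishes coefficient by coefficient.
  have h2 : ∀ m, PowerSeries.coeff m (euler (PowerSeries.map (G : Ut D →+* B) (etaS D ε i)) -
      euler (PowerSeries.map (F : Ut D →+* B) (etaS D ε i))) = 0 := by
    intro m
    induction m using Nat.strong_induction_on with
    | _ m ih =>
      have h3 := congrArg (PowerSeries.coeff m) h1
      rw [PowerSeries.coeff_mul, Finset.sum_eq_single (m, 0)] at h3
      · simpa using h3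
      · intro a ha hne
        have := Finset.HasAntidiagonal.mem_antidiagonal.1 ha
        have h0 : a.2 ≠ 0 := fun h0 => hne (Prod.ext (by simp; omega) h0)
        rw [ih a.1 (by omega), zero_mul]
      · intro h0
        exact absurd (Finset.HasAntidiagonal.mem_antidiagonal.2 (by simp)) h0
  have h3 := h2 p
  rw [map_sub, sub_eq_zero, coeff_euler, coeff_euler, PowerSeries.coeff_map,
    PowerSeries.coeff_map, coeff_etaS, ← Nat.cast_smul_eq_nsmul ℂ, ← Nat.cast_smul_eq_nsmul ℂ] at h3
  have h4 := smul_right_injective _ (Nat.cast_ne_zero.2 hp.ne') h3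
  have h5 : (((ε : ℤ) : ℂ) * (D.qp 1 - D.qp (-1))) • G (Ut.h D i ((ε : ℤ) * p)) =
      (((ε : ℤ) : ℂ) * (D.qp 1 - D.qp (-1))) • F (Ut.h D i ((ε : ℤ) * p)) := by
    rw [← map_smul, ← map_smul]
    exact h4
  exact (smul_right_injective _ (mul_ne_zero (by simp) D.q_sub_ne_zero) h5).symm

/-- A coproduct is prescribed on the `φ`'s and not on the generators `h`, so uniqueness needs
extensionality in this form. -/
theorem Ut.algHom_ext {B : Type*} [Ring B] [Algebra ℂ B] {F G : Ut D →ₐ[ℂ] B}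
    (hx : ∀ ε i r, F (Ut.x D ε i r) = G (Ut.x D ε i r))
    (hk : ∀ h, F (Ut.k D h) = G (Ut.k D h))
    (hφ : ∀ ε i m, F (Ut.phi D ε i m) = G (Ut.phi D ε i m)) : F = G := by
  refine RingQuot.ringQuot_ext' ℂ F G (FreeAlgebra.hom_ext (funext fun g => ?_))
  match g with
  | Gen.x ε i r => exact hx ε i r
  | Gen.k h => exact hk h
  | Gen.h i m =>
    have := map_h_eq_of_map_phi_eq D hk hφ i m.2
    rw [Ut.h, hF, dif_pos m.2] at this
    exact this

theorem incl_ext {B : Type*} [Ring B] [Algebra LC B] {F G : Ut' D →ₐ[LC] B}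
    (h : ∀ a, F (incl D a) = G (incl D a)) : F = G := by
  refine AlgHom.ext fun t => ?_
  induction t using TensorProduct.induction_on with
  | zero => rw [map_zero, map_zero]
  | add a b ha hb => rw [map_add, map_add, ha, hb]
  | tmul c a =>
    have : c ⊗ₜ[ℂ] a = c • incl D a := by
      rw [incl, Algebra.TensorProduct.includeRight_apply, TensorProduct.smul_tmul', smul_eq_mul,
        mul_one]
    rw [this, map_smul, map_smul, h]

theorem IsDrinfeldCoproduct.eq {Δ Δ' : Ut' D →ₐ[LC] UtCompl D} (h : IsDrinfeldCoproduct D Δ)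
    (h' : IsDrinfeldCoproduct D Δ') : Δ = Δ' := by
  refine incl_ext D fun a => ?_
  have : (Δ.restrictScalars ℂ).comp (incl D) = (Δ'.restrictScalars ℂ).comp (incl D) := by
    refine Ut.algHom_ext D (fun ε i r => ?_) (fun k => ?_) fun ε i m => ?_
    · rcases Int.units_eq_one_or ε with rfl | rfl
      · exact (h.map_x_pos i r).trans (h'.map_x_pos i r).symm
      · exact (h.map_x_neg i r).trans (h'.map_x_neg i r).symm
    · exact (h.map_k k).trans (h'.map_k k).symm
    · exact (h.map_phi ε i m).trans (h'.map_phi ε i m).symm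
  exact AlgHom.congr_fun this a

end Existence

/-! ### The `u`-adic topology -/

section Topology

open WithZero Filter Topology

noncomputable instance : Valued LC (WithZero (Multiplicative ℤ)) :=
  inferInstanceAs (Valued (LaurentSeries ℂ) (WithZero (Multiplicative ℤ)))

instance : CompleteSpace LC := inferInstanceAs (CompleteSpace (LaurentSeries ℂ))

instance : NonarchimedeanRing LC := by
  have h := (Valued.v (R := LC) (Γ₀ := WithZero (Multiplicative ℤ))).subgroups_basis.nonarchimedean
  have h2 := congrArg (fun u : UniformSpace LC => u.toTopologicalSpace)
    (Valued.toUniformSpace_eq LC (WithZero (Multiplicative ℤ)))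
  have h3 : (Valued.toUniformSpace.toTopologicalSpace : TopologicalSpace LC) = 
    (Valued.v (R := LC) (Γ₀ := WithZero (Multiplicative ℤ))).subgroups_basis.topology := h2
  rw [h3]
  exact h

theorem LC.coeff_zero (m : ℤ) : LC.coeff 0 m = 0 := rfl

theorem LC.coeff_add (c d : LC) (m : ℤ) : (c + d).coeff m = c.coeff m + d.coeff m := rfl

theorem LC.coeff_sub (c d : LC) (m : ℤ) : (c - d).coeff m = c.coeff m - d.coeff m := rfl

theorem LC.coeff_sum {ι : Type*} (s : Finset ι) (c : ι → LC) (m : ℤ) :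
    (∑ i ∈ s, c i).coeff m = ∑ i ∈ s, (c i).coeff m :=
  map_sum (⟨⟨fun c : LC => c.coeff m, rfl⟩, fun _ _ => rfl⟩ : LC →+ ℂ) c s

theorem LC.coeff_mul_uPow (c : LC) (l m : ℤ) : (c * uPow l).coeff m = c.coeff (m - l) := by
  have := HahnSeries.coeff_mul_single (r := (1 : ℂ)) (x := (c : LaurentSeries ℂ)) (a := m) (b := l)
  rw [mul_one] at this
  exact this

theorem LC.coeff_algebraMap_mul (a : ℂ) (c : LC) (m : ℤ) :
    (algebraMap ℂ LC a * c).coeff m = a * c.coeff m :=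
  HahnSeries.coeff_single_zero_mul (r := a) (x := (c : LaurentSeries ℂ)) (a := m)

theorem LC.coeff_uPow (l m : ℤ) : (uPow l).coeff m = if m = l then 1 else 0 := by
  have := HahnSeries.coeff_single (R := ℂ) (a := l) (b := m) (r := 1)
  convert! this

theorem uPow_zero : uPow 0 = 1 := rfl

theorem uPow_add (l m : ℤ) : uPow (l + m) = uPow l * uPow m := by
  have := HahnSeries.single_mul_single (a := l) (b := m) (r := (1 : ℂ)) (s := 1)
  rw [mul_one] at this
  exact this.symm

theorem mem_uLattice_iff {N : ℤ} {c : LC} :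
    c ∈ uLattice N ↔ Valued.v c ≤ exp (-N) :=
  (LaurentSeries.valuation_le_iff_coeff_lt_eq_zero ℂ (f := (c : LaurentSeries ℂ))).symm

theorem uLattice_mono {M N : ℤ} (h : M ≤ N) : uLattice N ⊆ uLattice M :=
  fun _ hc m hm => hc m (hm.trans_le h)

theorem zero_mem_uLattice (N : ℤ) : (0 : LC) ∈ uLattice N := fun _ _ => rfl

theorem add_mem_uLattice {N : ℤ} {c d : LC} (hc : c ∈ uLattice N) (hd : d ∈ uLattice N) :
    c + d ∈ uLattice N := fun m hm => by rw [LC.coeff_add, hc m hm, hd m hm, add_zero]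

theorem sub_mem_uLattice {N : ℤ} {c d : LC} (hc : c ∈ uLattice N) (hd : d ∈ uLattice N) :
    c - d ∈ uLattice N := fun m hm => by rw [LC.coeff_sub, hc m hm, hd m hm, sub_zero]

theorem sum_mem_uLattice {N : ℤ} {ι : Type*} {s : Finset ι} {c : ι → LC}
    (h : ∀ i ∈ s, c i ∈ uLattice N) : ∑ i ∈ s, c i ∈ uLattice N := fun m hm => by
  rw [LC.coeff_sum]; exact Finset.sum_eq_zero fun i hi => h i hi m hm

theorem mul_mem_uLattice {M N : ℤ} {c d : LC} (hc : c ∈ uLattice M) (hd : d ∈ uLattice N) :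
    c * d ∈ uLattice (M + N) := by
  rw [mem_uLattice_iff] at *
  rw [map_mul, neg_add, exp_add]
  exact mul_le_mul' hc hd

theorem uPow_mem_uLattice (N : ℤ) : uPow N ∈ uLattice N := fun m hm => by
  rw [LC.coeff_uPow, if_neg hm.ne]

theorem algebraMap_mem_uLattice (a : ℂ) : algebraMap ℂ LC a ∈ uLattice 0 := fun m hm => by
  rw [← mul_one (algebraMap ℂ LC a), ← uPow_zero, LC.coeff_algebraMap_mul, LC.coeff_uPow,
    if_neg hm.ne, mul_zero]

theorem exists_mem_uLattice (c : LC) : ∃ N, c ∈ uLattice N :=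
  ⟨HahnSeries.order (c : LaurentSeries ℂ), fun _ hm => HahnSeries.coeff_eq_zero_of_lt_order hm⟩

theorem uLattice_mem_nhds (N : ℤ) : uLattice N ∈ 𝓝 (0 : LC) := by
  have h1 : (Valued.v (uPow N) : WithZero (Multiplicative ℤ)) ≠ 0 := by
    rw [Valuation.ne_zero_iff]
    intro h
    have := congrArg (fun c => LC.coeff c N) h
    simp [LC.coeff_uPow, LC.coeff_zero] at this
  have h2 : (Valued.v.restrict (uPow N)) ≠ 0 := by
    intro h
    exact h1 (by simpa using h)
  rw [Valued.mem_nhds_zero]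
  refine ⟨Units.mk0 _ h2, fun c hc => ?_⟩
  simp only [Set.mem_ofPred_eq, Units.val_mk0, Valuation.restrict_lt_iff] at hc
  rw [mem_uLattice_iff]
  exact hc.le.trans (mem_uLattice_iff.1 (uPow_mem_uLattice N))

theorem exists_uLattice_subset {s : Set LC} (hs : s ∈ 𝓝 (0 : LC)) : ∃ N, uLattice N ⊆ s := by
  obtain ⟨γ, hγ⟩ := Valued.mem_nhds_zero.1 hs
  have h0 : MonoidWithZeroHom.ValueGroup₀.embedding γ.1 ≠ 0 := by simp
  refine ⟨1 - log (MonoidWithZeroHom.ValueGroup₀.embedding γ.1), fun c hc => hγ ?_⟩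
  rw [Set.mem_ofPred_eq, Valuation.restrict_lt_iff_lt_embedding]
  refine (mem_uLattice_iff.1 hc).trans_lt ?_
  rw [← exp_log h0, exp_lt_exp, exp_log h0]
  omega

theorem hasSum_iff_uLattice {ι : Type*} {f : ι → LC} {c : LC} :
    HasSum f c ↔ ∀ N : ℤ, ∃ F₀ : Finset ι, ∀ F : Finset ι, F₀ ⊆ F →
      ∑ i ∈ F, f i - c ∈ uLattice N := by
  rw [HasSum, SummationFilter.unconditional_filter, ← tendsto_sub_nhds_zero_iff]
  constructor
  · intro h N
    exact Filter.eventually_atTop.1 (h (uLattice_mem_nhds N))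
  · intro h s hs
    obtain ⟨N, hN⟩ := exists_uLattice_subset hs
    exact Filter.mem_of_superset (Filter.eventually_atTop.2 (h N)) fun F hF => hN hF

/-- In a complete nonarchimedean group it is enough that the terms tend to zero. -/
theorem summable_of_uLattice {ι : Type*} {f : ι → LC}
    (h : ∀ N : ℤ, {i | f i ∉ uLattice N}.Finite) : Summable f := by
  refine NonarchimedeanAddGroup.summable_of_tendsto_cofinite_zero fun s hs => ?_
  obtain ⟨N, hN⟩ := exists_uLattice_subset hs
  exact Filter.mem_of_superset (h N).compl_mem_cofinite fun i hi => hN (not_not.1 hi)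

theorem mem_uLattice_of_hasSum {ι : Type*} {f : ι → LC} {c : LC} (h : HasSum f c) {N : ℤ}
    (hf : ∀ i, f i ∈ uLattice N) : c ∈ uLattice N := by
  obtain ⟨F, hF⟩ := hasSum_iff_uLattice.1 h N
  have := sub_mem_uLattice (sum_mem_uLattice fun i (_ : i ∈ F) => hf i) (hF F subset_rfl)
  rwa [sub_sub_cancel] at this

theorem hasSum_coeff (c : LC) :
    HasSum (fun m : ℤ => algebraMap ℂ LC (c.coeff m) * uPow m) c := by
  rw [hasSum_iff_uLattice]
  intro N
  obtain ⟨M, hM⟩ := exists_mem_uLattice c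
  refine ⟨Finset.Ico M N, fun F hF m hm => ?_⟩
  rw [LC.coeff_sub, LC.coeff_sum]
  simp only [LC.coeff_algebraMap_mul, LC.coeff_uPow, mul_ite, mul_one, mul_zero]
  rw [Finset.sum_ite_eq]
  split_ifs with h
  · exact sub_self _
  · rw [hM m (by by_contra h'; exact h (hF (Finset.mem_Ico.2 ⟨not_lt.1 h', hm⟩))), sub_zero]

end Topology

/-! ### Summable families of vectors -/

section USum

variable {V W : Type*} [AddCommGroup V] [Module LC V] [AddCommGroup W] [Module LC W]

theorem HasUSum.hasSum_dual {f : ℤ → V} {y : V} (h : HasUSum f y) (ℓ : Module.Dual LC V) :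
    HasSum (fun m => ℓ (f m)) (ℓ y) := by
  obtain ⟨d, e, h⟩ := h
  rw [hasSum_iff_uLattice]
  intro N
  choose M hM using fun β => exists_mem_uLattice (ℓ (e β))
  -- A common bound for the poles of the values `ℓ (e β)`: applying `ℓ` costs only a shift of `N` by
  -- `C`.
  obtain ⟨C, hC⟩ : ∃ C, ∀ β, C ≤ M β := by
    obtain ⟨C, hC⟩ := (Set.finite_range M).bddBelow
    exact ⟨C, fun β => hC ⟨β, rfl⟩⟩
  obtain ⟨F₀, hF₀⟩ := h (N - C)
  refine ⟨F₀, fun F hF => ?_⟩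
  obtain ⟨c, hc, hc'⟩ := hF₀ F hF
  rw [← map_sum, ← map_sub, hc', map_sum]
  refine sum_mem_uLattice fun β _ => ?_
  rw [map_smul, smul_eq_mul]
  have := mul_mem_uLattice (hc β) (uLattice_mono (hC β) (hM β))
  rwa [sub_add_cancel] at this

/-- From `F₀` on, partial sums differ from `y` by elements of the span of `e`; each later term is a
difference of two of these. Adjoining the finitely many terms in `F₀` gives the subspace. -/
theorem HasUSum.exists_fg {f : ℤ → V} {y : V} (h : HasUSum f y) :
    ∃ E : Submodule LC V, E.FG ∧ (∀ m, f m ∈ E) ∧ y ∈ E := by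
  classical
  obtain ⟨d, e, h⟩ := h
  obtain ⟨F₀, hF₀⟩ := h 0
  have he : ∀ F, F₀ ⊆ F → ∑ m ∈ F, f m - y ∈ Submodule.span LC (Set.range e) := by
    intro F hF
    obtain ⟨c, -, hc⟩ := hF₀ F hF
    rw [hc]
    exact Submodule.sum_mem _ fun β _ => Submodule.smul_mem _ _ (Submodule.subset_span ⟨β, rfl⟩)
  have h1 : Submodule.span LC (Set.range e) ≤ Submodule.span LC (Set.range e ∪ f '' F₀) :=
    Submodule.span_mono Set.subset_union_left
  have h2 : ∀ m ∈ F₀, f m ∈ Submodule.span LC (Set.range e ∪ f '' F₀) := fun m hm =>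
    Submodule.subset_span (Or.inr ⟨m, hm, rfl⟩)
  refine ⟨Submodule.span LC (Set.range e ∪ f '' F₀),
    Submodule.fg_span ((Set.finite_range e).union (F₀.finite_toSet.image f)), fun m => ?_, ?_⟩
  · by_cases hm : m ∈ F₀
    · exact h2 m hm
    · have := Submodule.sub_mem _ (h1 (he (insert m F₀) (Finset.subset_insert _ _)))
        (h1 (he F₀ subset_rfl))
      rwa [Finset.sum_insert hm, sub_sub_sub_cancel_right, add_sub_cancel_right] at this
  · have := Submodule.sub_mem _ (Submodule.sum_mem _ h2) (h1 (he F₀ subset_rfl))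
    rwa [sub_sub_cancel] at this

/-- A family in a finite dimensional space is a combination of finitely many vectors, with
coefficients that are linear functionals defined everywhere. -/
theorem exists_dual_coords {E : Submodule LC V} (hE : E.FG) :
    ∃ (d : ℕ) (e : Fin d → V) (ℓ : Fin d → Module.Dual LC V),
      ∀ v ∈ E, v = ∑ k, ℓ k v • e k := by
  have : Module.Finite LC E := Module.Finite.iff_fg.2 hE
  let b := Module.finBasis LC E
  choose ℓ hℓ using fun k => (b.coord k).exists_extend
  refine ⟨_, fun k => b k, ℓ, fun v hv => ?_⟩
  have h1 := congrArg E.subtype (b.sum_repr ⟨v, hv⟩)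
  rw [map_sum] at h1
  refine h1.symm.trans (Finset.sum_congr rfl fun k _ => ?_)
  have := LinearMap.congr_fun (hℓ k) ⟨v, hv⟩
  rw [map_smul]
  exact congrArg (· • (b k : V)) this.symm

/-- Convergence becomes a matter of scalar series in `ℂ((u))`. The subspace `E` cannot be omitted
from this argument: it leaves only finitely many functionals to control at once. -/
theorem hasUSum_iff {f : ℤ → V} {y : V} : HasUSum f y ↔
    (∃ E : Submodule LC V, E.FG ∧ (∀ m, f m ∈ E) ∧ y ∈ E) ∧
      ∀ ℓ : Module.Dual LC V, HasSum (fun m => ℓ (f m)) (ℓ y) := by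
  classical
  refine ⟨fun h => ⟨h.exists_fg, h.hasSum_dual⟩, ?_⟩
  rintro ⟨⟨E, hE, hf, hy⟩, h⟩
  obtain ⟨d, e, ℓ, hℓ⟩ := exists_dual_coords hE
  refine ⟨d, e, fun N => ?_⟩
  choose F₀ hF₀ using fun k => hasSum_iff_uLattice.1 (h (ℓ k)) N
  refine ⟨Finset.univ.biUnion F₀, fun F hF => ⟨fun k => ℓ k (∑ m ∈ F, f m - y), fun k => ?_,
    hℓ _ (E.sub_mem (E.sum_mem fun m _ => hf m) hy)⟩⟩
  change ℓ k _ ∈ _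
  rw [map_sub, map_sum]
  exact hF₀ k F ((Finset.subset_biUnion_of_mem F₀ (Finset.mem_univ k)).trans hF)

theorem HasUSum.unique {f : ℤ → V} {y y' : V} (h : HasUSum f y) (h' : HasUSum f y') : y = y' := by
  rw [← sub_eq_zero, ← Module.forall_dual_apply_eq_zero_iff LC]
  intro ℓ
  rw [map_sub, sub_eq_zero]
  exact (h.hasSum_dual ℓ).unique (h'.hasSum_dual ℓ)

theorem HasUSum.add {f g : ℤ → V} {y z : V} (hf : HasUSum f y) (hg : HasUSum g z) :
    HasUSum (fun m => f m + g m) (y + z) := by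
  rw [hasUSum_iff] at *
  obtain ⟨⟨E, hE, hf, hy⟩, h⟩ := hf
  obtain ⟨⟨E', hE', hg, hz⟩, h'⟩ := hg
  refine ⟨⟨E ⊔ E', hE.sup hE', fun m => Submodule.add_mem_sup (hf m) (hg m),
    Submodule.add_mem_sup hy hz⟩, fun ℓ => ?_⟩
  simp only [map_add]
  exact (h ℓ).add (h' ℓ)

theorem HasUSum.map {f : ℤ → V} {y : V} (hf : HasUSum f y) (T : V →ₗ[LC] W) :
    HasUSum (fun m => T (f m)) (T y) := by
  rw [hasUSum_iff] at *
  obtain ⟨⟨E, hE, hf, hy⟩, h⟩ := hf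
  exact ⟨⟨E.map T, hE.map T, fun m => ⟨_, hf m, rfl⟩, ⟨_, hy, rfl⟩⟩, fun ℓ => h (ℓ.comp T)⟩

theorem HasUSum.const_smul {f : ℤ → V} {y : V} (hf : HasUSum f y) (c : LC) :
    HasUSum (fun m => c • f m) (c • y) :=
  hf.map (c • LinearMap.id)

theorem hasUSum_smul_vec {c : ℤ → LC} {s : LC} (h : HasSum c s) (v : V) :
    HasUSum (fun m => c m • v) (s • v) := by
  rw [hasUSum_iff]
  refine ⟨⟨Submodule.span LC {v}, Submodule.fg_span_singleton v,
    fun m => Submodule.smul_mem _ _ (Submodule.mem_span_singleton_self v),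
    Submodule.smul_mem _ _ (Submodule.mem_span_singleton_self v)⟩, fun ℓ => ?_⟩
  simp only [map_smul, smul_eq_mul]
  exact h.mul_right _

theorem hasUSum_zero : HasUSum (fun _ => (0 : V)) 0 := by
  rw [hasUSum_iff]
  refine ⟨⟨⊥, Submodule.fg_bot, fun m => Submodule.zero_mem _, Submodule.zero_mem _⟩, fun ℓ => ?_⟩
  simp only [map_zero]
  exact hasSum_zero

theorem hasUSum_sum {ι : Type*} {s : Finset ι} {f : ι → ℤ → V} {y : ι → V}
    (h : ∀ i ∈ s, HasUSum (f i) (y i)) :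
    HasUSum (fun m => ∑ i ∈ s, f i m) (∑ i ∈ s, y i) := by
  classical
  induction s using Finset.induction_on with
  | empty => simpa using hasUSum_zero
  | insert i s hi ih =>
    simp only [Finset.sum_insert hi]
    exact (h i (Finset.mem_insert_self i s)).add
      (ih fun j hj => h j (Finset.mem_insert_of_mem hj))

theorem hasUSum_single (l : ℤ) (v : V) : HasUSum (fun m => if m = l then v else 0) v := by
  have := hasUSum_smul_vec (hasSum_ite_eq l (1 : LC)) v
  rw [one_smul] at this
  convert this using 2 with m
  split_ifs <;> simp

theorem hasSum_finsum {ι : Type*} {f : ι → LC} (hf : f.HasFiniteSupport) :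
    HasSum f (∑ᶠ i, f i) := by
  rw [finsum_eq_sum_of_support_subset f (s := Set.Finite.toFinset hf)
    (fun i hi => Finset.mem_coe.2 ((Set.Finite.mem_toFinset hf).2 hi))]
  refine hasSum_sum_of_ne_finset_zero fun i hi => ?_
  by_contra h
  exact hi ((Set.Finite.mem_toFinset hf).2 h)

/-- The convolution of a summable family of scalars and a summable family of vectors. -/
theorem HasUSum.convolution {c : ℤ → LC} {s : LC} (hc : HasSum c s) {g : ℤ → V} {z : V}
    (hg : HasUSum g z) (hfin : ∀ N : ℤ, (fun b => c b • g (N - b)).HasFiniteSupport) :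
    HasUSum (fun N => ∑ᶠ b, c b • g (N - b)) (s • z) := by
  rw [hasUSum_iff] at hg ⊢
  obtain ⟨⟨E, hE, hg, hz⟩, h⟩ := hg
  refine ⟨⟨E, hE, fun N => ?_, E.smul_mem _ hz⟩, fun ℓ => ?_⟩
  · exact finsum_induction (· ∈ E) E.zero_mem (fun _ _ => E.add_mem)
      fun b => E.smul_mem _ (hg _)
  · have h1 := hc.mul_of_nonarchimedean (h ℓ)
    -- The pair `(N, b)` goes to `(b, N - b)`, so the fibre over `N` is the convolution sum, which
    -- is finite by `hfin`.
    let e : ℤ × ℤ ≃ ℤ × ℤ :=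
      { toFun := fun p => (p.2, p.1 - p.2)
        invFun := fun p => (p.1 + p.2, p.1)
        left_inv := fun p => by simp
        right_inv := fun p => by simp }
    have h2 := (e.hasSum_iff).2 h1
    have hfin' : ∀ N : ℤ, (fun b => c b * ℓ (g (N - b))).HasFiniteSupport := fun N =>
      (hfin N).subset fun b hb hb' => hb (by
        have := congrArg ℓ hb'
        simpa using this)
    have h3 := h2.prod_fiberwise (g := fun N => ∑ᶠ b, c b * ℓ (g (N - b))) fun N =>
      hasSum_finsum (hfin' N)
    rw [map_smul, smul_eq_mul]
    convert h3 using 2 with N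
    have h4 := (ℓ : V →ₗ[LC] LC).toAddMonoidHom.map_finsum (hfin N)
    refine h4.trans (finsum_congr fun b => ?_)
    exact map_smul ℓ _ _

end USum

/-! ### Laurent series of operators -/

section Acts

variable {T : Type*} [Ring T] {X : Type*} [AddCommGroup X] [Module LC X]
  (A : T →+* Module.End LC X)

/-- The operator `Θ` is the `u`-adically convergent sum `∑_m u^m t_m`. -/
def ActsAs (t : LaurentSeries T) (Θ : Module.End LC X) : Prop :=
  ∀ y, HasUSum (fun m => uPow m • A (t.coeff m) y) (Θ y)

variable {A}

theorem ActsAs.unique {t : LaurentSeries T} {Θ Θ' : Module.End LC X} (h : ActsAs A t Θ)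
    (h' : ActsAs A t Θ') : Θ = Θ' :=
  LinearMap.ext fun y => (h y).unique (h' y)

theorem ActsAs.add {t t' : LaurentSeries T} {Θ Θ' : Module.End LC X} (h : ActsAs A t Θ)
    (h' : ActsAs A t' Θ') : ActsAs A (t + t') (Θ + Θ') := by
  intro y
  change HasUSum _ (Θ y + Θ' y)
  convert (h y).add (h' y) using 2 with m
  rw [HahnSeries.coeff_add, map_add, LinearMap.add_apply, smul_add]

theorem actsAs_zero : ActsAs A 0 0 := by
  intro y
  simpa using hasUSum_zero

theorem actsAs_single (l : ℤ) (t : T) : ActsAs A (HahnSeries.single l t) (uPow l • A t) := by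
  intro y
  change HasUSum _ (uPow l • A t y)
  convert hasUSum_single l (uPow l • A t y) using 2 with m
  rw [HahnSeries.coeff_single]
  split_ifs with h
  · rw [h]
  · simp

theorem actsAs_sum {ι : Type*} {s : Finset ι} {t : ι → LaurentSeries T}
    {Θ : ι → Module.End LC X} (h : ∀ i ∈ s, ActsAs A (t i) (Θ i)) :
    ActsAs A (∑ i ∈ s, t i) (∑ i ∈ s, Θ i) := by
  classical
  induction s using Finset.induction_on with
  | empty => simpa using actsAs_zero
  | insert i s hi ih =>
    simp only [Finset.sum_insert hi]
    exact (h i (Finset.mem_insert_self i s)).add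
      (ih fun j hj => h j (Finset.mem_insert_of_mem hj))

/-- All `u^b t'_b y` lie in one finite dimensional space. Expanding them on its generators `e k`
turns the double sum into finitely many convolutions of scalar series with the sums defining `Θ (e
k)`, so no continuity of `Θ` is involved. -/
theorem ActsAs.mul {t t' : LaurentSeries T} {Θ Θ' : Module.End LC X} (h : ActsAs A t Θ)
    (h' : ActsAs A t' Θ') : ActsAs A (t * t') (Θ * Θ') := by
  intro y
  obtain ⟨⟨E, hE, hf, hy⟩, hℓ⟩ := hasUSum_iff.1 (h' y)
  obtain ⟨d, e, ℓ, he⟩ := exists_dual_coords hE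
  let c : Fin d → ℤ → LC := fun k b => ℓ k (uPow b • A (t'.coeff b) y)
  let g : Fin d → ℤ → X := fun k a => uPow a • A (t.coeff a) (e k)
  have hfin : ∀ k N, (fun b => c k b • g k (N - b)).HasFiniteSupport := by
    intro k N
    refine ((Finset.antidiagonal t'.isPWO_support t.isPWO_support N).image
      Prod.fst).finite_toSet.subset fun b hb => ?_
    rw [Finset.coe_image, Set.mem_image]
    refine ⟨(b, N - b), ?_, rfl⟩
    rw [Finset.mem_coe, Finset.mem_antidiagonal]
    refine ⟨fun h0 => hb ?_, fun h0 => hb ?_, by simp⟩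
    · simp only [c]
      rw [h0, map_zero, LinearMap.zero_apply, smul_zero, map_zero, zero_smul]
    · simp only [g]
      rw [h0, map_zero, LinearMap.zero_apply, smul_zero, smul_zero]
  have h1 := hasUSum_sum (s := Finset.univ) fun k _ =>
    HasUSum.convolution (hℓ (ℓ k)) (h (e k)) (hfin k)
  have h2 : (Θ * Θ') y = ∑ k, ℓ k (Θ' y) • Θ (e k) := by
    rw [Module.End.mul_apply, he _ hy, map_sum]
    refine Finset.sum_congr rfl fun k _ => ?_
    rw [map_smul, ← he _ hy]
  rw [h2]
  convert h1 using 2 with N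
  rw [← finsum_sum_comm _ _ fun k _ => hfin k N, coeff_mul_eq_finsum',
    A.toAddMonoidHom.map_finsum (f := fun b => t.coeff (N - b) * t'.coeff b)
      (hasFiniteSupport_coeff_mul' t t' N) |> (show A _ = _ from ·)]
  let ev : Module.End LC X →+ X :=
    { toFun := fun Θ => uPow N • Θ y
      map_zero' := by simp
      map_add' := fun a b => by simp }
  refine (ev.map_finsum ?_).trans (finsum_congr fun b => ?_)
  · refine (hasFiniteSupport_coeff_mul' t t' N).subset fun b hb hb' => hb ?_
    change A (t.coeff (N - b) * t'.coeff b) = 0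
    have hb' : t.coeff (N - b) * t'.coeff b = 0 := hb'
    rw [hb', map_zero]
  · change uPow N • A (t.coeff (N - b) * t'.coeff b) y = _
    rw [map_mul, Module.End.mul_apply, show uPow N = uPow (N - b) * uPow b by
      rw [← uPow_add, sub_add_cancel], mul_smul, ← map_smul, he _ (hf b), map_sum, Finset.smul_sum]
    refine Finset.sum_congr rfl fun k _ => ?_
    rw [map_smul, smul_comm]

theorem actsAs_laurentScalars [Algebra ℂ T]
    (hA : ∀ c : ℂ, A (algebraMap ℂ T c) = algebraMap ℂ LC c • LinearMap.id) (c : LC) :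
    ActsAs A (laurentScalars T c) (c • LinearMap.id) := by
  intro y
  change HasUSum _ (c • y)
  convert hasUSum_smul_vec (hasSum_coeff c) y using 2 with m
  change uPow m • A (algebraMap ℂ T (c.coeff m)) y = _
  rw [hA, LinearMap.smul_apply, LinearMap.id_apply, smul_smul, mul_comm]

/-- Sums are unique, so the limits depend linearly on the vector, and a spanning set is enough. -/
theorem exists_actsAs {t : LaurentSeries T} {S : Set X} (hS : Submodule.span LC S = ⊤)
    (h : ∀ y ∈ S, ∃ z, HasUSum (fun m => uPow m • A (t.coeff m) y) z) :
    ∃ Θ : Module.End LC X, ActsAs A t Θ := by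
  have h1 : ∀ y, ∃ z, HasUSum (fun m => uPow m • A (t.coeff m) y) z := by
    intro y
    have hy : y ∈ Submodule.span LC S := hS ▸ Submodule.mem_top
    induction hy using Submodule.span_induction with
    | mem y hy => exact h y hy
    | zero => exact ⟨0, by simpa using hasUSum_zero⟩
    | add y z _ _ hy hz =>
      obtain ⟨y', hy'⟩ := hy
      obtain ⟨z', hz'⟩ := hz
      exact ⟨y' + z', by simpa using hy'.add hz'⟩
    | smul c y _ hy =>
      obtain ⟨y', hy'⟩ := hy
      refine ⟨c • y', ?_⟩
      convert hy'.const_smul c using 2 with m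
      rw [map_smul, smul_comm]
  choose Θ hΘ using h1
  refine ⟨{ toFun := Θ, map_add' := fun y z => ?_, map_smul' := fun c y => ?_ }, hΘ⟩
  · refine (hΘ (y + z)).unique ?_
    simpa using (hΘ y).add (hΘ z)
  · refine (hΘ (c • y)).unique ?_
    change HasUSum _ (c • Θ y)
    convert (hΘ y).const_smul c using 2 with m
    rw [map_smul, smul_comm]

end Acts

/-! ### The module structure defined by a coproduct -/

section TensorAct

variable {n : ℕ} {H : Type*} [AddCommGroup H] [Module ℚ H] (D : Datum n H)
variable {V W : Type*} [AddCommGroup V] [Module LC V] [AddCommGroup W] [Module LC W]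
  (σ : Ut' D →ₐ[LC] Module.End LC W) (ρ : Ut' D →ₐ[LC] Module.End LC V)

theorem tensorAct_tmul (a b : Ut D) : tensorAct D σ ρ (a ⊗ₜ[ℂ] b) =
    TensorProduct.map (σ (incl D a)) (ρ (incl D b)) := rfl

/-- The action of `Ũ_q(ĝ) ⊗ Ũ_q(ĝ)` as a homomorphism of rings. -/
noncomputable def tensorActHom : Ut D ⊗[ℂ] Ut D →+* Module.End LC (W ⊗[LC] V) :=
  { tensorAct D σ ρ with
    map_one' := by
      change tensorAct D σ ρ (1 ⊗ₜ[ℂ] 1) = 1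
      rw [tensorAct_tmul, map_one, map_one, map_one]
      exact TensorProduct.map_id
    map_mul' := fun s t => by
      change tensorAct D σ ρ (s * t) = tensorAct D σ ρ s * tensorAct D σ ρ t
      induction s using TensorProduct.induction_on with
      | zero => simp
      | add s s' hs hs' => rw [add_mul, map_add, map_add, add_mul, hs, hs']
      | tmul a b =>
        induction t using TensorProduct.induction_on with
        | zero => simp
        | add t t' ht ht' => rw [mul_add, map_add, map_add, mul_add, ht, ht']
        | tmul a' b' =>
          rw [Algebra.TensorProduct.tmul_mul_tmul, tensorAct_tmul, tensorAct_tmul, tensorAct_tmul,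
            map_mul, map_mul, map_mul, map_mul]
          exact TensorProduct.map_mul _ _ _ _ }

theorem tensorActHom_apply (t : Ut D ⊗[ℂ] Ut D) : tensorActHom D σ ρ t = tensorAct D σ ρ t := rfl

theorem incl_algebraMap (c : ℂ) :
    incl D (algebraMap ℂ (Ut D) c) = algebraMap LC (Ut' D) (algebraMap ℂ LC c) := by
  rw [AlgHom.commutes, ← IsScalarTower.algebraMap_apply]

theorem tensorActHom_algebraMap (c : ℂ) :
    tensorActHom D σ ρ (algebraMap ℂ (Ut D ⊗[ℂ] Ut D) c) = algebraMap ℂ LC c • LinearMap.id := by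
  rw [Algebra.TensorProduct.algebraMap_apply, tensorActHom_apply, tensorAct_tmul,
    incl_algebraMap, AlgHom.commutes, map_one, map_one]
  ext x y
  simp [Module.algebraMap_end_apply, TensorProduct.smul_tmul']

/-- The module structure defined by `Δ` exists if the generators act by convergent series. -/
theorem exists_isDefinedBy {Δ : Ut' D →ₐ[LC] UtCompl D}
    (hx : ∀ ε i r, ∃ Θ, ActsAs (tensorActHom D σ ρ) (Δ (incl D (Ut.x D ε i r))) Θ)
    (hk : ∀ h, ∃ Θ, ActsAs (tensorActHom D σ ρ) (Δ (incl D (Ut.k D h))) Θ)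
    (hh : ∀ i m, ∃ Θ, ActsAs (tensorActHom D σ ρ) (Δ (incl D (Ut.h D i m))) Θ) :
    ∃ τ : Ut' D →ₐ[LC] Module.End LC (W ⊗[LC] V), IsDefinedBy D Δ σ ρ τ := by
  have hs : ∀ c : LC, ActsAs (tensorActHom D σ ρ) (Δ (algebraMap LC (Ut' D) c))
      (c • LinearMap.id) := fun c => by
    rw [AlgHom.commutes]
    exact actsAs_laurentScalars (tensorActHom_algebraMap D σ ρ) c
  -- The elements whose image acts by a convergent series form a subalgebra, so the generators
  -- decide.
  have h1 : ∀ a : Ut D, ∃ Θ, ActsAs (tensorActHom D σ ρ) (Δ (incl D a)) Θ := by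
    intro a
    obtain ⟨f, rfl⟩ := RingQuot.mkAlgHom_surjective ℂ (Rel D) a
    change ∃ Θ, ActsAs (tensorActHom D σ ρ) (Δ (incl D (mkU D f))) Θ
    induction f using FreeAlgebra.induction with
    | grade0 c =>
      rw [AlgHom.commutes]
      change ∃ Θ, ActsAs _ (Δ (incl D (algebraMap ℂ (Ut D) c))) Θ
      rw [incl_algebraMap]
      exact ⟨_, hs _⟩
    | grade1 g =>
      match g with
      | Gen.x ε i r => exact hx ε i r
      | Gen.k h => exact hk h
      | Gen.h i m =>
        have := hh i m
        rwa [Ut.h, hF, dif_pos m.2] at this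
    | mul a b ha hb =>
      obtain ⟨Θ, hΘ⟩ := ha
      obtain ⟨Θ', hΘ'⟩ := hb
      exact ⟨Θ * Θ', by rw [map_mul, map_mul, map_mul]; exact hΘ.mul hΘ'⟩
    | add a b ha hb =>
      obtain ⟨Θ, hΘ⟩ := ha
      obtain ⟨Θ', hΘ'⟩ := hb
      exact ⟨Θ + Θ', by rw [map_add, map_add, map_add]; exact hΘ.add hΘ'⟩
  have h2 : ∀ g : Ut' D, ∃ Θ, ActsAs (tensorActHom D σ ρ) (Δ g) Θ := by
    intro g
    induction g using TensorProduct.induction_on with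
    | zero => exact ⟨0, by rw [map_zero]; exact actsAs_zero⟩
    | add a b ha hb =>
      obtain ⟨Θ, hΘ⟩ := ha
      obtain ⟨Θ', hΘ'⟩ := hb
      exact ⟨Θ + Θ', by rw [map_add]; exact hΘ.add hΘ'⟩
    | tmul c a =>
      obtain ⟨Θ, hΘ⟩ := h1 a
      have : c ⊗ₜ[ℂ] a = algebraMap LC (Ut' D) c * incl D a := by
        rw [incl, Algebra.TensorProduct.includeRight_apply, Algebra.TensorProduct.algebraMap_apply,
          Algebra.TensorProduct.tmul_mul_tmul, mul_one, one_mul]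
        rfl
      exact ⟨_, by rw [this, map_mul]; exact (hs c).mul hΘ⟩
  -- As `Δ` is a homomorphism, all the algebra axioms for `Θ` follow from uniqueness of sums; no
  -- relation has to be checked on the module.
  choose Θ hΘ using h2
  refine ⟨{ toFun := Θ, map_one' := ?_, map_mul' := fun a b => ?_, map_zero' := ?_,
            map_add' := fun a b => ?_, commutes' := fun c => ?_ }, hΘ⟩
  · refine (hΘ 1).unique ?_
    have := hs 1
    rw [map_one, one_smul] at this
    exact this
  · refine (hΘ (a * b)).unique ?_
    rw [map_mul]
    exact (hΘ a).mul (hΘ b)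
  · refine (hΘ 0).unique ?_
    rw [map_zero]
    exact actsAs_zero
  · refine (hΘ (a + b)).unique ?_
    rw [map_add]
    exact (hΘ a).add (hΘ b)
  · exact (hΘ _).unique (hs c)

theorem IsDefinedBy.unique {Δ : Ut' D →ₐ[LC] UtCompl D}
    {τ τ' : Ut' D →ₐ[LC] Module.End LC (W ⊗[LC] V)} (h : IsDefinedBy D Δ σ ρ τ)
    (h' : IsDefinedBy D Δ σ ρ τ') : τ = τ' :=
  AlgHom.ext fun g => LinearMap.ext fun y => (h g y).unique (h' g y)

end TensorAct

/-! ### Generalized eigenvectors -/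

section GenEigen

open Module.End

variable {K V W : Type*} [Field K] [AddCommGroup V] [Module K V] [AddCommGroup W] [Module K W]

theorem mem_maxGenEigenspace_zero {f : Module.End K V} {v : V} :
    v ∈ f.maxGenEigenspace 0 ↔ ∃ p, (f ^ p) v = 0 := by
  rw [mem_maxGenEigenspace]
  simp

theorem mem_maxGenEigenspace_sub {f : Module.End K V} {a : K} {v : V} :
    v ∈ f.maxGenEigenspace a ↔ v ∈ (f - a • (1 : Module.End K V)).maxGenEigenspace 0 := by
  rw [mem_maxGenEigenspace, mem_maxGenEigenspace_zero]

theorem mem_maxGenEigenspace_add {f g : Module.End K V} (h : Commute f g) {a b : K} {v : V}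
    (hf : v ∈ f.maxGenEigenspace a) (hg : v ∈ g.maxGenEigenspace b) :
    v ∈ (f + g).maxGenEigenspace (a + b) := by
  have := genEigenspace_inf_le_add f g a b ⊤ ⊤ h ⟨hf, hg⟩
  rwa [top_add] at this

theorem mem_maxGenEigenspace_smul {f : Module.End K V} (c : K) {a : K} {v : V}
    (hf : v ∈ f.maxGenEigenspace a) : v ∈ (c • f).maxGenEigenspace (c * a) :=
  genEigenspace_le_smul f a c ⊤ hf

/-- Write `f g - a b = (f - a) g + a (g - b)`: the summands commute and each is nilpotent on `v`. -/
theorem mem_maxGenEigenspace_mul {f g : Module.End K V} (h : Commute f g) {a b : K} {v : V}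
    (hf : v ∈ f.maxGenEigenspace a) (hg : v ∈ g.maxGenEigenspace b) :
    v ∈ (f * g).maxGenEigenspace (a * b) := by
  have h1 : Commute (f - a • (1 : Module.End K V)) g :=
    h.sub_left ((Commute.one_left g).smul_left a)
  have h2 : v ∈ ((f - a • (1 : Module.End K V)) * g).maxGenEigenspace 0 := by
    obtain ⟨p, hp⟩ := mem_maxGenEigenspace_zero.1 (mem_maxGenEigenspace_sub.1 hf)
    refine mem_maxGenEigenspace_zero.2 ⟨p, ?_⟩
    rw [h1.mul_pow, (h1.pow_pow p p).eq, mul_apply, hp, map_zero]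
  have h3 := mem_maxGenEigenspace_add (h1.mul_left (Commute.refl g) |>.smul_right a) h2
    (mem_maxGenEigenspace_smul a hg)
  rw [zero_add] at h3
  convert h3 using 2
  rw [sub_mul, smul_mul_assoc, one_mul, sub_add_cancel]

theorem mem_maxGenEigenspace_sum {ι : Type*} {s : Finset ι} {f : ι → Module.End K V}
    (h : ∀ i j, Commute (f i) (f j)) {a : ι → K} {v : V}
    (hf : ∀ i ∈ s, v ∈ (f i).maxGenEigenspace (a i)) :
    v ∈ (∑ i ∈ s, f i).maxGenEigenspace (∑ i ∈ s, a i) := by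
  classical
  induction s using Finset.induction_on with
  | empty => exact mem_maxGenEigenspace_zero.2 ⟨1, by simp⟩
  | insert i s hi ih =>
    rw [Finset.sum_insert hi, Finset.sum_insert hi]
    exact mem_maxGenEigenspace_add (Commute.sum_right _ _ _ fun j _ => h i j)
      (hf i (Finset.mem_insert_self i s)) (ih fun j hj => hf j (Finset.mem_insert_of_mem hj))

theorem mem_maxGenEigenspace_of_intertwine {f : Module.End K V} {g : Module.End K W}
    (T : V →ₗ[K] W) (h : ∀ v, T (f v) = g (T v)) {a : K} {v : V}
    (hf : v ∈ f.maxGenEigenspace a) : T v ∈ g.maxGenEigenspace a := by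
  rw [mem_maxGenEigenspace] at hf ⊢
  obtain ⟨p, hp⟩ := hf
  have h1 : ∀ (p : ℕ) (x : V), T (((f - a • (1 : Module.End K V)) ^ p) x) =
      ((g - a • (1 : Module.End K W)) ^ p) (T x) := by
    intro p
    induction p with
    | zero => intro x; rfl
    | succ p ih =>
      intro x
      rw [pow_succ, pow_succ, mul_apply, mul_apply, ih]
      congr 1
      simp [h]
  exact ⟨p, by rw [← h1, hp, map_zero]⟩

theorem mem_maxGenEigenspace_tmul {f : Module.End K V} {g : Module.End K W} {a b : K} {v : V}
    {w : W} (hf : v ∈ f.maxGenEigenspace a) (hg : w ∈ g.maxGenEigenspace b) :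
    v ⊗ₜ[K] w ∈ maxGenEigenspace (TensorProduct.map f g) (a * b) := by
  have h1 : v ⊗ₜ[K] w ∈ maxGenEigenspace (TensorProduct.map f (1 : Module.End K W)) a :=
    mem_maxGenEigenspace_of_intertwine ((TensorProduct.mk K V W).flip w) (fun v => by simp) hf
  have h2 : v ⊗ₜ[K] w ∈ maxGenEigenspace (TensorProduct.map (1 : Module.End K V) g) b :=
    mem_maxGenEigenspace_of_intertwine (TensorProduct.mk K V W v) (fun v => by simp) hg
  have h3 : Commute (TensorProduct.map f (1 : Module.End K W))
      (TensorProduct.map (1 : Module.End K V) g) := by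
    change _ * _ = _ * _
    rw [← TensorProduct.map_mul, ← TensorProduct.map_mul, one_mul, one_mul, mul_one, mul_one]
  have h4 := mem_maxGenEigenspace_mul h3 h1 h2
  rwa [← TensorProduct.map_mul, mul_one, one_mul] at h4

end GenEigen

/-- An independent family of submodules is the only family below it with supremum `⊤`. -/
theorem eq_of_le_of_iSup_eq_top {R V ι : Type*} [Ring R] [AddCommGroup V] [Module R V]
    {N M : ι → Submodule R V} (hM : iSupIndep M) (hle : ∀ i, N i ≤ M i) (hN : ⨆ i, N i = ⊤)
    (i : ι) : N i = M i := by
  refine le_antisymm (hle i) fun v hv => ?_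
  have h1 : v ∈ N i ⊔ ⨆ j, ⨆ (_ : j ≠ i), N j := by
    rw [← iSup_split_single N i, hN]
    exact Submodule.mem_top
  obtain ⟨a, ha, b, hb, rfl⟩ := Submodule.mem_sup.1 h1
  have h2 : b ∈ M i := by
    have := Submodule.sub_mem _ hv (hle i ha)
    rwa [add_sub_cancel_left] at this
  have h3 : b ∈ ⨆ j, ⨆ (_ : j ≠ i), M j :=
    (iSup₂_mono fun j _ => hle j) hb
  rw [Submodule.disjoint_def.1 (hM i) b h2 h3, add_zero]
  exact ha

/-! ### Weight spaces -/

section Weights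

variable {n : ℕ} {H : Type*} [AddCommGroup H] [Module ℚ H] (D : Datum n H)
variable {K : Type*} [Field K] [Algebra ℂ K] {V : Type*} [AddCommGroup V] [Module K V]

/-- If `ω x ≠ ω' x`, rescaling `x` by a rational makes the difference of the values equal to `1`,
whence `q = 1`. -/
theorem Datum.qp_injective {ω ω' : Module.Dual ℚ H} (h : ∀ x, D.qp (ω x) = D.qp (ω' x)) :
    ω = ω' := by
  refine LinearMap.ext fun x => by_contra fun hx => D.qp_one_ne_one ?_
  have h1 := h ((ω x - ω' x)⁻¹ • x)
  have h2 : ω x - ω' x ≠ 0 := sub_ne_zero.2 hx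
  have h3 : ω ((ω x - ω' x)⁻¹ • x) = 1 + ω' ((ω x - ω' x)⁻¹ • x) := by
    rw [map_smul, map_smul, smul_eq_mul, smul_eq_mul]
    field_simp
    ring
  rw [h3, D.qp_add] at h1
  exact mul_right_cancel₀ (D.qp_ne_zero _) (h1.trans (one_mul _).symm)

theorem mem_weightSpace {κ : H → Module.End K V} {ω : Module.Dual ℚ H} {v : V} :
    v ∈ weightSpace D K κ ω ↔ ∀ h, κ h v = algebraMap ℂ K (D.qp (ω h)) • v := by
  simp [weightSpace, Submodule.mem_iInf, LinearMap.sub_apply, sub_eq_zero,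
    Module.algebraMap_end_apply]

variable (ψ : Ut D →+* Module.End K V)

/-- The weight spaces of the action `ψ`. -/
noncomputable abbrev wt (ω : Module.Dual ℚ H) : Submodule K V := weightSpace D K (fun h => ψ (Ut.k D h)) ω

/-- The `l`-weight spaces of the action `ψ`. -/
noncomputable abbrev lwt (ω : Module.Dual ℚ H) (γ : ℤˣ → Fin n → ℕ → K) : Submodule K V :=
  lWeightSpace D K (fun h => ψ (Ut.k D h)) (fun ε i m => ψ (Ut.phi D ε i m)) ω γ

theorem commute_mem_wt {a : Ut D} (ha : ∀ h, Commute (Ut.k D h) a) {ω : Module.Dual ℚ H} {v : V}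
    (hv : v ∈ wt D ψ ω) : ψ a v ∈ wt D ψ ω := by
  rw [mem_weightSpace] at hv ⊢
  intro h
  rw [← Module.End.mul_apply, ((ha h).map ψ).eq, Module.End.mul_apply, hv, map_smul]

theorem phi_mem_wt (ε : ℤˣ) (i : Fin n) (m : ℕ) {ω : Module.Dual ℚ H} {v : V}
    (hv : v ∈ wt D ψ ω) : ψ (Ut.phi D ε i m) v ∈ wt D ψ ω :=
  commute_mem_wt D ψ (fun h => Ut.commute_k_phi D h ε i m) hv

theorem phiZ_mem_wt (ε : ℤˣ) (i : Fin n) (m : ℤ) {ω : Module.Dual ℚ H} {v : V}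
    (hv : v ∈ wt D ψ ω) : ψ (Ut.phiZ D ε i m) v ∈ wt D ψ ω :=
  commute_mem_wt D ψ (fun h => Ut.commute_k_phiZ D h ε i m) hv

/-- The action `ψ` is only a ring homomorphism, so that actions over `ℂ` and over `ℂ((u))` are
treated together; hence the separate hypothesis on scalars. -/
theorem x_mem_wt (hψ : ∀ (c : ℂ) (a : Ut D), ψ (c • a) = algebraMap ℂ K c • ψ a)
    (ε : ℤˣ) (i : Fin n) (m : ℤ) {ω : Module.Dual ℚ H} {v : V}
    (hv : v ∈ wt D ψ ω) : ψ (Ut.x D ε i m) v ∈ wt D ψ (ω + (ε : ℤ) • D.root i) := by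
  rw [mem_weightSpace] at hv ⊢
  intro h
  rw [← Module.End.mul_apply, ← map_mul, Ut.k_mul_x, hψ, map_mul, LinearMap.smul_apply,
    Module.End.mul_apply, hv, map_smul, smul_smul, ← map_mul, ← D.qp_add]
  congr 3
  rw [LinearMap.add_apply, LinearMap.smul_apply, add_comm]
  simp

theorem phi_zero_apply {ω : Module.Dual ℚ H} {v : V} (hv : v ∈ wt D ψ ω) (ε : ℤˣ) (i : Fin n) :
    ψ (Ut.phi D ε i 0) v =
      algebraMap ℂ K (D.qp (((ε : ℤ) : ℚ) * (D.r i : ℚ) * ω (D.coroot i))) • v := by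
  rw [Ut.phi_zero, (mem_weightSpace D).1 hv, map_zsmul]
  simp

/-- `φ_{i,0}` is some `k_h`, hence a scalar on a weight space, and a nilpotent scalar is zero. -/
theorem compatible_of_mem_lwt {ω : Module.Dual ℚ H} {γ : ℤˣ → Fin n → ℕ → K} {v : V}
    (hv : v ∈ lwt D ψ ω γ) (h0 : v ≠ 0) : Compatible D K ω γ := by
  obtain ⟨hv, p, hp⟩ := hv
  intro ε i
  have h1 : ∀ p, ((ψ (Ut.phi D ε i 0) - algebraMap K (Module.End K V) (γ ε i 0)) ^ p) v =
      (algebraMap ℂ K (D.qp (((ε : ℤ) : ℚ) * (D.r i : ℚ) * ω (D.coroot i))) - γ ε i 0) ^ p • v := by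
    intro p
    induction p with
    | zero => simp
    | succ p ih =>
      rw [pow_succ, Module.End.mul_apply, LinearMap.sub_apply, phi_zero_apply D ψ hv,
        Module.algebraMap_end_apply, ← sub_smul, map_smul, ih, smul_smul, mul_comm, pow_succ]
  have h2 := hp ε i 0
  rw [h1, smul_eq_zero, or_iff_left h0] at h2
  exact (sub_eq_zero.1 (eq_zero_of_pow_eq_zero h2)).symm

theorem wt_le_iInf (ω : Module.Dual ℚ H) : wt D ψ ω ≤
    ⨅ h, (ψ (Ut.k D h)).maxGenEigenspace (algebraMap ℂ K (D.qp (ω h))) := by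
  refine le_iInf fun h v hv => (Module.End.mem_maxGenEigenspace _ _ _).2 ⟨1, ?_⟩
  have := (mem_weightSpace D).1 hv h
  simp [this]

/-- Weight spaces lie in the simultaneous generalized eigenspaces of the commuting `k_h`, which are
independent, and distinct weights give distinct eigenvalues. -/
theorem iSupIndep_wt : iSupIndep (wt D ψ) := by
  have h1 := Module.End.independent_iInf_maxGenEigenspace_of_forall_mapsTo
    (fun h => ψ (Ut.k D h)) fun h h' c =>
      Module.End.mapsTo_maxGenEigenspace_of_comm ((Ut.commute_k_k D h' h).map ψ) c
  refine (h1.comp (f := fun ω : Module.Dual ℚ H => fun h => algebraMap ℂ K (D.qp (ω h)))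
    fun ω ω' h => ?_).mono (wt_le_iInf D ψ)
  exact D.qp_injective fun x => (algebraMap ℂ K).injective (congrFun h x)

/-- The operators `k_h` and `φ` as one commuting family. -/
noncomputable def kPhi : H ⊕ (ℤˣ × Fin n × ℕ) → Ut D :=
  Sum.elim (Ut.k D) fun p => Ut.phi D p.1 p.2.1 p.2.2

theorem commute_kPhi (a b : H ⊕ (ℤˣ × Fin n × ℕ)) : Commute (kPhi D a) (kPhi D b) := by
  match a, b with
  | .inl h, .inl h' => exact Ut.commute_k_k D h h'
  | .inl h, .inr p => exact Ut.commute_k_phi D h _ _ _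
  | .inr p, .inl h => exact (Ut.commute_k_phi D h _ _ _).symm
  | .inr p, .inr p' => exact Ut.commute_phi_phi D _ _ _ _ _ _

/-- The eigenvalues of `kPhi` attached to a weight and an `l`-weight. -/
noncomputable def kPhiVal (p : Module.Dual ℚ H × (ℤˣ → Fin n → ℕ → K)) :
    H ⊕ (ℤˣ × Fin n × ℕ) → K :=
  Sum.elim (fun h => algebraMap ℂ K (D.qp (p.1 h))) fun s => p.2 s.1 s.2.1 s.2.2

theorem kPhiVal_injective : Function.Injective (kPhiVal (K := K) D) := by
  rintro ⟨ω, γ⟩ ⟨ω', γ'⟩ h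
  refine Prod.ext (D.qp_injective fun x => (algebraMap ℂ K).injective
    (congrFun h (.inl x))) ?_
  funext ε i m
  exact congrFun h (.inr (ε, i, m))

theorem lwt_le_iInf (p : Module.Dual ℚ H × (ℤˣ → Fin n → ℕ → K)) : lwt D ψ p.1 p.2 ≤
    ⨅ a, (ψ (kPhi D a)).maxGenEigenspace (kPhiVal D p a) := by
  refine le_iInf fun a v hv => ?_
  match a with
  | .inl h => exact (Submodule.mem_iInf _).1 (wt_le_iInf D ψ p.1 hv.1) h
  | .inr s =>
    obtain ⟨_, q, hq⟩ := hv
    exact (Module.End.mem_maxGenEigenspace _ _ _).2 ⟨q, hq s.1 s.2.1 s.2.2⟩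

/-- Joining the `k_h` and the `φ`'s in one commuting family gives independence over all pairs of a
weight and an `l`-weight at once. -/
theorem iSupIndep_lwt :
    iSupIndep fun p : Module.Dual ℚ H × (ℤˣ → Fin n → ℕ → K) => lwt D ψ p.1 p.2 :=
  ((Module.End.independent_iInf_maxGenEigenspace_of_forall_mapsTo
    (fun a => ψ (kPhi D a)) fun a b c =>
      Module.End.mapsTo_maxGenEigenspace_of_comm ((commute_kPhi D b a).map ψ) c).comp
    (kPhiVal_injective D)).mono (lwt_le_iInf D ψ)

/-- In a finite dimensional weight space, the exponents can be chosen uniformly. -/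
theorem mem_lwt_of_maxGenEigenspace {ω : Module.Dual ℚ H} [Module.Finite K (wt D ψ ω)]
    {γ : ℤˣ → Fin n → ℕ → K} {v : V} (hv : v ∈ wt D ψ ω)
    (h : ∀ ε i m, v ∈ (ψ (Ut.phi D ε i m)).maxGenEigenspace (γ ε i m)) : v ∈ lwt D ψ ω γ := by
  -- The dimension of the weight space bounds the nilpotency exponent of every `φ`.
  refine ⟨hv, Module.finrank K (wt D ψ ω), fun ε i m => ?_⟩
  have hmem : ∀ x ∈ wt D ψ ω, ψ (Ut.phi D ε i m) x ∈ wt D ψ ω :=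
    fun x hx => phi_mem_wt D ψ ε i m hx
  have h1 : (⟨v, hv⟩ : wt D ψ ω) ∈
      Module.End.maxGenEigenspace (LinearMap.restrict _ hmem) (γ ε i m) := by
    rw [Module.End.maxGenEigenspace, Module.End.genEigenspace_restrict]
    exact h ε i m
  rw [Module.End.maxGenEigenspace_eq_genEigenspace_finrank, Module.End.genEigenspace_restrict,
    Submodule.mem_comap, Module.End.mem_genEigenspace_nat] at h1
  exact h1

/-- Commuting operators on a finite dimensional space over an algebraically closed field have a
common generalized eigenspace decomposition. This serves for the first factor, over `ℂ`; over
`ℂ((u))` the decomposition is part of `InO'`. -/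
theorem wt_le_iSup_lwt [IsAlgClosed K] (ω : Module.Dual ℚ H) [Module.Finite K (wt D ψ ω)] :
    wt D ψ ω ≤ ⨆ γ, lwt D ψ ω γ := by
  let f : ℤˣ × Fin n × ℕ → Module.End K (wt D ψ ω) := fun s =>
    (ψ (Ut.phi D s.1 s.2.1 s.2.2)).restrict fun x hx => phi_mem_wt D ψ _ _ _ hx
  have hf : ⨆ χ : ℤˣ × Fin n × ℕ → K, ⨅ s, (f s).maxGenEigenspace (χ s) = ⊤ := by
    refine Module.End.iSup_iInf_maxGenEigenspace_eq_top_of_iSup_maxGenEigenspace_eq_top_of_commute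
      f (fun s t _ => LinearMap.ext fun x => Subtype.ext ?_)
      fun s => Module.End.iSup_maxGenEigenspace_eq_top _
    exact LinearMap.congr_fun
      ((Ut.commute_phi_phi D s.1 t.1 s.2.1 t.2.1 s.2.2 t.2.2).map ψ).eq (x : V)
  have h1 := congrArg (Submodule.map (wt D ψ ω).subtype) hf
  rw [Submodule.map_subtype_top, Submodule.map_iSup] at h1
  rw [← h1]
  refine iSup_le fun χ => le_iSup_of_le (fun ε i m => χ (ε, i, m)) ?_
  rintro _ ⟨v, hv, rfl⟩
  refine mem_lwt_of_maxGenEigenspace D ψ v.2 fun ε i m => ?_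
  have h2 := (Submodule.mem_iInf _).1 hv (ε, i, m)
  rw [Module.End.maxGenEigenspace, Module.End.genEigenspace_restrict] at h2
  exact h2

end Weights

/-! ### Bases of weight vectors -/

section WeightBases

variable {n : ℕ} {H : Type*} [AddCommGroup H] [Module ℚ H] (D : Datum n H)
variable {K : Type*} [Field K] [Algebra ℂ K] {V : Type*} [AddCommGroup V] [Module K V]
variable (ψ : Ut D →+* Module.End K V)

variable {D ψ} in
-- The spans lie in the independent weight spaces and together fill `V`, which forces equality.
theorem wt_eq_span {ι : Type*} {B : Module.Basis ι K V} {f : ι → Module.Dual ℚ H}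
    (hB : ∀ p, B p ∈ wt D ψ (f p)) (ω : Module.Dual ℚ H) :
    Submodule.span K (B '' {p | f p = ω}) = wt D ψ ω := by
  refine eq_of_le_of_iSup_eq_top (N := fun ω => Submodule.span K (B '' {p | f p = ω}))
    (iSupIndep_wt D ψ) (fun ω => ?_) ?_ ω
  · rw [Submodule.span_le]
    rintro _ ⟨p, rfl, rfl⟩
    exact hB p
  · rw [eq_top_iff, ← B.span_eq, Submodule.span_le]
    rintro _ ⟨p, rfl⟩
    exact Submodule.mem_iSup_of_mem (f p) (Submodule.subset_span ⟨p, rfl, rfl⟩)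

variable {D ψ} in
theorem iSup_wt_eq_top {ι : Type*} {B : Module.Basis ι K V} {f : ι → Module.Dual ℚ H}
    (hB : ∀ p, B p ∈ wt D ψ (f p)) : ⨆ ω, wt D ψ ω = ⊤ := by
  rw [eq_top_iff, ← B.span_eq, Submodule.span_le]
  rintro _ ⟨p, rfl⟩
  exact Submodule.mem_iSup_of_mem (f p) (hB p)

variable {D ψ} in
theorem repr_eq_zero_of_mem_wt {ι : Type*} {B : Module.Basis ι K V} {f : ι → Module.Dual ℚ H}
    (hB : ∀ p, B p ∈ wt D ψ (f p)) {ω : Module.Dual ℚ H} {v : V} (hv : v ∈ wt D ψ ω) {p : ι}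
    (hp : f p ≠ ω) : B.repr v p = 0 := by
  rw [← wt_eq_span hB, Module.Basis.mem_span_image] at hv
  by_contra h
  exact hp (hv (Finsupp.mem_support_iff.2 h))

variable {D ψ} in
/-- A basis of weight vectors with finite fibres gives bases of all the weight spaces. -/
theorem exists_basis_wt {ι : Type*} {B : Module.Basis ι K V} {f : ι → Module.Dual ℚ H}
    (hB : ∀ p, B p ∈ wt D ψ (f p)) (hf : ∀ ω, {p | f p = ω}.Finite) :
    ∃ (d : Module.Dual ℚ H → ℕ) (b : ∀ ω, Module.Basis (Fin (d ω)) K (wt D ψ ω)),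
      (∀ ω β, ∃ p, (b ω β : V) = B p) ∧
      ∀ ω, ∀ v ∈ wt D ψ ω, ∃ j : Fin (d ω) → ι, v = ∑ β, B.repr v (j β) • (b ω β : V) := by
  have (ω : Module.Dual ℚ H) : Finite {p | f p = ω} := hf ω
  have h1 (ω : Module.Dual ℚ H) :
      Submodule.span K (Set.range fun p : {p | f p = ω} => B p) = wt D ψ ω := by
    rw [← wt_eq_span hB ω, Set.image_eq_range]
  let b (ω : Module.Dual ℚ H) : Module.Basis (Fin (Nat.card {p | f p = ω})) K (wt D ψ ω) :=
    ((Module.Basis.span (B.linearIndependent.comp (Subtype.val : {p | f p = ω} → ι)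
      Subtype.val_injective)).map (LinearEquiv.ofEq _ _ (h1 ω))).reindex
        (Finite.equivFin {p | f p = ω})
  have hb (ω β) : (b ω β : V) = B ((Finite.equivFin {p | f p = ω}).symm β) := by
    simp only [b, Module.Basis.reindex_apply, Module.Basis.map_apply]
    rw [LinearEquiv.coe_ofEq_apply, Module.Basis.span_apply]
    rfl
  refine ⟨_, b, fun ω β => ⟨_, hb ω β⟩, fun ω v hv =>
    ⟨fun β => (Finite.equivFin {p | f p = ω}).symm β, ?_⟩⟩
  have h2 := congrArg Subtype.val ((b ω).sum_repr ⟨v, hv⟩)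
  rw [Submodule.coe_sum] at h2
  have h3 (β) : B.repr v ((Finite.equivFin {p | f p = ω}).symm β : {p | f p = ω}) =
      (b ω).repr ⟨v, hv⟩ β := by
    conv_lhs => rw [← show _ = v from h2]
    rw [map_sum, Finsupp.finsetSum_apply, Finset.sum_eq_single β]
    · rw [Submodule.coe_smul, hb, map_smul, Module.Basis.repr_self, Finsupp.smul_apply,
        Finsupp.single_eq_same, smul_eq_mul, mul_one]
    · intro γ _ hγ
      rw [Submodule.coe_smul, hb, map_smul, Module.Basis.repr_self, Finsupp.smul_apply,
        Finsupp.single_eq_of_ne, smul_zero]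
      exact fun h => hγ ((Finite.equivFin {p | f p = ω}).symm.injective (Subtype.ext h)).symm
    · exact fun h => absurd (Finset.mem_univ _) h
  conv_lhs => rw [← show _ = v from h2]
  refine Finset.sum_congr rfl fun β _ => ?_
  rw [h3, Submodule.coe_smul]

/-- Bases of the weight spaces assemble to a basis of weight vectors. -/
theorem exists_wtBasis (hi : iSupIndep (wt D ψ)) (ht : ⨆ ω, wt D ψ ω = ⊤)
    {d : Module.Dual ℚ H → ℕ} (b : ∀ ω, Module.Basis (Fin (d ω)) K (wt D ψ ω)) :
    ∃ B : Module.Basis (Σ ω, Fin (d ω)) K V, ∀ p, B p = b p.1 p.2 := by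
  classical
  exact ⟨(DirectSum.isInternal_submodule_of_iSupIndep_of_iSup_eq_top hi ht).collectedBasis b,
    fun p => by rw [DirectSum.IsInternal.collectedBasis_coe]⟩

theorem finite_sigma_fst_eq {ι : Type*} (d : ι → ℕ) (ω : ι) :
    {p : Σ ω, Fin (d ω) | p.1 = ω}.Finite := by
  refine (Set.finite_range fun k : Fin (d ω) => (⟨ω, k⟩ : Σ ω, Fin (d ω))).subset ?_
  rintro ⟨_, k⟩ rfl
  exact ⟨k, rfl⟩

end WeightBases

/-! ### Sums in coordinates -/

section Coordinates

variable {X ι : Type*} [AddCommGroup X] [Module LC X] (B : Module.Basis ι LC X)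

/-- Only the finitely many coordinates in `S` occur, so the sum is built one coordinate at a time.
-/
theorem exists_hasUSum_of_repr {f : ℤ → X} {S : Set ι} (hS : S.Finite)
    (h0 : ∀ m, ∀ p ∉ S, B.repr (f m) p = 0)
    (h : ∀ N p, {m | B.repr (f m) p ∉ uLattice N}.Finite) : ∃ z, HasUSum f z := by
  have h1 (p : ι) : HasUSum (fun m => B.repr (f m) p • B p) ((∑' m, B.repr (f m) p) • B p) :=
    hasUSum_smul_vec (summable_of_uLattice fun N => h N p).hasSum _
  refine ⟨∑ p ∈ hS.toFinset, (∑' m, B.repr (f m) p) • B p, ?_⟩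
  convert hasUSum_sum (s := hS.toFinset) fun p _ => h1 p using 2 with m
  conv_lhs => rw [← B.linearCombination_repr (f m), Finsupp.linearCombination_apply, Finsupp.sum]
  refine Finset.sum_subset (fun p hp => ?_) fun p _ hp => ?_
  · by_contra h2
    exact Finsupp.mem_support_iff.1 hp (h0 m p fun h3 => h2 (hS.mem_toFinset.2 h3))
  · rw [Finsupp.notMem_support_iff.1 hp, zero_smul]

variable {B} in
theorem repr_mem_uLattice_of_hasUSum {f : ℤ → X} {z : X} (hz : HasUSum f z) {p : ι} {N : ℤ}
    (h : ∀ m, B.repr (f m) p ∈ uLattice N) : B.repr z p ∈ uLattice N :=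
  mem_uLattice_of_hasSum (hz.hasSum_dual (B.coord p)) h

variable {B} in
theorem repr_mem_uLattice_of_hasCoeffsIn {d : ℕ} {e : Fin d → X} (he : ∀ β, ∃ p, e β = B p)
    {N : ℤ} {v : X} (h : HasCoeffsIn e N v) (p : ι) : B.repr v p ∈ uLattice N := by
  classical
  obtain ⟨c, hc, rfl⟩ := h
  rw [map_sum, Finsupp.finsetSum_apply]
  refine sum_mem_uLattice fun β _ => ?_
  obtain ⟨q, hq⟩ := he β
  rw [hq, map_smul, Module.Basis.repr_self, Finsupp.smul_apply, Finsupp.single_apply, smul_eq_mul]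
  split_ifs
  · rw [mul_one]
    exact hc β
  · rw [mul_zero]
    exact zero_mem_uLattice N

end Coordinates

/-! ### The tensor product -/

section Tensor

variable {V₁ : Type*} [AddCommGroup V₁] [Module ℂ V₁] {V₂ : Type*} [AddCommGroup V₂] [Module LC V₂]

/-- The vector `(1 ⊗ v) ⊗ w` of `i(V₁) ⊗ V₂`. -/
noncomputable def pureTensor (v : V₁) (w : V₂) : iTensor V₁ V₂ := ((1 : LC) ⊗ₜ[ℂ] v) ⊗ₜ[LC] w

theorem pureTensor_zero_left (w : V₂) : pureTensor (0 : V₁) w = 0 := by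
  rw [pureTensor, TensorProduct.tmul_zero, TensorProduct.zero_tmul]

theorem pureTensor_zero_right (v : V₁) : pureTensor v (0 : V₂) = 0 := by
  rw [pureTensor, TensorProduct.tmul_zero]

theorem pureTensor_add_left (v v' : V₁) (w : V₂) :
    pureTensor (v + v') w = pureTensor v w + pureTensor v' w := by
  rw [pureTensor, TensorProduct.tmul_add, TensorProduct.add_tmul]
  rfl

theorem pureTensor_add_right (v : V₁) (w w' : V₂) :
    pureTensor v (w + w') = pureTensor v w + pureTensor v w' := by
  rw [pureTensor, TensorProduct.tmul_add]
  rfl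

theorem pureTensor_smul_left (a : ℂ) (v : V₁) (w : V₂) :
    pureTensor (a • v) w = algebraMap ℂ LC a • pureTensor v w := by
  rw [pureTensor, pureTensor, TensorProduct.tmul_smul, ← algebraMap_smul LC a,
    ← TensorProduct.smul_tmul']

theorem pureTensor_smul_right (c : LC) (v : V₁) (w : V₂) :
    pureTensor v (c • w) = c • pureTensor v w := by
  rw [pureTensor, pureTensor, TensorProduct.tmul_smul]

variable {ι₁ ι₂ : Type*} (B₁ : Module.Basis ι₁ ℂ V₁) (B₂ : Module.Basis ι₂ LC V₂)

/-- The basis of `i(V₁) ⊗ V₂` given by bases of `V₁` and `V₂`. -/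
noncomputable def tensorBasis : Module.Basis (ι₁ × ι₂) LC (iTensor V₁ V₂) :=
  (B₁.baseChange LC).tensorProduct B₂

theorem tensorBasis_apply (p : ι₁ × ι₂) :
    tensorBasis B₁ B₂ p = pureTensor (B₁ p.1) (B₂ p.2) := by
  rw [tensorBasis, Module.Basis.tensorProduct_apply', Module.Basis.baseChange_apply, pureTensor]

theorem tensorBasis_repr (v : V₁) (w : V₂) (p : ι₁ × ι₂) :
    (tensorBasis B₁ B₂).repr (pureTensor v w) p =
      algebraMap ℂ LC (B₁.repr v p.1) * B₂.repr w p.2 := by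
  rw [tensorBasis, pureTensor, Module.Basis.tensorProduct_repr_tmul_apply,
    Module.Basis.baseChange_repr_tmul, smul_eq_mul, mul_comm, Algebra.smul_def, mul_one]

theorem pureTensor_ne_zero {v : V₁} {w : V₂} (hv : v ≠ 0) (hw : w ≠ 0) : pureTensor v w ≠ 0 := by
  let B₁ := Module.Basis.ofVectorSpace ℂ V₁
  let B₂ := Module.Basis.ofVectorSpace LC V₂
  obtain ⟨p, hp⟩ := Finsupp.ne_iff.1 ((map_ne_zero_iff _ B₁.repr.injective).2 hv)
  obtain ⟨q, hq⟩ := Finsupp.ne_iff.1 ((map_ne_zero_iff _ B₂.repr.injective).2 hw)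
  intro h
  have h1 := tensorBasis_repr B₁ B₂ v w (p, q)
  rw [h, map_zero] at h1
  exact mul_ne_zero ((map_ne_zero_iff _ (algebraMap ℂ LC).injective).2 hp) hq h1.symm

variable {n : ℕ} {H : Type*} [AddCommGroup H] [Module ℚ H] (D : Datum n H)
  (ρ₁ : Ut D →ₐ[ℂ] Module.End ℂ V₁) (ρ₂ : Ut' D →ₐ[LC] Module.End LC V₂)

theorem tensorAct_pureTensor (a b : Ut D) (v : V₁) (w : V₂) :
    tensorActHom D (iRep D ρ₁) ρ₂ (a ⊗ₜ[ℂ] b) (pureTensor v w) =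
      pureTensor (ρ₁ a v) (ρ₂ (incl D b) w) := by
  rw [tensorActHom_apply, pureTensor, tensorAct_apply]
  change iRep D ρ₁ ((1 : LC) ⊗ₜ[ℂ] a) ((1 : LC) ⊗ₜ[ℂ] v) ⊗ₜ[LC] _ = _
  rw [iRep_apply, mul_one]
  rfl

end Tensor

/-! ### Bases adapted to `𝒪^R` -/

section RBasis

variable {n : ℕ} {H : Type*} [AddCommGroup H] [Module ℚ H] (D : Datum n H)
variable {V : Type*} [AddCommGroup V] [Module LC V]

/-- The action of `Ũ_q(ĝ)` on a `Ũ'_q(ĝ)`-module. -/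
noncomputable def uAct (ρ : Ut' D →ₐ[LC] Module.End LC V) : Ut D →+* Module.End LC V :=
  (ρ : Ut' D →+* Module.End LC V).comp (incl D : Ut D →+* Ut' D)

theorem uAct_apply (ρ : Ut' D →ₐ[LC] Module.End LC V) (a : Ut D) :
    uAct D ρ a = ρ (incl D a) := rfl

theorem uAct_smul (ρ : Ut' D →ₐ[LC] Module.End LC V) (c : ℂ) (a : Ut D) :
    uAct D ρ (c • a) = algebraMap ℂ LC c • uAct D ρ a := by
  rw [uAct_apply, uAct_apply, map_smul, ← algebraMap_smul LC c, map_smul]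

/-- A basis of weight vectors, in which the matrix coefficients of `x_{i,m}^±` and `φ_{i,m}^±` lie
in the lattices prescribed by `𝒪^R`. -/
structure IsRBasis (R : ℕ) (ρ : Ut' D →ₐ[LC] Module.End LC V) {ι : Type*}
    (B : Module.Basis ι LC V) (f : ι → Module.Dual ℚ H) : Prop where
  mem_wt : ∀ p, B p ∈ wt D (uAct D ρ) (f p)
  finite : ∀ ω, {p | f p = ω}.Finite
  x_mem : ∀ ε i m p q, B.repr (uAct D ρ (Ut.x D ε i m) (B p)) q ∈
    uLattice (if 0 ≤ m then 0 else (R : ℤ) * m)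
  phi_neg_mem : ∀ i (m : ℕ) p q, B.repr (uAct D ρ (Ut.phi D (-1) i m) (B p)) q ∈
    uLattice (-((m : ℤ) * (R : ℤ)))
  phi_pos_mem : ∀ i m p q, B.repr (uAct D ρ (Ut.phi D 1 i m) (B p)) q ∈ uLattice 0

/-- A single basis of the whole module frees the estimates of matrix coefficients from the
bookkeeping of weights. -/
theorem InOR.exists_isRBasis {R : ℕ} {ρ : Ut' D →ₐ[LC] Module.End LC V} (h : InOR D R ρ) :
    ∃ (d : Module.Dual ℚ H → ℕ) (B : Module.Basis (Σ ω, Fin (d ω)) LC V),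
      IsRBasis D R ρ B Sigma.fst := by
  obtain ⟨hO, d, b, hx, hn, hp⟩ := h
  obtain ⟨B, hB⟩ := exists_wtBasis D (uAct D ρ) (iSupIndep_wt D _) hO.weights.iSup_eq_top b
  have hb (ω : Module.Dual ℚ H) (β : Fin (d ω)) :
      ∃ p, (b ω β : V) = B p := ⟨⟨ω, β⟩, (hB ⟨ω, β⟩).symm⟩
  refine ⟨d, B, fun p => ?_, finite_sigma_fst_eq d, ?_, ?_, ?_⟩
  · rw [hB]
    exact (b p.1 p.2).2
  · rintro ε i m ⟨ω, α⟩ q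
    rw [hB]
    exact repr_mem_uLattice_of_hasCoeffsIn (hb _) (hx ε i m ω α) q
  · rintro i m ⟨ω, α⟩ q
    rw [hB]
    exact repr_mem_uLattice_of_hasCoeffsIn (hb _) (hn i m ω α) q
  · rintro i m ⟨ω, α⟩ q
    rw [hB]
    exact repr_mem_uLattice_of_hasCoeffsIn (hb _) (hp i m ω α) q

variable {D} in
-- The coordinates in the bases of the weight spaces are coordinates in `B`, by `exists_basis_wt`,
-- so the bounds carry over unchanged.
theorem IsRBasis.inOR {R : ℕ} {ρ : Ut' D →ₐ[LC] Module.End LC V} {ι : Type*}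
    {B : Module.Basis ι LC V} {f : ι → Module.Dual ℚ H} (h : IsRBasis D R ρ B f)
    (hO : InO' D ρ) : InOR D R ρ := by
  obtain ⟨d, b, hb, hj⟩ := exists_basis_wt h.mem_wt h.finite
  refine ⟨hO, d, b, fun ε i m ω α => ?_, fun i m ω α => ?_, fun i m ω α => ?_⟩
  · obtain ⟨p, hp⟩ := hb ω α
    obtain ⟨j, hj⟩ := hj _ _ (x_mem_wt D (uAct D ρ) (uAct_smul D ρ) ε i m (b ω α).2)
    refine ⟨_, fun β => ?_, hj⟩
    rw [hp]
    exact h.x_mem ε i m p (j β)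
  · obtain ⟨p, hp⟩ := hb ω α
    obtain ⟨j, hj⟩ := hj _ _ (phi_mem_wt D (uAct D ρ) (-1) i m (b ω α).2)
    refine ⟨_, fun β => ?_, hj⟩
    rw [hp]
    exact h.phi_neg_mem i m p (j β)
  · obtain ⟨p, hp⟩ := hb ω α
    obtain ⟨j, hj⟩ := hj _ _ (phi_mem_wt D (uAct D ρ) 1 i m (b ω α).2)
    refine ⟨_, fun β => ?_, hj⟩
    rw [hp]
    exact h.phi_pos_mem i m p (j β)

theorem repr_self_mem_uLattice {ι : Type*} (B : Module.Basis ι LC V) (p q : ι) :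
    B.repr (B p) q ∈ uLattice 0 := by
  classical
  rw [Module.Basis.repr_self, Finsupp.single_apply]
  split_ifs
  · exact uPow_mem_uLattice 0
  · exact zero_mem_uLattice 0

end RBasis

/-! ### The action of the generators on the tensor product -/

section TensorModule

variable {n : ℕ} {H : Type*} [AddCommGroup H] [Module ℚ H] {D : Datum n H}
variable {V₁ : Type*} [AddCommGroup V₁] [Module ℂ V₁] {V₂ : Type*} [AddCommGroup V₂] [Module LC V₂]
  {ρ₁ : Ut D →ₐ[ℂ] Module.End ℂ V₁} {ρ₂ : Ut' D →ₐ[LC] Module.End LC V₂}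
  {ι₁ ι₂ : Type*} {B₁ : Module.Basis ι₁ ℂ V₁} {B₂ : Module.Basis ι₂ LC V₂}
  {f₁ : ι₁ → Module.Dual ℚ H} {f₂ : ι₂ → Module.Dual ℚ H}

/-- On a basis vector, the term of index `m` is zero for `m < M`, has coordinates of order at least
`m + c m`, and involves only the finitely many basis vectors of one pair of weights. As `c m ≥ 0`
for `m ≥ 0`, the orders tend to infinity; the least of them bounds the matrix coefficients of the
sum. -/
theorem exists_actsAs_of_isCur (h₁ : ∀ p, B₁ p ∈ wt D (ρ₁ : Ut D →+* Module.End ℂ V₁) (f₁ p))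
    (hf₁ : ∀ ω, {p | f₁ p = ω}.Finite) (h₂ : ∀ p, B₂ p ∈ wt D (uAct D ρ₂) (f₂ p))
    (hf₂ : ∀ ω, {p | f₂ p = ω}.Finite) {a b : ℤ → Ut D} {P : ℤ → UtCompl D} (hP : IsCur a b P)
    {α β : Module.Dual ℚ H}
    (ha : ∀ m ω, ∀ v ∈ wt D (ρ₁ : Ut D →+* Module.End ℂ V₁) ω,
      ρ₁ (a m) v ∈ wt D (ρ₁ : Ut D →+* Module.End ℂ V₁) (ω + α))
    (hb : ∀ m ω, ∀ v ∈ wt D (uAct D ρ₂) ω, uAct D ρ₂ (b m) v ∈ wt D (uAct D ρ₂) (ω + β))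
    {c : ℤ → ℤ} (hc : ∀ m p q, B₂.repr (uAct D ρ₂ (b m) (B₂ p)) q ∈ uLattice (c m))
    (hc0 : ∀ m, 0 ≤ m → 0 ≤ c m) (r M : ℤ) (hM : ∀ m < M, a (r - m) = 0 ∨ b m = 0) :
    ∃ Θ, ActsAs (tensorActHom D (iRep D ρ₁) ρ₂) (P r) Θ ∧
      ∀ N, (∀ m ≥ M, N ≤ m + c m) →
        ∀ p q, (tensorBasis B₁ B₂).repr (Θ (tensorBasis B₁ B₂ p)) q ∈ uLattice N := by
  set T := tensorBasis B₁ B₂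
  have hterm (m : ℤ) (p : ι₁ × ι₂) :
      uPow m • tensorActHom D (iRep D ρ₁) ρ₂ ((P r).coeff m) (T p) =
        uPow m • pureTensor (ρ₁ (a (r - m)) (B₁ p.1)) (uAct D ρ₂ (b m) (B₂ p.2)) := by
    rw [hP, tensorBasis_apply, tensorAct_pureTensor, uAct_apply]
  have hrepr (m : ℤ) (p q : ι₁ × ι₂) :
      T.repr (uPow m • tensorActHom D (iRep D ρ₁) ρ₂ ((P r).coeff m) (T p)) q =
        uPow m * (algebraMap ℂ LC (B₁.repr (ρ₁ (a (r - m)) (B₁ p.1)) q.1) *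
          B₂.repr (uAct D ρ₂ (b m) (B₂ p.2)) q.2) := by
    rw [hterm, map_smul, Finsupp.smul_apply, tensorBasis_repr, smul_eq_mul]
  have hzero (m : ℤ) (hm : m < M) (p q : ι₁ × ι₂) :
      T.repr (uPow m • tensorActHom D (iRep D ρ₁) ρ₂ ((P r).coeff m) (T p)) q = 0 := by
    rw [hrepr]
    rcases hM m hm with h | h
    · simp [h]
    · simp [h]
  have hmem (m : ℤ) (p q : ι₁ × ι₂) :
      T.repr (uPow m • tensorActHom D (iRep D ρ₁) ρ₂ ((P r).coeff m) (T p)) q ∈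
        uLattice (m + c m) := by
    rw [hrepr]
    have := mul_mem_uLattice (uPow_mem_uLattice m)
      (mul_mem_uLattice (algebraMap_mem_uLattice (B₁.repr (ρ₁ (a (r - m)) (B₁ p.1)) q.1))
        (hc m p.2 q.2))
    rwa [zero_add] at this
  obtain ⟨Θ, hΘ⟩ := exists_actsAs (A := tensorActHom D (iRep D ρ₁) ρ₂) (t := P r) T.span_eq (by
    rintro _ ⟨p, rfl⟩
    refine exists_hasUSum_of_repr T (S := {q | f₁ q.1 = f₁ p.1 + α} ∩ {q | f₂ q.2 = f₂ p.2 + β})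
      ?_ (fun m q hq => ?_) fun N q => ?_
    · exact (hf₁ (f₁ p.1 + α)).prod (hf₂ (f₂ p.2 + β))
    · rw [hrepr]
      by_cases hq1 : f₁ q.1 = f₁ p.1 + α
      · rw [repr_eq_zero_of_mem_wt h₂ (hb m _ _ (h₂ p.2)) fun hq2 => hq ⟨hq1, hq2⟩, mul_zero,
          mul_zero]
      · rw [repr_eq_zero_of_mem_wt h₁ (ha (r - m) _ _ (h₁ p.1)) hq1, map_zero, zero_mul, mul_zero]
    -- For `m ≥ max 0 N` the order `m + c m` is at least `m`, hence at least `N`.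
    · refine (Set.finite_Ico M (max 0 N)).subset fun m hm => ?_
      refine Set.mem_Ico.2 ⟨?_, ?_⟩
      · by_contra hlt
        refine hm ?_
        rw [hzero m (not_le.1 hlt)]
        exact zero_mem_uLattice N
      · by_contra hlt
        refine hm (uLattice_mono ?_ (hmem m p q))
        have h1 := max_le_iff.1 (not_lt.1 hlt)
        have h2 := hc0 m h1.1
        omega)
  refine ⟨Θ, hΘ, fun N hN p q => repr_mem_uLattice_of_hasUSum (hΘ (T p)) fun m => ?_⟩
  rcases lt_or_ge m M with h | h
  · rw [hzero m h]
    exact zero_mem_uLattice N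
  · exact uLattice_mono (hN m h) (hmem m p q)

theorem phiZ_repr_mem {R : ℕ} (h₂ : IsRBasis D R ρ₂ B₂ f₂) (i : Fin n) (m : ℤ) (p q : ι₂) :
    B₂.repr (uAct D ρ₂ (Ut.phiZ D 1 i m) (B₂ p)) q ∈ uLattice 0 := by
  rcases lt_or_ge m 0 with h | h
  · rw [Ut.phiZ_of_neg D 1 i (by simpa using h)]
    simpa using zero_mem_uLattice 0
  · rw [Ut.phiZ_of_nonneg D 1 i (m := m.toNat) (by simpa using h)]
    exact h₂.phi_pos_mem i _ p q

/-- This is where `R + 1` comes from. For `x^+` the sum runs over `m ≥ r`, and a negative `m` has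
order at least `m + R m`, which is at least `(R + 1) r`. For `x^-` the summand `u^r (1 ⊗ x^-_{i,r})`
reaches the same bound, while the other sum has only `m ≥ 0` and `φ^+` without poles. -/
theorem exists_actsAs_x {R : ℕ} (h₁ : ∀ p, B₁ p ∈ wt D (ρ₁ : Ut D →+* Module.End ℂ V₁) (f₁ p))
    (hf₁ : ∀ ω, {p | f₁ p = ω}.Finite) (h₂ : IsRBasis D R ρ₂ B₂ f₂) (ε : ℤˣ) (i : Fin n) (r : ℤ) :
    ∃ Θ, ActsAs (tensorActHom D (iRep D ρ₁) ρ₂) (coproduct D (incl D (Ut.x D ε i r))) Θ ∧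
      ∀ p q, (tensorBasis B₁ B₂).repr (Θ (tensorBasis B₁ B₂ p)) q ∈
        uLattice (if 0 ≤ r then 0 else ((R + 1 : ℕ) : ℤ) * r) := by
  have hx₁ (ε : ℤˣ) (m : ℤ) (ω) (v : V₁) (hv : v ∈ wt D (ρ₁ : Ut D →+* Module.End ℂ V₁) ω) :
      ρ₁ (Ut.x D ε i m) v ∈ wt D (ρ₁ : Ut D →+* Module.End ℂ V₁) (ω + (ε : ℤ) • D.root i) :=
    x_mem_wt D (ρ₁ : Ut D →+* Module.End ℂ V₁) (fun c a => map_smul ρ₁ c a) ε i m hv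
  rw [coproduct_incl, Ut.x, dU_mkU, dFree_x]
  have hN : (if 0 ≤ r then 0 else ((R + 1 : ℕ) : ℤ) * r) ≤ 0 := by
    split_ifs with h
    · exact le_rfl
    · exact mul_nonpos_of_nonneg_of_nonpos (by positivity) (not_le.1 h).le
  rcases Int.units_eq_one_or ε with rfl | rfl
  · obtain ⟨Θ, hΘ, hΘN⟩ := exists_actsAs_of_isCur (α := 0) h₁ hf₁ h₂.mem_wt h₂.finite
      (isCur_dP D i)
      (fun m ω v hv => by
        rw [add_zero]
        exact phiZ_mem_wt D (ρ₁ : Ut D →+* Module.End ℂ V₁) (-1) i m hv)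
      (fun m ω v hv => x_mem_wt D (uAct D ρ₂) (uAct_smul D ρ₂) 1 i m hv)
      (fun m p q => h₂.x_mem 1 i m p q) (fun m hm => by rw [if_pos hm]) r r
      (fun m hm => Or.inl (Ut.phiZ_of_neg D (-1) i (by simpa using hm)))
    rw [dX_one]
    refine ⟨_, (actsAs_single 0 _).add hΘ, fun p q => ?_⟩
    rw [LinearMap.add_apply, map_add, Finsupp.add_apply]
    refine add_mem_uLattice (uLattice_mono hN ?_) (hΘN _ (fun m hm => ?_) p q)
    · rw [uPow_zero, one_smul, tensorBasis_apply, tensorAct_pureTensor, tensorBasis_repr, map_one,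
        map_one, Module.End.one_apply]
      have := mul_mem_uLattice (algebraMap_mem_uLattice
        (B₁.repr (ρ₁ (Ut.x D 1 i r) (B₁ p.1)) q.1)) (repr_self_mem_uLattice B₂ p.2 q.2)
      rwa [zero_add] at this
    · have hR : (0 : ℤ) ≤ R := by positivity
      push_cast
      split_ifs <;> nlinarith
  · obtain ⟨Θ, hΘ, hΘN⟩ := exists_actsAs_of_isCur (β := 0) h₁ hf₁ h₂.mem_wt h₂.finite
      (isCur_dQ D i) (fun m ω v hv => hx₁ (-1) m ω v hv)
      (fun m ω v hv => by
        rw [add_zero]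
        exact phiZ_mem_wt D (uAct D ρ₂) 1 i m hv)
      (fun m p q => phiZ_repr_mem h₂ i m p q) (fun m hm => le_rfl) r 0
      (fun m hm => Or.inr (Ut.phiZ_of_neg D 1 i (by simpa using hm)))
    rw [dX_neg_one]
    refine ⟨_, (actsAs_single r _).add hΘ, fun p q => ?_⟩
    rw [LinearMap.add_apply, map_add, Finsupp.add_apply]
    refine add_mem_uLattice ?_ (hΘN _ (fun m hm => ?_) p q)
    · rw [LinearMap.smul_apply, map_smul, Finsupp.smul_apply, smul_eq_mul, tensorBasis_apply,
        tensorAct_pureTensor, tensorBasis_repr]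
      have := mul_mem_uLattice (uPow_mem_uLattice r) (mul_mem_uLattice (algebraMap_mem_uLattice
        (B₁.repr (ρ₁ 1 (B₁ p.1)) q.1)) (h₂.x_mem (-1) i r p.2 q.2))
      refine uLattice_mono ?_ this
      push_cast
      split_ifs <;> linarith
    · exact hN.trans (by simpa using hm)

theorem exists_isDefinedBy_coproduct {R : ℕ}
    (h₁ : ∀ p, B₁ p ∈ wt D (ρ₁ : Ut D →+* Module.End ℂ V₁) (f₁ p))
    (hf₁ : ∀ ω, {p | f₁ p = ω}.Finite) (h₂ : IsRBasis D R ρ₂ B₂ f₂) :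
    ∃ τ : Ut' D →ₐ[LC] Module.End LC (iTensor V₁ V₂),
      IsDefinedBy D (coproduct D) (iRep D ρ₁) ρ₂ τ := by
  refine exists_isDefinedBy D (iRep D ρ₁) ρ₂ (fun ε i r => ?_) (fun h => ?_) fun i m => ?_
  · obtain ⟨Θ, hΘ, _⟩ := exists_actsAs_x h₁ hf₁ h₂ ε i r
    exact ⟨Θ, hΘ⟩
  · rw [(isDrinfeldCoproduct_coproduct D).map_k]
    exact ⟨_, actsAs_single _ _⟩
  · rw [coproduct_incl, Ut.h, dU_mkU, dFree_h]
    exact ⟨_, (actsAs_single _ _).add (actsAs_single _ _)⟩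

variable {τ : Ut' D →ₐ[LC] Module.End LC (iTensor V₁ V₂)}

theorem IsDefinedBy.k_eq (hτ : IsDefinedBy D (coproduct D) (iRep D ρ₁) ρ₂ τ) (h : H) :
    uAct (V := iTensor V₁ V₂) D τ (Ut.k D h) = tensorActHom D (iRep D ρ₁) ρ₂ (Ut.k D h ⊗ₜ[ℂ] Ut.k D h) := by
  have h1 : ActsAs (tensorActHom D (iRep D ρ₁) ρ₂) (coproduct D (incl D (Ut.k D h)))
      (uAct (V := iTensor V₁ V₂) D τ (Ut.k D h)) := hτ _
  rw [(isDrinfeldCoproduct_coproduct D).map_k] at h1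
  rw [h1.unique (actsAs_single _ _), uPow_zero, one_smul]

theorem IsDefinedBy.phi_eq (hτ : IsDefinedBy D (coproduct D) (iRep D ρ₁) ρ₂ τ) (ε : ℤˣ)
    (i : Fin n) (m : ℕ) : uAct (V := iTensor V₁ V₂) D τ (Ut.phi D ε i m) = ∑ l ∈ Finset.range (m + 1),
      uPow ((ε : ℤ) * (l : ℤ)) • tensorActHom D (iRep D ρ₁) ρ₂
        (Ut.phi D ε i (m - l) ⊗ₜ[ℂ] Ut.phi D ε i l) := by
  have h1 : ActsAs (tensorActHom D (iRep D ρ₁) ρ₂) (coproduct D (incl D (Ut.phi D ε i m)))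
      (uAct (V := iTensor V₁ V₂) D τ (Ut.phi D ε i m)) := hτ _
  rw [(isDrinfeldCoproduct_coproduct D).map_phi] at h1
  exact h1.unique (actsAs_sum fun l _ => actsAs_single _ _)

theorem IsDefinedBy.pureTensor_mem_wt (hτ : IsDefinedBy D (coproduct D) (iRep D ρ₁) ρ₂ τ)
    {ω₁ ω₂ : Module.Dual ℚ H} {v : V₁} {w : V₂}
    (hv : v ∈ wt D (ρ₁ : Ut D →+* Module.End ℂ V₁) ω₁) (hw : w ∈ wt D (uAct D ρ₂) ω₂) :
    pureTensor v w ∈ wt D (uAct (V := iTensor V₁ V₂) D τ) (ω₁ + ω₂) := by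
  rw [mem_weightSpace] at hv hw ⊢
  intro h
  rw [hτ.k_eq, tensorAct_pureTensor]
  have hv' : ρ₁ (Ut.k D h) v = _ := hv h
  have hw' : ρ₂ (incl D (Ut.k D h)) w = _ := hw h
  rw [hv', hw', pureTensor_smul_right, Algebra.algebraMap_self_apply, pureTensor_smul_left,
    smul_smul, ← map_mul, ← D.qp_add, LinearMap.add_apply, add_comm]

theorem IsDefinedBy.phi_repr_mem (hτ : IsDefinedBy D (coproduct D) (iRep D ρ₁) ρ₂ τ) {ε : ℤˣ}
    {i : Fin n} {m : ℕ} {N : ℤ} {c : ℕ → ℤ}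
    (h : ∀ l p q, B₂.repr (uAct D ρ₂ (Ut.phi D ε i l) (B₂ p)) q ∈ uLattice (c l))
    (hc : ∀ l ≤ m, N ≤ (ε : ℤ) * l + c l) (p q : ι₁ × ι₂) :
    (tensorBasis B₁ B₂).repr (uAct (V := iTensor V₁ V₂) D τ (Ut.phi D ε i m) (tensorBasis B₁ B₂ p)) q ∈
      uLattice N := by
  rw [hτ.phi_eq, LinearMap.sum_apply, map_sum, Finsupp.finsetSum_apply]
  refine sum_mem_uLattice fun l hl => ?_
  rw [LinearMap.smul_apply, map_smul, Finsupp.smul_apply, smul_eq_mul, tensorBasis_apply,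
    tensorAct_pureTensor, tensorBasis_repr]
  have := mul_mem_uLattice (uPow_mem_uLattice ((ε : ℤ) * l))
    (mul_mem_uLattice (algebraMap_mem_uLattice
      (B₁.repr (ρ₁ (Ut.phi D ε i (m - l)) (B₁ p.1)) q.1)) (h l p.2 q.2))
  rw [zero_add] at this
  exact uLattice_mono (hc l (Nat.lt_succ_iff.1 (Finset.mem_range.1 hl))) this

theorem IsDefinedBy.isRBasis (hτ : IsDefinedBy D (coproduct D) (iRep D ρ₁) ρ₂ τ) {R : ℕ}
    (h₁ : ∀ p, B₁ p ∈ wt D (ρ₁ : Ut D →+* Module.End ℂ V₁) (f₁ p))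
    (hf₁ : ∀ ω, {p | f₁ p = ω}.Finite) (h₂ : IsRBasis D R ρ₂ B₂ f₂)
    (hf : ∀ ω, {p : ι₁ × ι₂ | f₁ p.1 + f₂ p.2 = ω}.Finite) :
    IsRBasis (V := iTensor V₁ V₂) D (R + 1) τ (tensorBasis B₁ B₂) fun p : ι₁ × ι₂ => f₁ p.1 + f₂ p.2 where
  mem_wt p := by
    rw [tensorBasis_apply]
    exact hτ.pureTensor_mem_wt (h₁ _) (h₂.mem_wt _)
  finite := hf
  x_mem ε i m p q := by
    obtain ⟨Θ, hΘ, h⟩ := exists_actsAs_x h₁ hf₁ h₂ ε i m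
    have h1 : ActsAs (tensorActHom D (iRep D ρ₁) ρ₂) (coproduct D (incl D (Ut.x D ε i m)))
      (uAct (V := iTensor V₁ V₂) D τ (Ut.x D ε i m)) := hτ _
    rw [h1.unique hΘ]
    exact h p q
  phi_neg_mem i m p q := by
    -- The factor `u^{-l}` lowers the order `-l R` to `-l (R + 1)`, which is at least `-m (R + 1)`.
    refine hτ.phi_repr_mem (fun l => h₂.phi_neg_mem i l) (fun l hl => ?_) p q
    have h1 : (l : ℤ) ≤ m := by exact_mod_cast hl
    have h2 : (l : ℤ) * (R + 1) ≤ m * (R + 1) := by gcongr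
    push_cast
    linarith
  phi_pos_mem i m p q := by
    refine hτ.phi_repr_mem (fun l => h₂.phi_pos_mem i l) (fun l hl => ?_) p q
    simp

end TensorModule

/-! ### Finiteness of the weight spaces of the tensor product -/

section Cones

variable {n : ℕ} {H : Type*} [AddCommGroup H] [Module ℚ H] (D : Datum n H)

theorem InCone.add {μ ν ω ω' : Module.Dual ℚ H} (h : InCone D μ ω) (h' : InCone D ν ω') :
    InCone D (μ + ν) (ω + ω') := by
  obtain ⟨c, hc⟩ := h
  obtain ⟨c', hc'⟩ := h'
  refine ⟨c + c', ?_⟩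
  rw [add_sub_add_comm, hc, hc', ← Finset.sum_add_distrib]
  exact Finset.sum_congr rfl fun i _ => (add_smul _ _ _).symm

theorem sum_root_injective :
    Function.Injective fun c : Fin n → ℕ => ∑ i, c i • D.root i := by
  intro c c' h
  have h1 := Fintype.linearIndependent_iff.1 D.root_indep (fun i => (c i : ℚ) - c' i) (by
    simp only [sub_smul, Nat.cast_smul_eq_nsmul, Finset.sum_sub_distrib]
    exact sub_eq_zero.2 h)
  funext i
  exact_mod_cast sub_eq_zero.1 (h1 i)

/-- If `c` and `c'` are the coefficients of `μ - ω` and `ω - ν` on the simple roots, linear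
independence makes `c + c'` constant, which leaves finitely many `c`. -/
theorem finite_inCone_sub (μ ν : Module.Dual ℚ H) :
    {ω | InCone D μ ω ∧ InCone D ω ν}.Finite := by
  rcases Set.eq_empty_or_nonempty {ω | InCone D μ ω ∧ InCone D ω ν} with h0 | ⟨ω₀, ⟨c₀, h₀⟩, c₀', h₀'⟩
  · rw [h0]
    exact Set.finite_empty
  refine ((Set.finite_Iic (c₀ + c₀')).image fun c => μ - ∑ i, c i • D.root i).subset ?_
  rintro ω ⟨⟨c, hc⟩, c', hc'⟩
  refine ⟨c, ?_, ?_⟩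
  · have h1 : c + c' = c₀ + c₀' := by
      refine sum_root_injective D ?_
      simp only [Pi.add_apply, add_smul, Finset.sum_add_distrib]
      rw [← hc, ← hc', ← h₀, ← h₀', sub_add_sub_cancel, sub_add_sub_cancel]
    exact Set.mem_Iic.2 (h1 ▸ le_self_add)
  · change μ - _ = ω
    rw [← hc, sub_sub_cancel]

theorem inCone_sub {μ ν ω ω' : Module.Dual ℚ H} (h : InCone D ν ω') (he : ω + ω' = μ) :
    InCone D ω (μ - ν) := by
  obtain ⟨c, hc⟩ := h
  refine ⟨c, ?_⟩
  rw [← hc, ← he]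
  abel

variable {ι₁ ι₂ : Type*} {f₁ : ι₁ → Module.Dual ℚ H} {f₂ : ι₂ → Module.Dual ℚ H}

/-- If the second weight lies below `ν`, the first one lies above `ω - ν`; it also lies below some
`μ`, and such intervals are finite. -/
theorem finite_fibre_add (hf₁ : ∀ ω, {p | f₁ p = ω}.Finite) (hf₂ : ∀ ω, {p | f₂ p = ω}.Finite)
    {S₁ S₂ : Finset (Module.Dual ℚ H)} (h₁ : ∀ p, ∃ μ ∈ S₁, InCone D μ (f₁ p))
    (h₂ : ∀ p, ∃ μ ∈ S₂, InCone D μ (f₂ p)) (ω : Module.Dual ℚ H) :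
    {p : ι₁ × ι₂ | f₁ p.1 + f₂ p.2 = ω}.Finite := by
  have hP : (⋃ μ ∈ S₁, ⋃ ν ∈ S₂, {ω₁ | InCone D μ ω₁ ∧ InCone D ω₁ (ω - ν)}).Finite :=
    Set.Finite.biUnion S₁.finite_toSet fun μ _ => Set.Finite.biUnion S₂.finite_toSet
      fun ν _ => finite_inCone_sub D μ (ω - ν)
  refine (hP.biUnion fun ω₁ _ => (hf₁ ω₁).prod (hf₂ (ω - ω₁))).subset fun p hp => ?_
  obtain ⟨μ, hμ, h1⟩ := h₁ p.1
  obtain ⟨ν, hν, h2⟩ := h₂ p.2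
  have hp : f₁ p.1 + f₂ p.2 = ω := hp
  simp only [Set.mem_iUnion]
  exact ⟨f₁ p.1, ⟨μ, hμ, ν, hν, h1, inCone_sub D h2 hp⟩, rfl, eq_sub_of_add_eq' hp⟩

variable {D} in
theorem InOWeights.exists_inCone {K : Type*} [Field K] [Algebra ℂ K] {V : Type*} [AddCommGroup V]
    [Module K V] {ψ : Ut D →+* Module.End K V} (h : InOWeights D K fun h => ψ (Ut.k D h))
    {ι : Type*} {B : Module.Basis ι K V} {f : ι → Module.Dual ℚ H}
    (hB : ∀ p, B p ∈ wt D ψ (f p)) :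
    ∃ S : Finset (Module.Dual ℚ H), ∀ p, ∃ μ ∈ S, InCone D μ (f p) := by
  obtain ⟨S, hS⟩ := h.bounded
  exact ⟨S, fun p => hS _ fun h0 => B.ne_zero p ((Submodule.eq_bot_iff _).1 h0 _ (hB p))⟩

variable {D} in
theorem inOWeights_of_basis {K : Type*} [Field K] [Algebra ℂ K] {V : Type*} [AddCommGroup V]
    [Module K V] {ψ : Ut D →+* Module.End K V} {ι : Type*} {B : Module.Basis ι K V}
    {f : ι → Module.Dual ℚ H} (hB : ∀ p, B p ∈ wt D ψ (f p)) (hf : ∀ ω, {p | f p = ω}.Finite)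
    {S : Finset (Module.Dual ℚ H)} (hS : ∀ p, ∃ μ ∈ S, InCone D μ (f p)) :
    InOWeights D K fun h => ψ (Ut.k D h) where
  indep := iSupIndep_wt D ψ
  iSup_eq_top := iSup_wt_eq_top hB
  finite ω := by
    obtain ⟨d, b, _⟩ := exists_basis_wt hB hf
    exact Module.Finite.of_basis (b ω)
  bounded := by
    refine ⟨S, fun ω hω => ?_⟩
    have hω : wt D ψ ω ≠ ⊥ := hω
    rw [← wt_eq_span hB] at hω
    obtain ⟨p, rfl⟩ : {p | f p = ω}.Nonempty := by
      rw [Set.nonempty_iff_ne_empty]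
      intro h0
      rw [h0, Set.image_empty, Submodule.span_empty] at hω
      exact hω rfl
    exact hS p

end Cones

/-! ### `l,u`-weights of the tensor product -/

section Generic

variable {n : ℕ} {H : Type*} [AddCommGroup H] [Module ℚ H] {D : Datum n H}

theorem eq_lwt_of_le {K : Type*} [Field K] [Algebra ℂ K] {V : Type*} [AddCommGroup V] [Module K V]
    {ψ : Ut D →+* Module.End K V}
    {N : Module.Dual ℚ H × (ℤˣ → Fin n → ℕ → K) → Submodule K V}
    (hle : ∀ p, N p ≤ lwt D ψ p.1 p.2) (hN : ⨆ p, N p = ⊤)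
    (p : Module.Dual ℚ H × (ℤˣ → Fin n → ℕ → K)) : N p = lwt D ψ p.1 p.2 :=
  eq_of_le_of_iSup_eq_top (iSupIndep_lwt D ψ) hle hN p

/-- Independence is automatic, so it suffices that the `l,u`-weight spaces fill the module: within
each weight space they then fill it too, by independence of the weight spaces. -/
theorem inO'_of_iSup_lwt {V : Type*} [AddCommGroup V] [Module LC V]
    {ρ : Ut' D →ₐ[LC] Module.End LC V} (h : InOWeights D LC fun h => uAct D ρ (Ut.k D h))
    (hN : ⨆ p : Plu D, lwt D (uAct D ρ) p.1.1 p.1.2 = ⊤) : InO' D ρ where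
  weights := h
  lu_indep ω := by
    refine (iSupIndep_lwt D (uAct D ρ)).comp
      (f := fun Ψ : {Ψ : ℤˣ → Fin n → ℕ → LC // (ω, Ψ) ∈ Plu D} => (ω, Ψ.1)) fun Ψ Ψ' hΨ => ?_
    exact Subtype.ext (congrArg Prod.snd hΨ)
  lu_iSup ω := by
    refine eq_of_le_of_iSup_eq_top
      (N := fun ω => ⨆ Ψ : {Ψ : ℤˣ → Fin n → ℕ → LC // (ω, Ψ) ∈ Plu D}, luSpace D ρ ω Ψ.1)
      h.indep (fun ω => iSup_le fun Ψ v hv => hv.1) ?_ ω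
    rw [eq_top_iff, ← hN]
    exact iSup_le fun p => le_iSup_of_le p.1.1 (le_iSup_of_le ⟨p.1.2, p.2⟩ le_rfl)

end Generic

/-! ### Tensor products of generalized eigenvectors -/

section LWeights

open Module.End

variable {n : ℕ} {H : Type*} [AddCommGroup H] [Module ℚ H] {D : Datum n H}
variable {V₁ : Type*} [AddCommGroup V₁] [Module ℂ V₁] {V₂ : Type*} [AddCommGroup V₂] [Module LC V₂]
  {ρ₁ : Ut D →ₐ[ℂ] Module.End ℂ V₁} {ρ₂ : Ut' D →ₐ[LC] Module.End LC V₂}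

theorem iRep_incl_tmul (a : Ut D) (v : V₁) :
    iRep D ρ₁ (incl D a) ((1 : LC) ⊗ₜ[ℂ] v) = (1 : LC) ⊗ₜ[ℂ] ρ₁ a v := by
  change iRep D ρ₁ ((1 : LC) ⊗ₜ[ℂ] a) _ = _
  rw [iRep_apply, mul_one]

theorem tmul_mem_maxGenEigenspace {a : Ut D} {c : ℂ} {v : V₁}
    (hv : v ∈ (ρ₁ a).maxGenEigenspace c) : (1 : LC) ⊗ₜ[ℂ] v ∈
      (iRep D ρ₁ (incl D a)).maxGenEigenspace (algebraMap ℂ LC c) := by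
  rw [mem_maxGenEigenspace] at hv ⊢
  obtain ⟨p, hp⟩ := hv
  have h1 : ∀ (p : ℕ) (v : V₁), ((iRep D ρ₁ (incl D a) -
      algebraMap ℂ LC c • (1 : Module.End LC (LC ⊗[ℂ] V₁))) ^ p) ((1 : LC) ⊗ₜ[ℂ] v) =
        (1 : LC) ⊗ₜ[ℂ] (((ρ₁ a - c • (1 : Module.End ℂ V₁)) ^ p) v) := by
    intro p
    induction p with
    | zero => intro v; rfl
    | succ p ih =>
      intro v
      rw [pow_succ, pow_succ, mul_apply, mul_apply, ← ih, LinearMap.sub_apply, iRep_incl_tmul,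
        LinearMap.smul_apply, one_apply, LinearMap.sub_apply, LinearMap.smul_apply, one_apply,
        TensorProduct.tmul_sub, TensorProduct.tmul_smul, algebraMap_smul, algebraMap_smul]
  exact ⟨p, by rw [h1, hp, TensorProduct.tmul_zero]⟩

theorem maxGenEigenspace_of_mem_lwt {K : Type*} [Field K] [Algebra ℂ K] {V : Type*}
    [AddCommGroup V] [Module K V] {ψ : Ut D →+* Module.End K V} {ω : Module.Dual ℚ H}
    {γ : ℤˣ → Fin n → ℕ → K} {v : V} (hv : v ∈ lwt D ψ ω γ) (ε : ℤˣ) (i : Fin n) (m : ℕ) :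
    v ∈ (ψ (Ut.phi D ε i m)).maxGenEigenspace (γ ε i m) := by
  obtain ⟨_, p, hp⟩ := hv
  exact (mem_maxGenEigenspace _ _ _).2 ⟨p, hp ε i m⟩

/-- The summation is reversed so that `l` indexes the second factor, as in `IsDefinedBy.phi_eq`. -/
theorem twistedMul_eq (γ₁ : ℤˣ → Fin n → ℕ → ℂ) (γ₂ : ℤˣ → Fin n → ℕ → LC) (ε : ℤˣ) (i : Fin n)
    (m : ℕ) : twistedMul γ₁ γ₂ ε i m = ∑ l ∈ Finset.range (m + 1),
      uPow ((ε : ℤ) * (l : ℤ)) * (algebraMap ℂ LC (γ₁ ε i (m - l)) * γ₂ ε i l) := by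
  rw [twistedMul, ← Finset.sum_flip fun l : ℕ =>
    uPow ((ε : ℤ) * (l : ℤ)) * (algebraMap ℂ LC (γ₁ ε i (m - l)) * γ₂ ε i l)]
  refine Finset.sum_congr rfl fun l hl => ?_
  rw [Nat.sub_sub_self (Nat.lt_succ_iff.1 (Finset.mem_range.1 hl)), mul_comm]

variable {τ : Ut' D →ₐ[LC] Module.End LC (iTensor V₁ V₂)}

/-- The summands `φ ⊗ φ` of the action commute, and on `v ⊗ w` each has the product of the two
eigenvalues as generalized eigenvalue; these add up to the twisted product. -/
theorem IsDefinedBy.pureTensor_mem_lwt (hτ : IsDefinedBy D (coproduct D) (iRep D ρ₁) ρ₂ τ)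
    {ω₁ ω₂ : Module.Dual ℚ H}
    [Module.Finite LC (wt (V := iTensor V₁ V₂) D (uAct (V := iTensor V₁ V₂) D τ) (ω₁ + ω₂))]
    {γ₁ : ℤˣ → Fin n → ℕ → ℂ} {γ₂ : ℤˣ → Fin n → ℕ → LC} {v : V₁} {w : V₂}
    (hv : v ∈ lwt D (ρ₁ : Ut D →+* Module.End ℂ V₁) ω₁ γ₁)
    (hw : w ∈ lwt D (uAct D ρ₂) ω₂ γ₂) :
    pureTensor v w ∈
      lwt (V := iTensor V₁ V₂) D (uAct (V := iTensor V₁ V₂) D τ) (ω₁ + ω₂) (twistedMul γ₁ γ₂) := by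
  refine mem_lwt_of_maxGenEigenspace D _ (hτ.pureTensor_mem_wt hv.1 hw.1) fun ε i m => ?_
  rw [hτ.phi_eq, twistedMul_eq]
  refine mem_maxGenEigenspace_sum (fun l l' => ?_) fun l _ =>
    mem_maxGenEigenspace_smul _ ?_
  · refine (Commute.smul_left (Commute.smul_right ?_ _) _)
    refine Commute.map ?_ (tensorActHom D (iRep D ρ₁) ρ₂)
    change _ * _ = _ * _
    rw [Algebra.TensorProduct.tmul_mul_tmul, Algebra.TensorProduct.tmul_mul_tmul,
      (Ut.commute_phi_phi D ε ε i i (m - l) (m - l')).eq, (Ut.commute_phi_phi D ε ε i i l l').eq]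
  · exact mem_maxGenEigenspace_tmul
      (tmul_mem_maxGenEigenspace (maxGenEigenspace_of_mem_lwt hv ε i (m - l)))
      (maxGenEigenspace_of_mem_lwt hw ε i l)

theorem compatible_twistedMul {ω₁ ω₂ : Module.Dual ℚ H} {γ₁ : ℤˣ → Fin n → ℕ → ℂ}
    {γ₂ : ℤˣ → Fin n → ℕ → LC} (h₁ : Compatible D ℂ ω₁ γ₁) (h₂ : Compatible D LC ω₂ γ₂) :
    Compatible D LC (ω₁ + ω₂) (twistedMul γ₁ γ₂) := by
  intro ε i
  rw [twistedMul_eq, zero_add, Finset.sum_range_one, Nat.cast_zero, mul_zero, uPow_zero, one_mul,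
    Nat.sub_zero, h₁, h₂, Algebra.algebraMap_self_apply, ← map_mul, ← D.qp_add,
    LinearMap.add_apply, mul_add]

theorem twistedMul_mem_Plu {ω₁ ω₂ : Module.Dual ℚ H} {γ₁ : ℤˣ → Fin n → ℕ → ℂ}
    {γ₂ : ℤˣ → Fin n → ℕ → LC} (h₁ : (ω₁, γ₁) ∈ Pl D) (h₂ : (ω₂, γ₂) ∈ Plu D) :
    (ω₁ + ω₂, twistedMul γ₁ γ₂) ∈ Plu D := by
  refine ⟨compatible_twistedMul h₁ h₂.1, fun ε i m => ?_⟩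
  refine (Set.Finite.biUnion (Finset.range (m + 1)).finite_toSet fun l _ =>
    (h₂.2 ε i (m - l)).image fun s => s + (ε : ℤ) * ((m - l : ℕ) : ℤ)).subset fun s hs => ?_
  have hs : LC.coeff (∑ l ∈ Finset.range (m + 1), _) s ≠ 0 := hs
  rw [LC.coeff_sum] at hs
  obtain ⟨l, hl, hs⟩ := Finset.exists_ne_zero_of_sum_ne_zero hs
  rw [LC.coeff_mul_uPow, LC.coeff_algebraMap_mul] at hs
  exact Set.mem_biUnion (Finset.mem_coe.2 hl) ⟨_, right_ne_zero_of_mul hs, sub_add_cancel _ _⟩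

/-- The span of the vectors `v ⊗ w` where `v`, `w` are `l`-weight vectors whose weights combine
to `p`. -/
noncomputable def tensorLwt (ρ₁ : Ut D →ₐ[ℂ] Module.End ℂ V₁)
    (ρ₂ : Ut' D →ₐ[LC] Module.End LC V₂)
    (p : Module.Dual ℚ H × (ℤˣ → Fin n → ℕ → LC)) : Submodule LC (iTensor V₁ V₂) :=
  Submodule.span LC {y | ∃ p₁ ∈ Pl D, ∃ p₂ ∈ Plu D,
    ∃ v ∈ lwt D (ρ₁ : Ut D →+* Module.End ℂ V₁) p₁.1 p₁.2,
    ∃ w ∈ lwt D (uAct D ρ₂) p₂.1 p₂.2, v ≠ 0 ∧ w ≠ 0 ∧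
      p = (p₁.1 + p₂.1, twistedMul p₁.2 p₂.2) ∧ y = pureTensor v w}

/-- Both factors are spanned by `l`-weight vectors, the first because `ℂ` is algebraically closed
and the second by `InO'`; pure tensors are bilinear. -/
theorem iSup_tensorLwt (h₁ : InO D ρ₁) (h₂ : InO' D ρ₂) : ⨆ p, tensorLwt ρ₁ ρ₂ p = ⊤ := by
  have hv : ∀ v : V₁, v ∈ ⨆ p : Module.Dual ℚ H × (ℤˣ → Fin n → ℕ → ℂ),
      lwt D (ρ₁ : Ut D →+* Module.End ℂ V₁) p.1 p.2 := by
    intro v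
    have h : v ∈ ⨆ ω, wt D (ρ₁ : Ut D →+* Module.End ℂ V₁) ω := by
      rw [show ⨆ ω, wt D (ρ₁ : Ut D →+* Module.End ℂ V₁) ω = ⊤ from h₁.iSup_eq_top]
      exact Submodule.mem_top
    refine (iSup_le fun ω => ?_ : (⨆ ω, wt _ _ ω) ≤ _) h
    have : Module.Finite ℂ (wt D (ρ₁ : Ut D →+* Module.End ℂ V₁) ω) := h₁.finite ω
    exact (wt_le_iSup_lwt D _ ω).trans
      (iSup_le fun γ => le_iSup_of_le (ω, γ) le_rfl)
  have hw : ∀ w : V₂, w ∈ ⨆ p : Plu D, lwt D (uAct D ρ₂) p.1.1 p.1.2 := by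
    intro w
    have h : w ∈ ⨆ ω, wt D (uAct D ρ₂) ω := by
      rw [show ⨆ ω, wt D (uAct D ρ₂) ω = ⊤ from h₂.weights.iSup_eq_top]
      exact Submodule.mem_top
    refine (iSup_le fun ω => ?_ : (⨆ ω, wt _ _ ω) ≤ _) h
    rw [show wt D (uAct D ρ₂) ω = _ from (h₂.lu_iSup ω).symm]
    exact iSup_le fun Ψ => le_iSup_of_le ⟨(ω, Ψ.1), Ψ.2⟩ le_rfl
  have key : ∀ (v : V₁) (w : V₂), pureTensor v w ∈ ⨆ p, tensorLwt ρ₁ ρ₂ p := by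
    intro v w
    refine Submodule.iSup_induction _ (motive := fun v => pureTensor v w ∈ ⨆ p, tensorLwt ρ₁ ρ₂ p)
      (hv v) (fun p₁ v hv => ?_) ?_ fun v v' h h' => ?_
    · refine Submodule.iSup_induction _
        (motive := fun w => pureTensor v w ∈ ⨆ p, tensorLwt ρ₁ ρ₂ p)
        (hw w) (fun p₂ w hw => ?_) ?_ fun w w' h h' => ?_
      · rcases eq_or_ne v 0 with rfl | hv0
        · rw [pureTensor_zero_left]
          exact Submodule.zero_mem _
        rcases eq_or_ne w 0 with rfl | hw0
        · rw [pureTensor_zero_right]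
          exact Submodule.zero_mem _
        -- On the first factor, compatibility is automatic for nonzero vectors; on the second, `p₂`
        -- already ranges over `Plu D`.
        exact Submodule.mem_iSup_of_mem (p₁.1 + p₂.1.1, twistedMul p₁.2 p₂.1.2)
          (Submodule.subset_span ⟨p₁, compatible_of_mem_lwt D _ hv hv0, p₂.1, p₂.2, v, hv, w, hw,
            hv0, hw0, rfl, rfl⟩)
      · rw [pureTensor_zero_right]
        exact Submodule.zero_mem _
      · rw [pureTensor_add_right]
        exact Submodule.add_mem _ h h'
    · rw [pureTensor_zero_left]
      exact Submodule.zero_mem _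
    · rw [pureTensor_add_left]
      exact Submodule.add_mem _ h h'
  rw [eq_top_iff, ← (tensorBasis (Module.Basis.ofVectorSpace ℂ V₁)
    (Module.Basis.ofVectorSpace LC V₂)).span_eq, Submodule.span_le]
  rintro _ ⟨p, rfl⟩
  rw [tensorBasis_apply]
  exact key _ _

/-- This excludes further `l,u`-weights: the spans lie in the independent `l`-weight spaces and fill
the module, so they leave no room for other vectors. -/
theorem IsDefinedBy.tensorLwt_eq (hτ : IsDefinedBy D (coproduct D) (iRep D ρ₁) ρ₂ τ)
    (h₁ : InO D ρ₁) (h₂ : InO' D ρ₂)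
    (h : InOWeights (V := iTensor V₁ V₂) D LC fun h => uAct (V := iTensor V₁ V₂) D τ (Ut.k D h))
    (p : Module.Dual ℚ H × (ℤˣ → Fin n → ℕ → LC)) :
    tensorLwt ρ₁ ρ₂ p = lwt (V := iTensor V₁ V₂) D (uAct (V := iTensor V₁ V₂) D τ) p.1 p.2 := by
  refine eq_lwt_of_le (V := iTensor V₁ V₂) (N := tensorLwt ρ₁ ρ₂) (fun p => Submodule.span_le.2 ?_)
    (iSup_tensorLwt h₁ h₂) p
  rintro _ ⟨p₁, _, p₂, _, v, hv, w, hw, _, _, rfl, rfl⟩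
  have := h.finite (p₁.1 + p₂.1)
  exact hτ.pureTensor_mem_lwt hv hw

theorem tensorLwt_ne_bot {p : Module.Dual ℚ H × (ℤˣ → Fin n → ℕ → LC)}
    (hp : tensorLwt ρ₁ ρ₂ p ≠ ⊥) : ∃ p₁ ∈ lWeights D ρ₁, ∃ p₂ ∈ luWeights D ρ₂,
      p = (p₁.1 + p₂.1, twistedMul p₁.2 p₂.2) := by
  rw [tensorLwt, Ne, Submodule.span_eq_bot] at hp
  push Not at hp
  obtain ⟨y, ⟨p₁, h₁, p₂, h₂, v, hv, w, hw, hv0, hw0, hp, _⟩, _⟩ := hp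
  exact ⟨p₁, ⟨h₁, fun h => hv0 ((Submodule.eq_bot_iff _).1 h v hv)⟩,
    p₂, ⟨h₂, fun h => hw0 ((Submodule.eq_bot_iff _).1 h w hw)⟩, hp⟩

theorem IsDefinedBy.luWeights_eq (hτ : IsDefinedBy D (coproduct D) (iRep D ρ₁) ρ₂ τ)
    (h₁ : InO D ρ₁) (h₂ : InO' D ρ₂)
    (h : InOWeights (V := iTensor V₁ V₂) D LC fun h => uAct (V := iTensor V₁ V₂) D τ (Ut.k D h)) :
    luWeights (V := iTensor V₁ V₂) D τ =
      {p | ∃ p₁ ∈ lWeights D ρ₁, ∃ p₂ ∈ luWeights D ρ₂,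
        p = (p₁.1 + p₂.1, twistedMul p₁.2 p₂.2)} := by
  ext p
  constructor
  · rintro ⟨_, hp⟩
    refine tensorLwt_ne_bot ?_
    rw [hτ.tensorLwt_eq h₁ h₂ h]
    exact hp
  · rintro ⟨p₁, hp₁, p₂, hp₂, rfl⟩
    refine ⟨twistedMul_mem_Plu hp₁.1 hp₂.1, fun h0 => ?_⟩
    obtain ⟨v, hv, hv0⟩ := Submodule.exists_mem_ne_zero_of_ne_bot hp₁.2
    obtain ⟨w, hw, hw0⟩ := Submodule.exists_mem_ne_zero_of_ne_bot hp₂.2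
    have := h.finite (p₁.1 + p₂.1)
    exact pureTensor_ne_zero hv0 hw0
      ((Submodule.eq_bot_iff _).1 h0 _ (hτ.pureTensor_mem_lwt hv hw))

theorem IsDefinedBy.inO' (hτ : IsDefinedBy D (coproduct D) (iRep D ρ₁) ρ₂ τ)
    (h₁ : InO D ρ₁) (h₂ : InO' D ρ₂)
    (h : InOWeights (V := iTensor V₁ V₂) D LC fun h => uAct (V := iTensor V₁ V₂) D τ (Ut.k D h)) :
    InO' (V := iTensor V₁ V₂) D τ := by
  refine inO'_of_iSup_lwt (V := iTensor V₁ V₂) h ?_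
  rw [eq_top_iff, ← iSup_tensorLwt h₁ h₂]
  refine iSup_le fun p => ?_
  by_cases hp : tensorLwt ρ₁ ρ₂ p = ⊥
  · rw [hp]
    exact bot_le
  · obtain ⟨p₁, hp₁, p₂, hp₂, rfl⟩ := tensorLwt_ne_bot hp
    rw [hτ.tensorLwt_eq h₁ h₂ h]
    exact le_iSup_of_le (⟨_, twistedMul_mem_Plu hp₁.1 hp₂.1⟩ : Plu D) le_rfl

/-- The tensor product of a module in `𝒪` and a module in `𝒪^R`. -/
theorem exists_tensorModule (ρ₁ : Ut D →ₐ[ℂ] Module.End ℂ V₁)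
    (ρ₂ : Ut' D →ₐ[LC] Module.End LC V₂) (R : ℕ) (h₁ : InO D ρ₁) (h₂ : InOR D R ρ₂) :
    ∃ τ : Ut' D →ₐ[LC] Module.End LC (iTensor V₁ V₂),
      IsDefinedBy D (coproduct D) (iRep D ρ₁) ρ₂ τ ∧
      (∀ τ', IsDefinedBy D (coproduct D) (iRep D ρ₁) ρ₂ τ' → τ' = τ) ∧
      InOR (V := iTensor V₁ V₂) D (R + 1) τ ∧
      luWeights (V := iTensor V₁ V₂) D τ =
        {p | ∃ p₁ ∈ lWeights D ρ₁, ∃ p₂ ∈ luWeights D ρ₂,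
          p = (p₁.1 + p₂.1, twistedMul p₁.2 p₂.2)} := by
  have hfin (ω) : Module.Finite ℂ (wt D (ρ₁ : Ut D →+* Module.End ℂ V₁) ω) := h₁.finite ω
  obtain ⟨B₁, hB₁⟩ := exists_wtBasis D (ρ₁ : Ut D →+* Module.End ℂ V₁) h₁.indep h₁.iSup_eq_top
    fun ω => Module.finBasis ℂ _
  have hm₁ (p) : B₁ p ∈ wt D (ρ₁ : Ut D →+* Module.End ℂ V₁) p.1 := by
    rw [hB₁]
    exact Subtype.coe_prop _
  obtain ⟨d₂, B₂, hB₂⟩ := InOR.exists_isRBasis D h₂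
  obtain ⟨τ, hτ⟩ := exists_isDefinedBy_coproduct hm₁ (finite_sigma_fst_eq _) hB₂
  obtain ⟨S₁, hS₁⟩ := InOWeights.exists_inCone h₁ hm₁
  obtain ⟨S₂, hS₂⟩ := InOWeights.exists_inCone h₂.inO'.weights hB₂.mem_wt
  have hR := hτ.isRBasis hm₁ (finite_sigma_fst_eq _) hB₂
    (finite_fibre_add D (finite_sigma_fst_eq _) hB₂.finite hS₁ hS₂)
  classical
  -- Sums of vertices of the cones for the two factors serve as vertices for the tensor product.
  have hW : InOWeights (V := iTensor V₁ V₂) D LC fun h => uAct (V := iTensor V₁ V₂) D τ (Ut.k D h) :=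
    inOWeights_of_basis hR.mem_wt hR.finite (S := Finset.image₂ (· + ·) S₁ S₂) fun p => by
      obtain ⟨μ, hμ, h⟩ := hS₁ p.1
      obtain ⟨ν, hν, h'⟩ := hS₂ p.2
      exact ⟨μ + ν, Finset.mem_image₂_of_mem hμ hν, h.add D h'⟩
  exact ⟨τ, hτ, fun τ' h => h.unique D _ _ hτ, hR.inOR (hτ.inO' h₁ h₂.inO' hW),
    hτ.luWeights_eq h₁ h₂.inO' hW⟩

end LWeights

end QAff

theorem mainTheorem6 {n : ℕ} {H : Type*} [AddCommGroup H] [Module ℚ H] (D : QAff.Datum n H) :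
    ∃ Δ : QAff.Ut' D →ₐ[QAff.LC] QAff.UtCompl D,
      QAff.IsDrinfeldCoproduct D Δ ∧
      (∀ Δ' : QAff.Ut' D →ₐ[QAff.LC] QAff.UtCompl D, QAff.IsDrinfeldCoproduct D Δ' → Δ' = Δ) ∧
      ∀ {V₁ : Type*} [AddCommGroup V₁] [Module ℂ V₁]
        {V₂ : Type*} [AddCommGroup V₂] [Module QAff.LC V₂]
        (ρ₁ : QAff.Ut D →ₐ[ℂ] Module.End ℂ V₁)
        (ρ₂ : QAff.Ut' D →ₐ[QAff.LC] Module.End QAff.LC V₂) (R : ℕ),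
        QAff.InO D ρ₁ → QAff.InOR D R ρ₂ →
        ∃ τ : QAff.Ut' D →ₐ[QAff.LC] Module.End QAff.LC (QAff.iTensor V₁ V₂),
          QAff.IsDefinedBy D Δ (QAff.iRep D ρ₁) ρ₂ τ ∧
          (∀ τ', QAff.IsDefinedBy D Δ (QAff.iRep D ρ₁) ρ₂ τ' → τ' = τ) ∧
          QAff.InOR (V := QAff.iTensor V₁ V₂) D (R + 1) τ ∧
          QAff.luWeights (V := QAff.iTensor V₁ V₂) D τ =
            {p | ∃ p₁ ∈ QAff.lWeights D ρ₁, ∃ p₂ ∈ QAff.luWeights D ρ₂,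
              p = (p₁.1 + p₂.1, QAff.twistedMul p₁.2 p₂.2)} :=
  ⟨QAff.coproduct D, QAff.isDrinfeldCoproduct_coproduct D,
    fun _ h => QAff.IsDrinfeldCoproduct.eq D h (QAff.isDrinfeldCoproduct_coproduct D),
    fun ρ₁ ρ₂ R h₁ h₂ => QAff.exists_tensorModule ρ₁ ρ₂ R h₁ h₂⟩
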